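/- **Setting.** Let $q_1\in\mathbb R^3\setminus\{0\}$, let $S_0,S_1:\mathbb R^3\to\mathbb C$, and let $\alpha_\varepsilon>0$ with $\alpha_\varepsilon\to0$ as $\varepsilon\to0^+$. For small $\varepsilon>0$ let $u^\varepsilon\in L^2(\mathbb R^3)$ be the solution (in the sense of distributions) of the Helmholtz equation $$-i\frac{\alpha_\varepsilon}{\varepsilon}u^\varepsilon+\Delta u^\varepsilon+\frac1{\varepsilon^2}u^\varepsilon=\frac1{\varepsilon^3}S_0\Big(\frac x\varepsilon\Big)+\frac1{\varepsilon^3}S_1\Big(\frac{x-q_1}\varepsilon\Big)\qquad\text{on }\mathbb R^3 .$$ The Fourier transform is $\hat f(\xi)=(2\pi)^{-3}\int_{\mathbb R^3}e^{-ix\cdot\xi}f(x)\,dx$, the Wigner transform is $$W^\varepsilon(x,\xi)=(2\pi)^{-3}\int_{\mathbb R^3}e^{-iy\cdot\xi}\,u^\varepsilon\big(x+\tfrac\varepsilon2y\big)\,\overline{u^\varepsilon\big(x-\tfrac\varepsilon2y\big)}\,dy ,$$ and $\|f\|_B=\sum_{j\ge-1}\big(2^{j+1}\int_{C(j)}|f|^2dx\big)^{1/2}$,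 where $C(-1)$ is the unit ball and $C(j)=\{2^j\le|x|<2^{j+1}\}$ for $j\ge0$; $B$ is the space of functions for which this norm is finite. Put $\langle x\rangle=(1+|x|^2)^{1/2}$. A Wigner measure of $(u^\varepsilon)$ is a positive Radon measure $\mu$ on $\mathbb R^3_x\times\mathbb R^3_\xi$ such that, along some sequence $\varepsilon_k\to0^+$, $\int W^{\varepsilon_k}\varphi\,dx\,d\xi\to\int\varphi\,d\mu$ for all $\varphi\in C_c^\infty(\mathbb R^6)$. **Theorem.** Assume that * (H1) for some $\gamma>0$, $\alpha_\varepsilon\ge\varepsilon^\gamma$ for all small $\varepsilon>0$; * (H2) $S_0,S_1\in B$; * (H3) $\langle x\rangle^NS_0,\ \langle x\rangle^NS_1\in L^2(\mathbb R^3)$ for some $N>\frac12+\frac{3\gamma}{\gamma+1}$. Then $\widehat{S_0}$ and $\widehat{S_1}$ have traces in $L^2$ of the unit sphere $\{|\xi|=1\}$ (the continuous extension to $B$ of the restriction of the Fourier transform to the sphere), and every Wigner measure $\mu$ of $(u^\varepsilon)$ satisfies, in the sense of distributions on $\mathbb R^6$, the transport equation $$\xi\cdot\nabla_x\mu=Q,\qquad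 Q:=-8\pi^4\Big(\delta(x)\,|\widehat{S_0}(\xi)|^2+\delta(x-q_1)\,|\widehat{S_1}(\xi)|^2\Big)\,\delta(|\xi|^2-1),$$ where $\delta(|\xi|^2-1)=\frac12\,d\sigma(\xi)$ and $\sigma$ is the surface measure of the unit sphere. (Equivalently, with the unnormalized transform $\widetilde{S_j}=(2\pi)^3\widehat{S_j}$, $Q=-\frac1{(4\pi)^2}\big(\delta(x)|\widetilde{S_0}(\xi)|^2+\delta(x-q_1)|\widetilde{S_1}(\xi)|^2\big)\,d\sigma(\xi)$.) Moreover, $\mu$ is the solution of this equation selected by the following radiation condition: for every $R\in C_c^\infty(\mathbb R^6)$, with $g(x,\xi)=\int_0^\infty R(x-\xi t,\xi)\,dt$, $$\int_{\mathbb R^6}R\,d\mu=-\int_{\mathbb R^6}Q\,g ,$$ with no restriction on the support of $R$ (which may contain points with $\xi=0$). -/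

import Mathlib

open MeasureTheory Filter Topology Metric
open scoped ContDiff ENNReal Laplacian

noncomputable section

namespace TwoSource

/-- Physical space (and frequency space): three-dimensional Euclidean space. -/
abbrev E : Type := EuclideanSpace ℝ (Fin 3)

/-- Complex-valued smooth functions with compact support. -/
def IsTestFunction {F : Type*} [NormedAddCommGroup F] [NormedSpace ℝ F] (φ : F → ℂ) : Prop :=
  ContDiff ℝ ∞ φ ∧ HasCompactSupport φ

/-- The Fourier transform `(2π)⁻³ ∫ exp (-i x·ξ) f x dx` of an integrable function. -/
def fourier (f : E → ℂ) (ξ : E) : ℂ :=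
  ((2 * Real.pi : ℝ) : ℂ)⁻¹ ^ 3 *
    ∫ x : E, Complex.exp (-Complex.I * ((inner ℝ x ξ : ℝ) : ℂ)) * f x

/-- The Wigner transform at scale `ε`: the Fourier transform in `y` of
`u (x + ε y / 2) * conj (u (x - ε y / 2))`. For `u` in `L²` the integrand is integrable for
every `x`, and the result is a bounded continuous function of `(x, ξ)`. -/
def wigner (ε : ℝ) (u : E → ℂ) (x ξ : E) : ℂ :=
  fourier (fun y => u (x + (ε / 2) • y) * (starRingEnd ℂ) (u (x - (ε / 2) • y))) ξ

/-- `μ` is the Wigner measure of the family `u` along the sequence of scales `e`: it is a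
positive Radon measure on phase space, and the Wigner transforms converge to it when tested
against smooth compactly supported functions. -/
structure IsWignerMeasure (u : ℝ → E → ℂ) (e : ℕ → ℝ) (μ : Measure (E × E)) : Prop where
  locallyFinite : IsLocallyFiniteMeasure μ
  tendsto : ∀ φ : E × E → ℂ, IsTestFunction φ →
    Tendsto (fun k => ∫ p : E × E, wigner (e k) (u (e k)) p.1 p.2 * φ p) atTop
      (𝓝 (∫ p, φ p ∂μ))

/-- The dyadic rings, with the index shifted by one: `ring 0` is the unit ball and
`ring (j + 1) = {2 ^ j ≤ |x| < 2 ^ (j + 1)}`. -/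
def ring : ℕ → Set E
  | 0 => {x | ‖x‖ < 1}
  | j + 1 => {x | 2 ^ j ≤ ‖x‖ ∧ ‖x‖ < 2 ^ (j + 1)}

/-- The Agmon-Hörmander norm `∑_{j ≥ -1} (2 ^ (j + 1) ∫_{C(j)} |f|²)^{1/2}` (here `n = j + 1`),
with values in `[0, ∞]`. -/
def normB (f : E → ℂ) : ℝ≥0∞ :=
  ∑' n : ℕ, ((2 : ℝ≥0∞) ^ n * ∫⁻ x in ring n, ‖f x‖ₑ ^ 2) ^ (1 / 2 : ℝ)

/-- The Agmon-Hörmander space `B`. -/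
def MemB (f : E → ℂ) : Prop :=
  AEStronglyMeasurable f volume ∧ normB f < ⊤

/-- The bracket `(1 + |x|²)^{1/2}`. -/
def bracket (x : E) : ℝ := √(1 + ‖x‖ ^ 2)

/-- The source with profiles `S₀` at the origin and `S₁` at `q₁`, concentrated at scale `ε`. -/
def source (S₀ S₁ : E → ℂ) (q₁ : E) (ε : ℝ) (x : E) : ℂ :=
  ((ε : ℂ) ^ 3)⁻¹ * S₀ (ε⁻¹ • x) + ((ε : ℂ) ^ 3)⁻¹ * S₁ (ε⁻¹ • (x - q₁))

/-- `u` is an `L²` solution, in the sense of distributions on the whole space, of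
`-i (a / ε) u + Δ u + u / ε² = S`. -/
def IsHelmholtzSolution (ε a : ℝ) (S u : E → ℂ) : Prop :=
  MemLp u 2 volume ∧
    ∀ φ : E → ℂ, IsTestFunction φ →
      ∫ x, u x * (-Complex.I * ((a / ε : ℝ) : ℂ) * φ x + Δ φ x + ((1 / ε ^ 2 : ℝ) : ℂ) * φ x) =
        ∫ x, S x * φ x

/-- The measure `δ(|ξ|² - 1)`. The gradient of `|ξ|² - 1` has length `2` on the unit sphere, so
this is one half of the surface measure of the unit sphere. -/
def deltaSphere : Measure E :=
  (2 : ℝ≥0∞)⁻¹ • Measure.map ((↑) : sphere (0 : E) 1 → E) (volume : Measure E).toSphere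

/-- `T` is the trace on the unit sphere of the Fourier transform of `S ∈ B`: the value at `S` of
the continuous extension to `B`, with values in `L²` of the sphere, of the map which restricts
the Fourier transform of an integrable function to the sphere. It is unique up to a null set of
the sphere, and if `S` is itself integrable, it is the restriction of `fourier S`. -/
def IsFourierTrace (S T : E → ℂ) : Prop :=
  MemLp T 2 deltaSphere ∧
    ∀ f : ℕ → E → ℂ, (∀ n, Integrable (f n) volume) →
      Tendsto (fun n => normB (fun x => f n x - S x)) atTop (𝓝 0) →
      Tendsto (fun n => eLpNorm (fun ξ => fourier (f n) ξ - T ξ) 2 deltaSphere) atTop (𝓝 0)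

/-- The pairing with a function `ψ` on phase space of the distribution
`Q = -8π⁴ (δ(x) |T₀(ξ)|² + δ(x - q₁) |T₁(ξ)|²) δ(|ξ|² - 1)`. -/
def pairQ (q₁ : E) (T₀ T₁ : E → ℂ) (ψ : E × E → ℂ) : ℂ :=
  -((8 * Real.pi ^ 4 : ℝ) : ℂ) *
    ((∫ ξ, ((‖T₀ ξ‖ ^ 2 : ℝ) : ℂ) * ψ (0, ξ) ∂deltaSphere) +
      ∫ ξ, ((‖T₁ ξ‖ ^ 2 : ℝ) : ℂ) * ψ (q₁, ξ) ∂deltaSphere)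

/-- The derivative `ξ · ∇ₓ ψ (x, ξ)`. -/
def transport (ψ : E × E → ℂ) (p : E × E) : ℂ :=
  fderiv ℝ ψ p (p.2, 0)

/-- The function `g (x, ξ) = ∫_0^∞ R (x - ξ t, ξ) dt`. -/
def rayIntegral (R : E × E → ℂ) (p : E × E) : ℂ :=
  ∫ t in Set.Ioi (0 : ℝ), R (p.1 - t • p.2, p.2)

end TwoSource

end

/-! In the variable `y = x/ε` the equation becomes `(Δ + 1 - iδ) v = S₀ + S₁(· - q₁/ε)` with `δ = ε
α_ε`. Solutions in `L²` are unique, so `u^ε` is the sum of a wave emitted from `0` and a wave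
emitted from `q₁`, and each can be studied alone. The absorption selects the square root `κ ≈ -1` of
`1 - iδ`, so a wave emitted from the origin oscillates like `e^{-i|x|/ε}`, with local frequency
`-x/|x|`.

Two facts about a single wave carry the proof. The first is a bound uniform in `δ`. A Morawetz
multiplier argument (`integral_weight_mul_energy_le`) and the duality defining `B` bound the
resolvent from `B` to `L²` with weight `R² (R² + |x|²)^{-3/2}`, with one constant for all `R ≥ 1`
and `0 < δ ≤ 1` (`eLpNorm_resolvent_weight_le`). Choosing `R = 1/ε` and scaling back places all the
waves in a bounded subset of a single Hilbert space, `WeightedL2`. The second fact is explicit. For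
a test function as source, the Green function (`schwartzResolvent_eq_integral`) shows that the wave
with its phase `e^{-i|x|/ε}` removed converges pointwise to `farField`, which is `-2π²/|x|` times
the Fourier transform of the source at `-x/|x|` (`tendsto_modulatedWave`).

The weighted norm of a far field is a fixed multiple of the `L²` norm on the sphere
(`lintegral_farField`). Hence the uniform bound passes to the limit and becomes the trace theorem on
`B`, and density then gives strong convergence of the amplitudes for every source in `B`
(`tendsto_amplitude`).

Tested against `φ`, the Wigner transform is a sesquilinear form in `u^ε` whose kernel is the Fourier
transform of `φ` in `ξ` (`integral_wigner_mul`). Such forms are bounded on `WeightedL2` uniformly in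
`ε` and in the phases (`IsKernel.exists_norm_wignerForm_le`), so strongly convergent amplitudes may
be replaced by fixed ones. In the two diagonal terms the phases combine into `e^{-iy·n}` with `n`
the unit vector away from the source, and Fourier inversion puts the mass `|farField|²` at `ξ = -n`
(`wignerForm_limitPhase`). The two cross terms keep a factor `e^{∓i(|x| - |x - q₁|)/ε}`. Since `|x|
- |x - q₁|` has an absolutely continuous distribution, the Riemann–Lebesgue lemma removes them
(`tendsto_wignerForm_of_ne`).

Polar coordinates turn the diagonal limits into integrals along rays
(`integral_normSq_farField_mul`), which is the radiation formula. It comes out for every test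
function at once, so `ξ = 0` needs no separate treatment. The transport equation is the special case
`R = ξ·∇ₓψ`, for which the ray integral is `ψ` itself on `|ξ| = 1`. -/

noncomputable section

namespace TwoSource

open scoped SchwartzMap LineDeriv FourierTransform

/-! ### The resolvent on Schwartz functions and on `L²` -/

/-- The Fourier symbol of the resolvent `(Δ + 1 - i δ)⁻¹`. -/
def symbol (δ : ℝ) (ξ : E) : ℂ :=
  (((1 + ‖(1 - (2 * Real.pi) ^ 2 * ‖ξ‖ ^ 2) / δ‖ ^ 2) ^ (-1 : ℝ) : ℝ) : ℂ) *
    ((((1 - (2 * Real.pi) ^ 2 * ‖ξ‖ ^ 2) / δ : ℝ) : ℂ) + Complex.I) * ((δ⁻¹ : ℝ) : ℂ)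

lemma symbol_mul {δ : ℝ} (hδ : 0 < δ) (ξ : E) :
    symbol δ ξ * (1 - Complex.I * δ - (2 * Real.pi) ^ 2 * (‖ξ‖ : ℂ) ^ 2) = 1 := by
  set s : ℝ := (1 - (2 * Real.pi) ^ 2 * ‖ξ‖ ^ 2) / δ with hs
  have h1 : (1 - Complex.I * δ - (2 * Real.pi) ^ 2 * (‖ξ‖ : ℂ) ^ 2) = δ * ((s : ℂ) - Complex.I) := by
    have : (δ : ℂ) ≠ 0 := by exact_mod_cast hδ.ne'
    rw [hs]; push_cast; field_simp; ring
  have h2 : symbol δ ξ = (((1 + s ^ 2)⁻¹ : ℝ) : ℂ) * ((s : ℂ) + Complex.I) * ((δ⁻¹ : ℝ) : ℂ) := by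
    simp only [symbol, ← hs, Real.rpow_neg_one, Real.norm_eq_abs, sq_abs]
  have h3 : ((1 : ℂ) + (s : ℂ) ^ 2) ≠ 0 := by
    have : (0 : ℝ) < 1 + s ^ 2 := by positivity
    exact_mod_cast this.ne'
  have h4 : (δ : ℂ) ≠ 0 := by exact_mod_cast hδ.ne'
  rw [h1, h2]; push_cast; field_simp
  ring_nf; simp; ring

/-- This is why `symbol` is written as `(s + i) / (δ (1 + s²))` with `s` real, and not as the
reciprocal `1 / (δ (s - i))`: a power of `1 + s²` composed with a polynomial is visibly of temperate
growth. -/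
lemma hasTemperateGrowth_symbol (δ : ℝ) : (symbol δ).HasTemperateGrowth := by
  have h0 : (fun ξ : E => (1 - (2 * Real.pi) ^ 2 * ‖ξ‖ ^ 2) / δ).HasTemperateGrowth := by
    simp only [div_eq_mul_inv]
    fun_prop
  have h1 := (Function.hasTemperateGrowth_one_add_norm_sq_rpow ℝ (-1)).comp h0
  have h2 := Function.Complex.hasTemperateGrowth_ofReal.comp h1
  have h3 := Function.Complex.hasTemperateGrowth_ofReal.comp h0
  exact (h2.mul (h3.add (.const Complex.I))).mul (.const ((δ⁻¹ : ℝ) : ℂ))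

/-- The denominator has imaginary part `-δ`. The bound blows up as `δ → 0`. It serves only to define
the resolvent on `L²` for fixed `δ`; uniformity comes from the Morawetz estimate. -/
lemma norm_symbol_le {δ : ℝ} (hδ : 0 < δ) (ξ : E) : ‖symbol δ ξ‖ ≤ δ⁻¹ := by
  have h := congrArg norm (symbol_mul hδ ξ)
  rw [norm_mul, norm_one] at h
  have h2 : δ ≤ ‖(1 - Complex.I * δ - (2 * Real.pi) ^ 2 * (‖ξ‖ : ℂ) ^ 2)‖ := by
    have := Complex.abs_im_le_norm (1 - Complex.I * δ - (2 * Real.pi) ^ 2 * (‖ξ‖ : ℂ) ^ 2)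
    have e : (1 - Complex.I * δ - (2 * Real.pi) ^ 2 * (‖ξ‖ : ℂ) ^ 2)
      = ((1 - (2 * Real.pi) ^ 2 * ‖ξ‖ ^ 2 : ℝ) : ℂ) - Complex.I * δ := by push_cast; ring
    rw [e] at this ⊢
    simp only [Complex.sub_im, Complex.ofReal_im, Complex.mul_im, Complex.I_re, Complex.I_im,
      Complex.ofReal_re, zero_mul, one_mul, zero_sub, zero_add, abs_neg, abs_of_pos hδ] at this
    exact this
  rw [le_inv_comm₀ _ hδ]
  · rw [← one_div, le_div_iff₀]
    · nlinarith [norm_nonneg (symbol δ ξ)]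
    · by_contra h0
      have : ‖symbol δ ξ‖ = 0 := le_antisymm (not_lt.1 h0) (norm_nonneg _)
      simp [this] at h
  · by_contra h0
    have : ‖symbol δ ξ‖ = 0 := le_antisymm (not_lt.1 h0) (norm_nonneg _)
    simp [this] at h

/-- The operator `Δ + 1 - i δ` on Schwartz functions. -/
def helmholtz (δ : ℝ) (f : 𝓢(E, ℂ)) : 𝓢(E, ℂ) := Δ f + (1 - Complex.I * δ) • f

/-- The resolvent `(Δ + 1 - i δ)⁻¹` on Schwartz functions. -/
def schwartzResolvent (δ : ℝ) : 𝓢(E, ℂ) →L[ℂ] 𝓢(E, ℂ) :=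
  SchwartzMap.fourierMultiplierCLM ℂ (symbol δ)

lemma hasTemperateGrowth_multiplier (δ : ℝ) :
    (fun ξ : E => 1 - Complex.I * δ - (2 * Real.pi) ^ 2 * (‖ξ‖ : ℂ) ^ 2).HasTemperateGrowth := by
  have hc : (fun ξ : E => (‖ξ‖ : ℂ) ^ 2).HasTemperateGrowth := by
    have := Function.Complex.hasTemperateGrowth_ofReal.comp (Function.hasTemperateGrowth_norm_sq E)
    simpa only [Function.comp_def, Complex.ofReal_pow] using this
  exact (Function.HasTemperateGrowth.const _).sub ((Function.HasTemperateGrowth.const _).mul hc)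

/-- The factor `(2π)²` reflects the kernel `e^{-2πi x·ξ}` of `𝓕`, which differs from the
normalization of `fourier`. -/
lemma helmholtz_eq (δ : ℝ) (f : 𝓢(E, ℂ)) :
    helmholtz δ f = SchwartzMap.fourierMultiplierCLM ℂ
      (fun ξ : E => 1 - Complex.I * δ - (2 * Real.pi) ^ 2 * (‖ξ‖ : ℂ) ^ 2) f := by
  have hc : (fun ξ : E => (‖ξ‖ : ℂ) ^ 2).HasTemperateGrowth := by
    have := Function.Complex.hasTemperateGrowth_ofReal.comp (Function.hasTemperateGrowth_norm_sq E)
    simpa only [Function.comp_def, Complex.ofReal_pow] using this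
  have hm : (fun ξ : E => (2 * Real.pi : ℂ) ^ 2 * (‖ξ‖ : ℂ) ^ 2).HasTemperateGrowth :=
    (Function.HasTemperateGrowth.const _).mul hc
  have e1 : SchwartzMap.fourierMultiplierCLM ℂ (fun ξ : E => ‖ξ‖ ^ 2) f =
      SchwartzMap.fourierMultiplierCLM ℂ (fun ξ : E => (‖ξ‖ : ℂ) ^ 2) f := by
    rw [← SchwartzMap.fourierMultiplierCLM_ofReal ℂ (Function.hasTemperateGrowth_norm_sq E)]
    simp
  have e2 : (fun ξ : E => (2 * Real.pi : ℂ) ^ 2 * (‖ξ‖ : ℂ) ^ 2) =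
      (2 * Real.pi : ℂ) ^ 2 • (fun ξ : E => (‖ξ‖ : ℂ) ^ 2) := by
    ext; simp
  have e3 : (fun ξ : E => 1 - Complex.I * δ - (2 * Real.pi) ^ 2 * (‖ξ‖ : ℂ) ^ 2) =
      (fun ξ : E => 1 - Complex.I * δ) - fun ξ : E => (2 * Real.pi) ^ 2 * (‖ξ‖ : ℂ) ^ 2 := rfl
  rw [helmholtz, SchwartzMap.laplacian_eq_fourierMultiplierCLM]
  change -(2 * Real.pi) ^ 2 • SchwartzMap.fourierMultiplierCLM ℂ (fun ξ : E => ‖ξ‖ ^ 2) f + _ = _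
  rw [e1, SchwartzMap.fourierMultiplierCLM_apply (fun ξ : E => 1 - Complex.I * δ - _), e3,
    SchwartzMap.smulLeftCLM_sub (.const _) hm, e2, SchwartzMap.smulLeftCLM_smul hc,
    SchwartzMap.fourierMultiplierCLM_apply]
  have e4 : 𝓕⁻ ((SchwartzMap.smulLeftCLM ℂ (fun _ : E => 1 - Complex.I * (δ : ℂ)) -
      (2 * Real.pi : ℂ) ^ 2 • SchwartzMap.smulLeftCLM ℂ (fun ξ : E => (‖ξ‖ : ℂ) ^ 2)) (𝓕 f)) =
      (1 - Complex.I * (δ : ℂ)) • f - (2 * Real.pi : ℂ) ^ 2 •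
        𝓕⁻ (SchwartzMap.smulLeftCLM ℂ (fun ξ : E => (‖ξ‖ : ℂ) ^ 2) (𝓕 f)) := by
    change FourierTransform.fourierInvCLM ℂ 𝓢(E, ℂ) _ = _ - _ • FourierTransform.fourierInvCLM ℂ 𝓢(E, ℂ) _
    rw [sub_apply, map_sub, smul_apply, map_smul, SchwartzMap.smulLeftCLM_const, smul_apply,
      map_smul]
    simp
  rw [e4]
  ext x
  simp
  ring

lemma helmholtz_schwartzResolvent {δ : ℝ} (hδ : 0 < δ) (f : 𝓢(E, ℂ)) :
    helmholtz δ (schwartzResolvent δ f) = f := by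
  rw [helmholtz_eq, schwartzResolvent,
    SchwartzMap.fourierMultiplierCLM_fourierMultiplierCLM_apply (hasTemperateGrowth_multiplier δ)
      (hasTemperateGrowth_symbol δ)]
  have : (fun ξ : E => 1 - Complex.I * δ - (2 * Real.pi) ^ 2 * (‖ξ‖ : ℂ) ^ 2) * symbol δ =
      fun _ => 1 := funext fun ξ => (mul_comm _ _).trans (symbol_mul hδ ξ)
  rw [this, SchwartzMap.fourierMultiplierCLM_const]
  simp

lemma norm_toLp_schwartzResolvent_le {δ : ℝ} (hδ : 0 < δ) (f : 𝓢(E, ℂ)) :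
    ‖(schwartzResolvent δ f).toLp 2 volume‖ ≤ δ⁻¹ * ‖f.toLp 2 volume‖ := by
  rw [← SchwartzMap.norm_fourier_toL2_eq, ← SchwartzMap.norm_fourier_toL2_eq f]
  have h : 𝓕 (schwartzResolvent δ f) = SchwartzMap.smulLeftCLM ℂ (symbol δ) (𝓕 f) := by
    rw [schwartzResolvent, SchwartzMap.fourierMultiplierCLM_apply]
    simp
  rw [h]
  refine Lp.norm_le_mul_norm_of_ae_le_mul ?_
  filter_upwards [SchwartzMap.coeFn_toLp (𝓕 f) 2 volume,
    SchwartzMap.coeFn_toLp (SchwartzMap.smulLeftCLM ℂ (symbol δ) (𝓕 f)) 2 volume] with ξ h1 h2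
  rw [h1, h2, SchwartzMap.smulLeftCLM_apply_apply (hasTemperateGrowth_symbol δ), norm_smul]
  gcongr
  exact norm_symbol_le hδ ξ

/-- The resolvent `(Δ + 1 - i δ)⁻¹` on `L²`. -/
def resolvent (δ : ℝ) : Lp ℂ 2 (volume : Measure E) →L[ℂ] Lp ℂ 2 (volume : Measure E) :=
  ((SchwartzMap.toLpCLM ℂ ℂ 2 volume).toLinearMap ∘ₗ
    (schwartzResolvent δ).toLinearMap).extendOfNorm (SchwartzMap.toLpCLM ℂ ℂ 2 volume).toLinearMap

lemma denseRange_schwartz_toLp :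
    DenseRange (SchwartzMap.toLpCLM ℂ ℂ 2 (volume : Measure E)).toLinearMap :=
  SchwartzMap.denseRange_toLpCLM (F := ℂ) (μ := (volume : Measure E)) (by simp)

lemma resolvent_toLp {δ : ℝ} (hδ : 0 < δ) (f : 𝓢(E, ℂ)) :
    resolvent δ (f.toLp 2 volume) = (schwartzResolvent δ f).toLp 2 volume :=
  LinearMap.extendOfNorm_eq denseRange_schwartz_toLp
    ⟨δ⁻¹, fun f => norm_toLp_schwartzResolvent_le hδ f⟩ f

/-! ### Weak solutions and their uniqueness -/

/-- `v` solves `Δ v + v - i δ v = f` in the sense of distributions. -/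
def IsWeakSolution (δ : ℝ) (f v : E → ℂ) : Prop :=
  ∀ φ : E → ℂ, IsTestFunction φ →
    ∫ x, v x * (Δ φ x + (1 - Complex.I * δ) * φ x) = ∫ x, f x * φ x

lemma integrable_mul_schwartz {w : E → ℂ} (hw : MemLp w 2 volume) (φ : 𝓢(E, ℂ)) :
    Integrable (fun x => w x * φ x) :=
  hw.integrable_mul (φ.memLp 2 volume)

lemma helmholtz_apply (δ : ℝ) (φ : 𝓢(E, ℂ)) (x : E) :
    helmholtz δ φ x = Δ (φ : E → ℂ) x + (1 - Complex.I * δ) * φ x := by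
  simp [helmholtz, SchwartzMap.laplacian_apply]

/-- The adjoint of the Helmholtz operator with respect to the bilinear pairing is itself. -/
lemma integral_schwartz_mul_helmholtz (δ : ℝ) (f φ : 𝓢(E, ℂ)) :
    ∫ x, f x * helmholtz δ φ x = ∫ x, helmholtz δ f x * φ x := by
  have h := SchwartzMap.integral_mul_laplacian_right_eq_left (μ := volume) f φ
  have i1 := integrable_mul_schwartz (f.memLp 2 volume) (Δ φ)
  have i2 := integrable_mul_schwartz (f.memLp 2 volume) φ
  have i3 := integrable_mul_schwartz ((Δ f).memLp 2 volume) φ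
  calc ∫ x, f x * helmholtz δ φ x
      = ∫ x, (f x * (Δ φ) x + (1 - Complex.I * δ) * (f x * φ x)) := by
        congr 1; ext x; simp [helmholtz]; ring
    _ = (∫ x, f x * (Δ φ) x) + ∫ x, (1 - Complex.I * δ) * (f x * φ x) :=
        integral_add i1 (i2.const_mul _)
    _ = (∫ x, (Δ f) x * φ x) + ∫ x, (1 - Complex.I * δ) * (f x * φ x) := by rw [h]
    _ = ∫ x, ((Δ f) x * φ x + (1 - Complex.I * δ) * (f x * φ x)) :=
        (integral_add i3 (i2.const_mul _)).symm
    _ = _ := by congr 1; ext x; simp [helmholtz]; ring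

lemma continuous_integral_Lp_mul (φ : 𝓢(E, ℂ)) :
    Continuous fun w : Lp ℂ 2 (volume : Measure E) => ∫ x, w x * φ x := by
  have hm : MemLp (fun x => (starRingEnd ℂ) (φ x)) 2 (volume : Measure E) :=
    (φ.memLp 2 volume).star
  have : (fun w : Lp ℂ 2 (volume : Measure E) => ∫ x, w x * φ x) =
      fun w => inner ℂ (hm.toLp _) w := by
    ext w
    rw [L2.inner_def]
    refine integral_congr_ae ?_
    filter_upwards [hm.coeFn_toLp] with x hx
    simp [hx]
  rw [this]
  exact continuous_const.inner continuous_id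

/-- The `L²` resolvent produces weak solutions, tested against Schwartz functions. -/
lemma integral_resolvent_mul_helmholtz {δ : ℝ} (hδ : 0 < δ) (f : Lp ℂ 2 (volume : Measure E))
    (φ : 𝓢(E, ℂ)) :
    ∫ x, resolvent δ f x * helmholtz δ φ x = ∫ x, f x * φ x := by
  refine denseRange_schwartz_toLp.induction (P := fun f => ∫ x, resolvent δ f x *
    helmholtz δ φ x = ∫ x, f x * φ x) ?_ (isClosed_eq ?_ ?_) f
  · rintro _ ⟨g, rfl⟩
    change ∫ x, resolvent δ (g.toLp 2 volume) x * _ = ∫ x, g.toLp 2 volume x * _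
    rw [resolvent_toLp hδ, integral_congr_ae (g := fun x => schwartzResolvent δ g x *
      helmholtz δ φ x), integral_schwartz_mul_helmholtz, helmholtz_schwartzResolvent hδ]
    · refine integral_congr_ae ?_
      filter_upwards [SchwartzMap.coeFn_toLp g 2 volume] with x hx
      rw [hx]
    · filter_upwards [SchwartzMap.coeFn_toLp (schwartzResolvent δ g) 2 volume] with x hx
      rw [hx]
  · exact (continuous_integral_Lp_mul _).comp (resolvent δ).continuous
  · exact continuous_integral_Lp_mul _

lemma laplacian_eq_sum_iteratedFDeriv (f : E → ℂ) (x : E) :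
    Δ f x = ∑ i : Fin 3, iteratedFDeriv ℝ 2 f x
      ![EuclideanSpace.basisFun (Fin 3) ℝ i, EuclideanSpace.basisFun (Fin 3) ℝ i] :=
  congrFun (InnerProductSpace.laplacian_eq_iteratedFDeriv_orthonormalBasis f
    (EuclideanSpace.basisFun (Fin 3) ℝ)) x

lemma norm_laplacian_le (f : E → ℂ) (x : E) :
    ‖Δ f x‖ ≤ 3 * ‖iteratedFDeriv ℝ 2 f x‖ := by
  rw [laplacian_eq_sum_iteratedFDeriv]
  refine (norm_sum_le _ _).trans ?_
  have : ∀ i ∈ (Finset.univ : Finset (Fin 3)), ‖iteratedFDeriv ℝ 2 f x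
      ![EuclideanSpace.basisFun (Fin 3) ℝ i, EuclideanSpace.basisFun (Fin 3) ℝ i]‖ ≤
      ‖iteratedFDeriv ℝ 2 f x‖ := fun i _ => by
    refine (ContinuousMultilinearMap.le_opNorm _ _).trans ?_
    simp [Fin.prod_univ_two]
  refine (Finset.sum_le_sum this).trans ?_
  simp

lemma laplacian_comp_smul {f : E → ℂ} (hf : ContDiff ℝ 2 f) (c : ℝ) (x : E) :
    Δ (fun y => f (c • y)) x = (c : ℂ) ^ 2 * Δ f (c • x) := by
  rw [laplacian_eq_sum_iteratedFDeriv, laplacian_eq_sum_iteratedFDeriv,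
    iteratedFDeriv_comp_const_smul c hf, Finset.mul_sum]
  simp

lemma laplacian_comp_sub (f : E → ℂ) (a x : E) :
    Δ (fun y => f (y - a)) x = Δ f (x - a) := by
  rw [laplacian_eq_sum_iteratedFDeriv, laplacian_eq_sum_iteratedFDeriv, iteratedFDeriv_comp_sub]

lemma IsTestFunction.comp_smul {f : E → ℂ} (hf : IsTestFunction f) {c : ℝ} (hc : c ≠ 0) :
    IsTestFunction fun x => f (c • x) :=
  ⟨hf.1.comp (contDiff_const_smul c), hf.2.comp_smul hc⟩

/-- A smooth cutoff at scale `n`. -/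
def cutoff (n : ℕ) (x : E) : ℂ :=
  (((⟨1, 2, one_pos, one_lt_two⟩ : ContDiffBump (0 : E)) (((n : ℝ) + 1)⁻¹ • x) : ℝ) : ℂ)

lemma isTestFunction_cutoff (n : ℕ) : IsTestFunction (cutoff n) := by
  refine IsTestFunction.comp_smul (f := fun x => (((⟨1, 2, one_pos, one_lt_two⟩ :
    ContDiffBump (0 : E)) x : ℝ) : ℂ)) ⟨?_, ?_⟩ (by positivity)
  · exact Complex.ofRealCLM.contDiff.comp (ContDiffBump.contDiff _)
  · exact (ContDiffBump.hasCompactSupport _).comp_left (g := ((↑) : ℝ → ℂ)) rfl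

lemma cutoff_eq_one {n : ℕ} {x : E} (hx : ‖x‖ ≤ n + 1) : cutoff n x = 1 := by
  rw [cutoff, ContDiffBump.one_of_mem_closedBall]
  · simp
  · have : (0 : ℝ) < n + 1 := by positivity
    rw [mem_closedBall_zero_iff, norm_smul, Real.norm_of_nonneg (by positivity)]
    rw [inv_mul_le_iff₀ this]
    simpa using hx

lemma norm_cutoff_le (n : ℕ) (x : E) : ‖cutoff n x‖ ≤ 1 := by
  rw [cutoff, Complex.norm_real, Real.norm_of_nonneg (ContDiffBump.nonneg _)]
  exact ContDiffBump.le_one _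

/-- Each derivative of a dilated cutoff gains a factor `(n + 1)⁻¹ ≤ 1`, so the bound for `n = 0`
serves for all `n`. -/
lemma exists_norm_iteratedFDeriv_cutoff_le (i : ℕ) :
    ∃ C, ∀ n x, ‖iteratedFDeriv ℝ i (cutoff n) x‖ ≤ C := by
  have h0 := isTestFunction_cutoff 0
  obtain ⟨C, hC⟩ := (h0.2.iteratedFDeriv (𝕜 := ℝ) i).exists_bound_of_continuous
    ((h0.1.of_le (mod_cast le_top)).continuous_iteratedFDeriv' (m := i))
  refine ⟨C, fun n x => ?_⟩
  have e : cutoff n = fun x => cutoff 0 (((n : ℝ) + 1)⁻¹ • x) := by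
    ext x; simp [cutoff]
  rw [e, iteratedFDeriv_comp_const_smul _ (h0.1.of_le (mod_cast le_top))]
  simp only [norm_smul, norm_pow]
  have : ‖((n : ℝ) + 1)⁻¹‖ ≤ 1 := by
    rw [norm_inv, Real.norm_of_nonneg (by positivity)]
    exact inv_le_one_of_one_le₀ (by linarith [n.cast_nonneg (α := ℝ)])
  calc _ ≤ 1 ^ i * C := by gcongr; exact hC _
    _ = C := by simp

lemma exists_schwartz_decay (φ : 𝓢(E, ℂ)) (k N : ℕ) :
    ∃ C, ∀ j ≤ N, ∀ x, ‖iteratedFDeriv ℝ j φ x‖ ≤ C * ((1 + ‖x‖) ^ k)⁻¹ := by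
  refine ⟨2 ^ k * (Finset.Iic (k, N)).sup (fun m => SchwartzMap.seminorm ℝ m.1 m.2) φ,
    fun j hj x => ?_⟩
  have := SchwartzMap.one_add_le_sup_seminorm_apply (𝕜 := ℝ) (m := (k, N)) le_rfl hj φ x
  rw [← div_eq_mul_inv, le_div_iff₀ (by positivity), mul_comm]
  exact this

lemma memLp_two_one_add_norm_inv :
    MemLp (fun x : E => ((1 + ‖x‖) ^ 2)⁻¹) 2 volume := by
  have hc : Continuous fun x : E => ((1 + ‖x‖) ^ 2)⁻¹ :=
    Continuous.inv₀ (by fun_prop) fun x => by positivity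
  refine (memLp_two_iff_integrable_sq hc.aestronglyMeasurable).2 ?_
  have := integrable_one_add_norm (E := E) (μ := volume) (r := 4) (by simp; norm_num)
  refine this.congr (.of_forall fun x => ?_)
  have h : (0 : ℝ) < 1 + ‖x‖ := by positivity
  simp only []
  rw [Real.rpow_neg h.le, inv_pow, ← pow_mul]
  norm_cast

lemma isTestFunction_cutoff_mul (n : ℕ) (φ : 𝓢(E, ℂ)) :
    IsTestFunction fun x => cutoff n x * φ x :=
  ⟨(isTestFunction_cutoff n).1.mul (φ.smooth ⊤), (isTestFunction_cutoff n).2.mul_right⟩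

/-- Weak solutions in `L²` may be tested against Schwartz functions. -/
lemma IsWeakSolution.integral_mul_helmholtz {δ : ℝ} {f v : E → ℂ} (h : IsWeakSolution δ f v)
    (hf : MemLp f 2 volume) (hv : MemLp v 2 volume) (φ : 𝓢(E, ℂ)) :
    ∫ x, v x * helmholtz δ φ x = ∫ x, f x * φ x := by
  have key : ∀ n, ∫ x, v x * (Δ (fun x => cutoff n x * φ x) x +
      (1 - Complex.I * δ) * (cutoff n x * φ x)) = ∫ x, f x * (cutoff n x * φ x) :=
    fun n => h _ (isTestFunction_cutoff_mul n φ)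
  have lim2 : Tendsto (fun n => ∫ x, f x * (cutoff n x * φ x)) atTop (𝓝 (∫ x, f x * φ x)) := by
    refine tendsto_integral_of_dominated_convergence (fun x => ‖f x * φ x‖) (fun n => ?_)
      (integrable_mul_schwartz hf φ).norm (fun n => .of_forall fun x => ?_) (.of_forall fun x => ?_)
    · exact hf.1.mul (isTestFunction_cutoff_mul n φ).1.continuous.aestronglyMeasurable
    · rw [norm_mul, norm_mul, norm_mul]
      have := norm_cutoff_le n x
      have h2 : ‖cutoff n x‖ * ‖φ x‖ ≤ ‖φ x‖ := mul_le_of_le_one_left (norm_nonneg _) this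
      gcongr
    · refine tendsto_const_nhds.congr' ?_
      filter_upwards [eventually_ge_atTop ⌈‖x‖⌉₊] with n hn
      rw [cutoff_eq_one, one_mul]
      linarith [Nat.ceil_le.1 hn]
  -- The cutoff derivatives are bounded uniformly in `n` and `φ` decays fast, so the integrand is
  -- dominated by `|v| (1 + |x|)⁻²`, a product of two `L²` functions because `4 > 3`.
  have lim1 : Tendsto (fun n => ∫ x, v x * (Δ (fun x => cutoff n x * φ x) x +
      (1 - Complex.I * δ) * (cutoff n x * φ x))) atTop (𝓝 (∫ x, v x * helmholtz δ φ x)) := by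
    obtain ⟨C0, hC0⟩ := exists_norm_iteratedFDeriv_cutoff_le 0
    obtain ⟨C1, hC1⟩ := exists_norm_iteratedFDeriv_cutoff_le 1
    obtain ⟨C2, hC2⟩ := exists_norm_iteratedFDeriv_cutoff_le 2
    obtain ⟨D, hD⟩ := exists_schwartz_decay φ 2 2
    have hb : ∀ n x, ‖Δ (fun x => cutoff n x * φ x) x + (1 - Complex.I * δ) * (cutoff n x * φ x)‖ ≤
        (3 * (C0 + 2 * C1 + C2) * D + ‖(1 - Complex.I * δ : ℂ)‖ * D) * ((1 + ‖x‖) ^ 2)⁻¹ := by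
      intro n x
      have l := norm_iteratedFDeriv_mul_le (𝕜 := ℝ) (N := 2)
        (contDiff_infty.1 (isTestFunction_cutoff n).1 2) (φ.smooth 2) x (n := 2) le_rfl
      simp only [Finset.sum_range_succ, Finset.range_zero, Finset.sum_empty, Nat.choose_zero_right,
        Nat.cast_one, one_mul, zero_add, Nat.choose_self, Nat.choose_one_right, Nat.cast_ofNat,
        Nat.sub_zero, Nat.reduceSub] at l
      have d0 := hD 0 (by norm_num) x
      have d1 := hD 1 (by norm_num) x
      have d2 := hD 2 (by norm_num) x
      have c0 := (norm_nonneg _).trans (hC0 n x)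
      have c1 := (norm_nonneg _).trans (hC1 n x)
      have c2 := (norm_nonneg _).trans (hC2 n x)
      have l2 : ‖iteratedFDeriv ℝ 2 (fun x => cutoff n x * φ x) x‖ ≤
          (C0 + 2 * C1 + C2) * (D * ((1 + ‖x‖) ^ 2)⁻¹) := by
        refine l.trans ?_
        calc _ ≤ C0 * (D * ((1 + ‖x‖) ^ 2)⁻¹) + 2 * C1 * (D * ((1 + ‖x‖) ^ 2)⁻¹) +
              C2 * (D * ((1 + ‖x‖) ^ 2)⁻¹) := by
              gcongr
              · exact hC0 n x
              · exact hC1 n x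
              · exact hC2 n x
          _ = _ := by ring
      have l3 := norm_laplacian_le (fun x => cutoff n x * φ x) x
      have l4 : ‖cutoff n x * φ x‖ ≤ D * ((1 + ‖x‖) ^ 2)⁻¹ := by
        rw [norm_mul]
        simp only [norm_iteratedFDeriv_zero] at d0
        exact (mul_le_of_le_one_left (norm_nonneg _) (norm_cutoff_le n x)).trans d0
      calc _ ≤ ‖Δ (fun x => cutoff n x * φ x) x‖ + ‖(1 - Complex.I * δ) * (cutoff n x * φ x)‖ :=
            norm_add_le _ _
        _ ≤ 3 * ((C0 + 2 * C1 + C2) * (D * ((1 + ‖x‖) ^ 2)⁻¹)) +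
            ‖(1 - Complex.I * δ : ℂ)‖ * (D * ((1 + ‖x‖) ^ 2)⁻¹) := by
            rw [norm_mul (1 - Complex.I * δ : ℂ)]
            gcongr
            linarith
        _ = _ := by ring
    set K := 3 * (C0 + 2 * C1 + C2) * D + ‖(1 - Complex.I * δ : ℂ)‖ * D
    have hcont : ∀ n, Continuous fun x => Δ (fun x => cutoff n x * φ x) x +
        (1 - Complex.I * δ) * (cutoff n x * φ x) := fun n => by
      let ψ := (isTestFunction_cutoff_mul n φ).2.toSchwartzMap (isTestFunction_cutoff_mul n φ).1
      refine (helmholtz δ ψ).continuous.congr fun x => ?_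
      rw [helmholtz_apply]; rfl
    refine tendsto_integral_of_dominated_convergence (fun x => ‖v x‖ * (K * ((1 + ‖x‖) ^ 2)⁻¹))
      (fun n => hv.1.mul (hcont n).aestronglyMeasurable)
      (hv.norm.integrable_mul (memLp_two_one_add_norm_inv.const_mul K))
      (fun n => .of_forall fun x => ?_) (.of_forall fun x => ?_)
    · rw [norm_mul]
      gcongr
      exact hb n x
    · refine tendsto_const_nhds.congr' ?_
      filter_upwards [eventually_ge_atTop ⌈‖x‖⌉₊] with n hn
      have hx : ‖x‖ < n + 1 := by linarith [Nat.ceil_le.1 hn]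
      -- Equality on a neighbourhood is needed because the Laplacian is compared; hence the strict
      -- inequality `‖x‖ < n + 1`.
      have : (fun x => cutoff n x * φ x) =ᶠ[𝓝 x] φ := by
        filter_upwards [(continuous_norm.tendsto x).eventually (gt_mem_nhds hx)] with y hy
        rw [cutoff_eq_one hy.le, one_mul]
      rw [(InnerProductSpace.laplacian_congr_nhds this).eq_of_nhds, cutoff_eq_one hx.le, one_mul,
        helmholtz_apply]
  exact tendsto_nhds_unique (lim1.congr key) lim2

/-- Uniqueness of weak solutions. -/
lemma IsWeakSolution.ae_eq_resolvent {δ : ℝ} (hδ : 0 < δ) {f v : E → ℂ}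
    (h : IsWeakSolution δ f v) (hf : MemLp f 2 volume) (hv : MemLp v 2 volume) :
    v =ᵐ[volume] resolvent δ (hf.toLp f) := by
  refine ae_eq_of_integral_contDiff_smul_eq (hv.locallyIntegrable (by norm_num))
    ((Lp.memLp _).locallyIntegrable (by norm_num)) fun g hg hgc => ?_
  let φ : 𝓢(E, ℂ) := (hgc.comp_left (g := ((↑) : ℝ → ℂ)) rfl).toSchwartzMap
    (Complex.ofRealCLM.contDiff.comp hg)
  have hφ : ∀ x, φ x = g x := fun x => rfl
  -- Uniqueness by duality: both candidates are tested against the resolvent of `φ`, which the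
  -- operator sends back to `φ`. This test function is Schwartz but in general not compactly
  -- supported, hence the extended class of test functions.
  have e1 := h.integral_mul_helmholtz hf hv (schwartzResolvent δ φ)
  have e2 := integral_resolvent_mul_helmholtz hδ (hf.toLp f) (schwartzResolvent δ φ)
  rw [helmholtz_schwartzResolvent hδ] at e1 e2
  have e3 : ∫ x, hf.toLp f x * schwartzResolvent δ φ x = ∫ x, f x * schwartzResolvent δ φ x := by
    refine integral_congr_ae ?_
    filter_upwards [hf.coeFn_toLp] with x hx
    rw [hx]
  have := e1.trans (e3.symm.trans e2.symm)
  simpa only [Complex.real_smul, hφ, mul_comm] using this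

lemma isWeakSolution_resolvent_comp_sub {δ : ℝ} (hδ : 0 < δ) {f : E → ℂ} (hf : MemLp f 2 volume)
    (z : E) : IsWeakSolution δ (fun x => f (x - z)) fun x => resolvent δ (hf.toLp f) (x - z) := by
  intro φ hφ
  have hφ' : IsTestFunction fun x => φ (x + z) :=
    ⟨hφ.1.comp (by fun_prop), hφ.2.comp_homeomorph (Homeomorph.addRight z)⟩
  have e := integral_resolvent_mul_helmholtz hδ (hf.toLp f) (hφ'.2.toSchwartzMap hφ'.1)
  have e3 : ∫ x, hf.toLp f x * hφ'.2.toSchwartzMap hφ'.1 x = ∫ x, f x * φ (x + z) := by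
    refine integral_congr_ae ?_
    filter_upwards [hf.coeFn_toLp] with x hx
    rw [hx]; rfl
  rw [e3] at e
  rw [← integral_add_right_eq_self _ z, ← integral_add_right_eq_self (fun x => f (x - z) * φ x) z]
  simp only [add_sub_cancel_right]
  rw [← e]
  refine integral_congr_ae (.of_forall fun x => ?_)
  simp only [helmholtz_apply]
  have := laplacian_comp_sub φ (-z) x
  simp only [sub_neg_eq_add] at this
  change _ = _ * (Δ (fun x => φ (x + z)) x + _ * φ (x + z))
  rw [this]

lemma IsWeakSolution.add {δ : ℝ} {f g v w : E → ℂ} (hv : IsWeakSolution δ f v)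
    (hw : IsWeakSolution δ g w) (mf : MemLp f 2 volume) (mg : MemLp g 2 volume)
    (mv : MemLp v 2 volume) (mw : MemLp w 2 volume) :
    IsWeakSolution δ (fun x => f x + g x) fun x => v x + w x := by
  intro φ hφ
  let ψ := hφ.2.toSchwartzMap hφ.1
  have e : ∀ x, Δ φ x + (1 - Complex.I * δ) * φ x = helmholtz δ ψ x := fun x => by
    rw [helmholtz_apply]; rfl
  have hv' := hv φ hφ
  have hw' := hw φ hφ
  simp only [e, add_mul] at hv' hw' ⊢
  rw [integral_add (integrable_mul_schwartz mv _) (integrable_mul_schwartz mw _), hv', hw']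
  exact (integral_add (integrable_mul_schwartz mf ψ) (integrable_mul_schwartz mg ψ)).symm

/-! ### Rescaling to the wavelength and superposition of the two waves -/

lemma memLp_comp_smul {f : E → ℂ} (hf : MemLp f 2 volume) {c : ℝ} (hc : c ≠ 0) :
    MemLp (fun x => f (c • x)) 2 volume := by
  have hm : AEStronglyMeasurable (fun x => f (c • x)) volume :=
    hf.1.comp_quasiMeasurePreserving (Measure.quasiMeasurePreserving_smul volume hc)
  have h := (memLp_two_iff_integrable_sq_norm hf.1).1 hf
  exact (memLp_two_iff_integrable_sq_norm hm).2 (h.comp_smul hc)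

lemma memLp_comp_sub {f : E → ℂ} (hf : MemLp f 2 volume) (z : E) :
    MemLp (fun x => f (x - z)) 2 volume :=
  hf.comp_measurePreserving (measurePreserving_sub_right volume z)

/-- Rescaling the Helmholtz equation to the wavelength. -/
lemma IsHelmholtzSolution.rescale {ε a : ℝ} (hε : 0 < ε) {S₀ S₁ u : E → ℂ} {q : E}
    (h : IsHelmholtzSolution ε a (source S₀ S₁ q ε) u) :
    IsWeakSolution (ε * a) (fun y => S₀ y + S₁ (y - ε⁻¹ • q)) fun y => (ε : ℂ) * u (ε • y) := by
  intro φ hφ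
  have hε' : (ε : ℂ) ≠ 0 := by exact_mod_cast hε.ne'
  have h1 := h.2 _ (hφ.comp_smul (inv_ne_zero hε.ne'))
  have c2 : ContDiff ℝ 2 φ := contDiff_infty.1 hφ.1 2
  have i1 := Measure.integral_comp_smul volume (fun x => u x * (-Complex.I * ((a / ε : ℝ) : ℂ) *
    φ (ε⁻¹ • x) + Δ (fun x => φ (ε⁻¹ • x)) x + ((1 / ε ^ 2 : ℝ) : ℂ) * φ (ε⁻¹ • x))) ε
  have i2 := Measure.integral_comp_smul volume (fun x => source S₀ S₁ q ε x * φ (ε⁻¹ • x)) ε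
  rw [h1, ← i2] at i1
  -- The factor `ε³` removes the `ε⁻³` of the source. On the other side it leaves `ε u(εy)` against
  -- `Δφ + (1 - iεa) φ`, which is where `δ = εa` and the normalization of the rescaled solution come
  -- from.
  have i3 := congrArg (fun z => (ε : ℂ) ^ 3 * z) i1
  simp only [← integral_const_mul] at i3
  convert i3 using 1
  · refine integral_congr_ae (.of_forall fun y => ?_)
    simp only [laplacian_comp_smul c2, smul_smul, inv_mul_cancel₀ hε.ne', one_smul]
    push_cast
    field_simp
    ring
  · refine integral_congr_ae (.of_forall fun y => ?_)
    simp only [source, smul_smul, inv_mul_cancel₀ hε.ne', one_smul, smul_sub]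
    field_simp

/-- The solution of the Helmholtz equation with one source, concentrated at the origin at
scale `ε`. -/
def wave (ε a : ℝ) (S : Lp ℂ 2 (volume : Measure E)) (x : E) : ℂ :=
  (ε : ℂ)⁻¹ * resolvent (ε * a) S (ε⁻¹ • x)

lemma memLp_wave {ε : ℝ} (hε : 0 < ε) (a : ℝ) (S : Lp ℂ 2 (volume : Measure E)) :
    MemLp (wave ε a S) 2 volume :=
  (memLp_comp_smul (Lp.memLp (resolvent (ε * a) S)) (inv_ne_zero hε.ne')).const_mul _

/-- In wavelength units the rescaled `u` and the sum of the two resolvents, the second translated by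
`q/ε`, are `L²` weak solutions with the same right-hand side, hence equal. -/
lemma IsHelmholtzSolution.ae_eq_wave {ε a : ℝ} (hε : 0 < ε) (ha : 0 < a) {S₀ S₁ u : E → ℂ} {q : E}
    (h : IsHelmholtzSolution ε a (source S₀ S₁ q ε) u) (h₀ : MemLp S₀ 2 volume)
    (h₁ : MemLp S₁ 2 volume) :
    u =ᵐ[volume] fun x => wave ε a (h₀.toLp S₀) x + wave ε a (h₁.toLp S₁) (x - q) := by
  have hδ : 0 < ε * a := mul_pos hε ha
  set z := ε⁻¹ • q
  have hS : MemLp (fun y => S₀ y + S₁ (y - z)) 2 volume := h₀.add (memLp_comp_sub h₁ z)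
  have e1 := h.rescale hε |>.ae_eq_resolvent hδ hS ((memLp_comp_smul h.1 hε.ne').const_mul _)
  have w0 := isWeakSolution_resolvent_comp_sub hδ h₀ 0
  simp only [sub_zero] at w0
  have m0 := Lp.memLp (resolvent (ε * a) (h₀.toLp S₀))
  have m1 := memLp_comp_sub (Lp.memLp (resolvent (ε * a) (h₁.toLp S₁))) z
  have e2 := (w0.add (isWeakSolution_resolvent_comp_sub hδ h₁ z) h₀ (memLp_comp_sub h₁ z) m0 m1
    ).ae_eq_resolvent hδ hS (m0.add m1)
  have e3 := e1.trans e2.symm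
  have e4 := (Measure.quasiMeasurePreserving_smul volume (inv_ne_zero hε.ne')).ae_eq_comp e3
  filter_upwards [e4] with x hx
  simp only [Function.comp_apply, smul_smul, mul_inv_cancel₀ hε.ne', one_smul] at hx
  have hε' : (ε : ℂ) ≠ 0 := by exact_mod_cast hε.ne'
  rw [wave, wave, smul_sub, ← mul_add, ← hx]
  field_simp

/-! ### Partial derivatives and weights -/

/-- The standard basis of space. -/
def basis (i : Fin 3) : E := EuclideanSpace.basisFun (Fin 3) ℝ i

lemma basis_apply (i j : Fin 3) : basis i j = if j = i then 1 else 0 := by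
  simp [basis, EuclideanSpace.basisFun_apply]

lemma norm_sq_eq_sum (x : E) : ‖x‖ ^ 2 = x 0 ^ 2 + x 1 ^ 2 + x 2 ^ 2 := by
  rw [EuclideanSpace.real_norm_sq_eq, Fin.sum_univ_three]

/-- `w'` is the partial derivative of `w` in the direction of the `i`-th basis vector. -/
def HasPartial {F : Type*} [NormedAddCommGroup F] [NormedSpace ℝ F] (w w' : E → F) (i : Fin 3) :
    Prop :=
  ∀ x, HasLineDerivAt ℝ w (w' x) x (basis i)

section HasPartial

variable {w w' s s' : E → ℝ} {i : Fin 3}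

lemma HasPartial.mul (h : HasPartial w w' i) (h' : HasPartial s s' i) :
    HasPartial (fun x => w x * s x) (fun x => w' x * s x + w x * s' x) i := fun x => by
  have := HasDerivAt.mul (h x) (h' x)
  simp only [zero_smul, add_zero] at this
  exact this

lemma HasPartial.add (h : HasPartial w w' i) (h' : HasPartial s s' i) :
    HasPartial (fun x => w x + s x) (fun x => w' x + s' x) i := fun x =>
  HasDerivAt.add (h x) (h' x)

lemma HasPartial.const_mul (h : HasPartial w w' i) (c : ℝ) :
    HasPartial (fun x => c * w x) (fun x => c * w' x) i := fun x =>
  HasDerivAt.const_mul c (h x)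

lemma HasPartial.pow (h : HasPartial w w' i) (n : ℕ) :
    HasPartial (fun x => w x ^ n) (fun x => n * w x ^ (n - 1) * w' x) i := fun x => by
  have := HasDerivAt.pow (h x) n
  simp only [zero_smul, add_zero] at this
  exact this

lemma HasPartial.congr_right (h : HasPartial w w' i) (e : ∀ x, w' x = s' x) :
    HasPartial w s' i := fun x => e x ▸ h x

lemma hasPartial_coord (i j : Fin 3) :
    HasPartial (fun x : E => x j) (fun _ => if j = i then 1 else 0) i := fun x => by
  have : HasDerivAt (fun t : ℝ => x j + t * (if j = i then 1 else 0)) (if j = i then 1 else 0) 0 := by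
    simpa using ((hasDerivAt_id (0 : ℝ)).mul_const (if j = i then (1 : ℝ) else 0)).const_add (x j)
  refine HasDerivAt.congr_deriv (f := fun t : ℝ => (x + t • basis i) j) ?_ rfl
  simpa [basis_apply] using this

lemma hasPartial_schwartz {F : Type*} [NormedAddCommGroup F] [NormedSpace ℝ F] (f : 𝓢(E, F))
    (i : Fin 3) : HasPartial f (∂_{basis i} f : 𝓢(E, F)) i := fun x => by
  rw [SchwartzMap.lineDerivOp_apply_eq_fderiv]
  exact f.differentiableAt.hasFDerivAt.hasLineDerivAt _

end HasPartial

/-- The weight `(R² + |x|²)^{-1/2}`. -/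
def wt (R : ℝ) (x : E) : ℝ := (√(R ^ 2 + ‖x‖ ^ 2))⁻¹

section wt

variable {R : ℝ} (hR : 0 < R)
include hR

lemma wt_pos (x : E) : 0 < wt R x := by
  unfold wt; positivity

/-- The one algebraic relation between the weight and the coordinates. The later identities use it
to eliminate `|x|²`, after which everything is polynomial in `wt R x`. -/
lemma wt_sq_mul (x : E) : wt R x ^ 2 * (R ^ 2 + (x 0 ^ 2 + x 1 ^ 2 + x 2 ^ 2)) = 1 := by
  have h : 0 < R ^ 2 + ‖x‖ ^ 2 := by positivity
  rw [wt, inv_pow, Real.sq_sqrt h.le, ← norm_sq_eq_sum]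
  exact inv_mul_cancel₀ h.ne'

lemma wt_le (x : E) : wt R x ≤ R⁻¹ := by
  unfold wt
  gcongr
  exact Real.le_sqrt_of_sq_le (by nlinarith [sq_nonneg ‖x‖])

lemma abs_coord_mul_wt_le (x : E) (j : Fin 3) : |x j * wt R x| ≤ 1 := by
  have h := wt_sq_mul hR x
  have h2 := norm_sq_eq_sum x
  rw [abs_le_one_iff_mul_self_le_one]
  fin_cases j <;> simp only [Fin.zero_eta, Fin.mk_one, Fin.reduceFinMk] <;>
    nlinarith [mul_nonneg (sq_nonneg (wt R x)) (sq_nonneg R),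
      mul_nonneg (sq_nonneg (wt R x)) (sq_nonneg (x 0)),
      mul_nonneg (sq_nonneg (wt R x)) (sq_nonneg (x 1)),
      mul_nonneg (sq_nonneg (wt R x)) (sq_nonneg (x 2))]

lemma continuous_wt : Continuous (wt R) := by
  unfold wt
  exact Continuous.inv₀ (by fun_prop) fun x => by positivity

lemma hasPartial_wt (i : Fin 3) : HasPartial (wt R) (fun x => -(x i) * wt R x ^ 3) i := fun x => by
  have h1 : HasPartial (fun x : E => R ^ 2 + ‖x‖ ^ 2) (fun x => 2 * x i) i := fun x => by
    have := ((hasStrictFDerivAt_norm_sq x).hasFDerivAt.const_add (R ^ 2)).hasLineDerivAt (basis i)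
    have e : (2 • innerSL ℝ x) (basis i) = 2 * x i := by
      simp [basis, EuclideanSpace.inner_single_right]
    rw [e] at this
    exact this
  have hp : R ^ 2 + ‖x + (0 : ℝ) • basis i‖ ^ 2 ≠ 0 := by positivity
  have h2 := (HasDerivAt.sqrt (h1 x) hp).inv (by positivity)
  refine HasDerivAt.congr_deriv h2 ?_
  have hx : 0 < √(R ^ 2 + ‖x‖ ^ 2) := by positivity
  simp only [zero_smul, add_zero, wt]
  field_simp

end wt

/-- Bounded continuous weights. -/
def IsWeight {F : Type*} [NormedAddCommGroup F] (w : E → F) : Prop :=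
  Continuous w ∧ ∃ C, ∀ x, ‖w x‖ ≤ C

lemma IsWeight.mul {w s : E → ℝ} (hw : IsWeight w) (hs : IsWeight s) :
    IsWeight fun x => w x * s x := by
  obtain ⟨C, hC⟩ := hw.2
  obtain ⟨D, hD⟩ := hs.2
  refine ⟨hw.1.mul hs.1, C * D, fun x => ?_⟩
  rw [norm_mul]
  have := (norm_nonneg _).trans (hC x)
  gcongr
  exacts [hC x, hD x]

lemma IsWeight.add {w s : E → ℝ} (hw : IsWeight w) (hs : IsWeight s) :
    IsWeight fun x => w x + s x := by
  obtain ⟨C, hC⟩ := hw.2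
  obtain ⟨D, hD⟩ := hs.2
  exact ⟨hw.1.add hs.1, C + D, fun x => (norm_add_le _ _).trans (add_le_add (hC x) (hD x))⟩

lemma isWeight_const {F : Type*} [NormedAddCommGroup F] (c : F) : IsWeight fun _ : E => c :=
  ⟨continuous_const, ‖c‖, fun _ => le_rfl⟩

lemma IsWeight.pow {w : E → ℝ} (hw : IsWeight w) (n : ℕ) : IsWeight fun x => w x ^ n := by
  induction n with
  | zero => simpa using isWeight_const (1 : ℝ)
  | succ n ih => simpa only [pow_succ] using ih.mul hw

lemma isWeight_wt {R : ℝ} (hR : 0 < R) : IsWeight (wt R) :=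
  ⟨continuous_wt hR, R⁻¹, fun x => by
    rw [Real.norm_of_nonneg (wt_pos hR x).le]; exact wt_le hR x⟩

lemma isWeight_coord_mul_wt {R : ℝ} (hR : 0 < R) (j : Fin 3) : IsWeight fun x => x j * wt R x :=
  ⟨by have := continuous_wt hR; fun_prop, 1, fun x => abs_coord_mul_wt_le hR x j⟩

lemma IsWeight.congr {w s : E → ℝ} (hw : IsWeight w) (h : ∀ x, w x = s x) : IsWeight s :=
  funext h ▸ hw

/-! ### Integral identities obtained by integration by parts -/

/-- Integrable functions with vanishing integral. -/
def IsNull (F : E → ℝ) : Prop := Integrable F ∧ ∫ x, F x = 0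

lemma IsNull.add {F G : E → ℝ} (hF : IsNull F) (hG : IsNull G) : IsNull fun x => F x + G x :=
  ⟨hF.1.add hG.1, by rw [integral_add hF.1 hG.1, hF.2, hG.2, add_zero]⟩

lemma IsNull.const_mul {F : E → ℝ} (hF : IsNull F) (c : ℝ) : IsNull fun x => c * F x :=
  ⟨hF.1.const_mul c, by rw [integral_const_mul, hF.2, mul_zero]⟩

lemma IsNull.sum {ι : Type*} [Fintype ι] {F : ι → E → ℝ} (hF : ∀ i, IsNull (F i)) :
    IsNull fun x => ∑ i, F i x :=
  ⟨integrable_finsetSum _ fun i _ => (hF i).1, by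
    rw [integral_finsetSum _ fun i _ => (hF i).1]; exact Finset.sum_eq_zero fun i _ => (hF i).2⟩

lemma IsNull.congr {F G : E → ℝ} (hF : IsNull F) (h : ∀ x, F x = G x) : IsNull G :=
  funext h ▸ hF

lemma IsWeight.integrable_mul {w : E → ℝ} (hw : IsWeight w) (s t : 𝓢(E, ℝ)) :
    Integrable fun x => w x * (s x * t x) := by
  obtain ⟨C, hC⟩ := hw.2
  exact ((s.memLp 2 volume).integrable_mul (t.memLp 2 volume)).bdd_mul
    hw.1.aestronglyMeasurable (.of_forall hC)

/-- The integrand is `∂ᵢ(w s t)`. The integral identities below are linear combinations of this one,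
checked pointwise by algebra. -/
lemma isNull_of_hasPartial {w w' : E → ℝ} {i : Fin 3} (h : HasPartial w w' i) (hw : IsWeight w)
    (hw' : IsWeight w') (s t : 𝓢(E, ℝ)) :
    IsNull fun x => w' x * (s x * t x) +
      w x * ((∂_{basis i} s : 𝓢(E, ℝ)) x * t x + s x * (∂_{basis i} t : 𝓢(E, ℝ)) x) := by
  have i1 := hw'.integrable_mul s t
  have i2 : Integrable fun x =>
      w x * ((∂_{basis i} s : 𝓢(E, ℝ)) x * t x + s x * (∂_{basis i} t : 𝓢(E, ℝ)) x) := by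
    simp only [mul_add]
    exact (hw.integrable_mul _ _).add (hw.integrable_mul _ _)
  refine ⟨i1.add i2, ?_⟩
  have := integral_bilinear_hasLineDerivAt_right_eq_neg_left_of_integrable (μ := volume)
    (B := ContinuousLinearMap.mul ℝ ℝ) (v := basis i) (f := w) (f' := w')
    (g := fun x => s x * t x)
    (g' := fun x => (∂_{basis i} s : 𝓢(E, ℝ)) x * t x + s x * (∂_{basis i} t : 𝓢(E, ℝ)) x)
    i1 i2 (hw.integrable_mul s t) (fun x _ => h x)
    (fun x _ => ((hasPartial_schwartz s i).mul (hasPartial_schwartz t i)) x)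
  simp only [ContinuousLinearMap.mul_apply'] at this
  rw [integral_add i1 i2, this, add_neg_cancel]

lemma lineDeriv_basis_comm (f : 𝓢(E, ℝ)) (i j : Fin 3) (x : E) :
    (∂_{basis i} (∂_{basis j} f : 𝓢(E, ℝ)) : 𝓢(E, ℝ)) x =
      (∂_{basis j} (∂_{basis i} f : 𝓢(E, ℝ)) : 𝓢(E, ℝ)) x := by
  have h : ∀ i j, (∂_{basis i} (∂_{basis j} f : 𝓢(E, ℝ)) : 𝓢(E, ℝ)) x =
      iteratedFDeriv ℝ 2 f x ![basis i, basis j] := fun i j => by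
    rw [← SchwartzMap.iteratedLineDerivOp_eq_iteratedFDeriv]
    rfl
  rw [h, h, iteratedFDeriv_two_apply, iteratedFDeriv_two_apply]
  exact (f.smooth 2).contDiffAt.isSymmSndFDerivAt (by simp) _ _

lemma laplacian_eq_sum_basis {F : Type*} [NormedAddCommGroup F] [NormedSpace ℝ F] (f : 𝓢(E, F)) :
    Δ f = ∑ i, (∂_{basis i} (∂_{basis i} f : 𝓢(E, F)) : 𝓢(E, F)) :=
  SchwartzMap.laplacian_eq_sum (EuclideanSpace.basisFun (Fin 3) ℝ) f

/-- The integrand is the divergence of `w a ∇a - ½ a² ∇w`, that is, the energy identity obtained by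
testing `Δa` against `w a`. -/
lemma isNull_energy {w : E → ℝ} {w' w'' : Fin 3 → E → ℝ} (h : ∀ i, HasPartial w (w' i) i)
    (h' : ∀ i, HasPartial (w' i) (w'' i) i) (hw : IsWeight w) (hw' : ∀ i, IsWeight (w' i))
    (hw'' : ∀ i, IsWeight (w'' i)) (a : 𝓢(E, ℝ)) :
    IsNull fun x => w x * (a x * (Δ a) x + ∑ i, (∂_{basis i} a : 𝓢(E, ℝ)) x ^ 2) -
      (∑ i, w'' i x) / 2 * a x ^ 2 := by
  have t1 := IsNull.sum fun i => isNull_of_hasPartial (h i) hw (hw' i) a (∂_{basis i} a)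
  have t2 := IsNull.sum fun i =>
    (isNull_of_hasPartial (h' i) (hw' i) (hw'' i) a a).const_mul (-(1 / 2))
  refine (t1.add t2).congr fun x => ?_
  rw [laplacian_eq_sum_basis]
  simp only [Fin.sum_univ_three, add_apply]
  ring

/-- The divergence of `a∇b - b∇a`. For `v = a + ib` this is the flux identity, which controls the
absorption `δ ∫ |v|²`. -/
lemma isNull_skew (a b : 𝓢(E, ℝ)) : IsNull fun x => a x * (Δ b) x - b x * (Δ a) x := by
  have h : ∀ i, HasPartial (fun _ : E => (1 : ℝ)) (fun _ => 0) i := fun i x => by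
    exact hasDerivAt_const _ _
  have t1 := IsNull.sum fun i =>
    isNull_of_hasPartial (h i) (isWeight_const _) (isWeight_const _) a (∂_{basis i} b)
  have t2 := IsNull.sum fun i =>
    (isNull_of_hasPartial (h i) (isWeight_const _) (isWeight_const _) b (∂_{basis i} a)).const_mul
      (-1)
  refine (t1.add t2).congr fun x => ?_
  rw [laplacian_eq_sum_basis, laplacian_eq_sum_basis]
  simp only [Fin.sum_univ_three, add_apply]
  ring

section Morawetz

variable {R : ℝ} (hR : 0 < R)
include hR

lemma isWeight_coord_mul_wt_pow (i : Fin 3) (n : ℕ) : IsWeight fun x => x i * wt R x ^ (n + 1) :=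
  ((isWeight_coord_mul_wt hR i).mul ((isWeight_wt hR).pow n)).congr fun x => by ring

lemma hasPartial_wt_pow (i : Fin 3) (n : ℕ) :
    HasPartial (fun x => wt R x ^ (n + 1)) (fun x => -(n + 1) * (x i * wt R x ^ (n + 3))) i :=
  ((hasPartial_wt hR i).pow (n + 1)).congr_right fun x => by
    push_cast
    ring

lemma hasPartial_coord_mul_wt_pow (i j : Fin 3) (n : ℕ) :
    HasPartial (fun x => x j * wt R x ^ (n + 1)) (fun x => (if j = i then 1 else 0) *
      wt R x ^ (n + 1) + -(n + 1) * ((x i * x j) * wt R x ^ (n + 3))) i :=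
  ((hasPartial_coord i j).mul (hasPartial_wt_pow hR i n)).congr_right fun x => by ring

lemma isWeight_coord_mul_coord (i j : Fin 3) (n : ℕ) :
    IsWeight fun x => x i * x j * wt R x ^ (n + 2) :=
  (((isWeight_coord_mul_wt hR i).mul (isWeight_coord_mul_wt hR j)).mul
    ((isWeight_wt hR).pow n)).congr fun x => by ring

lemma isWeight_deriv (i j : Fin 3) (n : ℕ) :
    IsWeight fun x => (if j = i then 1 else 0) * wt R x ^ (n + 1) +
      -(n + 1) * ((x i * x j) * wt R x ^ (n + 3)) :=
  ((isWeight_const _).mul ((isWeight_wt hR).pow _)).add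
    ((isWeight_const _).mul (isWeight_coord_mul_coord hR i j (n + 1)))

/-- Put `h = √(R² + |x|²)`, so that `∇h = x · wt R x` and `Δh = 2r + R² r³` with `r = wt R x`. The
multiplier of `Δa + a` is `∇h·∇a + ½ Δh a`. Integration by parts leaves the Hessian form `D²h(∇a,
∇a)` and `-¼ Δ²h a²`, which are the last two groups of terms. Both are nonnegative: `h` is convex
and `-Δ²h = 15 R⁴ r⁷`. The zero-order part of `Δa + a` contributes only the divergence of `½ a² ∇h`.
-/
lemma isNull_morawetz (a : 𝓢(E, ℝ)) :
    IsNull fun x => ((Δ a) x + a x) * (wt R x * ∑ i, x i * (∂_{basis i} a : 𝓢(E, ℝ)) x +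
        (wt R x + R ^ 2 / 2 * wt R x ^ 3) * a x) +
      (wt R x * ∑ i, (∂_{basis i} a : 𝓢(E, ℝ)) x ^ 2 -
        wt R x ^ 3 * (∑ i, x i * (∂_{basis i} a : 𝓢(E, ℝ)) x) ^ 2) +
      15 / 4 * R ^ 4 * wt R x ^ 7 * a x ^ 2 := by
  have hX : ∀ i j, HasPartial (fun x => x j * wt R x ^ (0 + 1)) _ i :=
    fun i j => hasPartial_coord_mul_wt_pow hR i j 0
  have wX : ∀ j, IsWeight fun x => x j * wt R x ^ (0 + 1) :=
    fun j => isWeight_coord_mul_wt_pow hR j 0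
  have wX' := fun i j => isWeight_deriv hR i j 0
  have hD : ∀ i, HasPartial (fun x => 2 * wt R x ^ (0 + 1) + R ^ 2 * wt R x ^ (2 + 1)) _ i :=
    fun i => ((hasPartial_wt_pow hR i 0).const_mul 2).add
      ((hasPartial_wt_pow hR i 2).const_mul (R ^ 2))
  have wD : IsWeight fun x => 2 * wt R x ^ (0 + 1) + R ^ 2 * wt R x ^ (2 + 1) :=
    ((isWeight_const 2).mul ((isWeight_wt hR).pow _)).add
      ((isWeight_const (R ^ 2)).mul ((isWeight_wt hR).pow _))
  have hD' := fun i => (((hasPartial_coord_mul_wt_pow hR i i 2).const_mul (-(((0 : ℕ) : ℝ) + 1))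
    ).const_mul 2).add (((hasPartial_coord_mul_wt_pow hR i i 4).const_mul (-(((2 : ℕ) : ℝ) + 1))
    ).const_mul (R ^ 2))
  have wD' := fun i => ((isWeight_const (2 : ℝ)).mul ((isWeight_const (-(((0 : ℕ) : ℝ) + 1))).mul
      (isWeight_coord_mul_wt_pow hR i 2))).add ((isWeight_const (R ^ 2)).mul
      ((isWeight_const (-(((2 : ℕ) : ℝ) + 1))).mul (isWeight_coord_mul_wt_pow hR i 4)))
  have wD'' := fun i => ((isWeight_const (2 : ℝ)).mul ((isWeight_const (-(((0 : ℕ) : ℝ) + 1))).mul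
      (isWeight_deriv hR i i 2))).add ((isWeight_const (R ^ 2)).mul
      ((isWeight_const (-(((2 : ℕ) : ℝ) + 1))).mul (isWeight_deriv hR i i 4)))
  have t1 := IsNull.sum fun i => IsNull.sum fun j =>
    isNull_of_hasPartial (hX i j) (wX j) (wX' i j) (∂_{basis i} a) (∂_{basis j} a)
  have t2 := (IsNull.sum fun i => IsNull.sum fun j =>
    isNull_of_hasPartial (hX i i) (wX i) (wX' i i) (∂_{basis j} a) (∂_{basis j} a)).const_mul
      (-(1 / 2))
  have t3 := (IsNull.sum fun i =>
    isNull_of_hasPartial (hD i) wD (wD' i) (∂_{basis i} a) a).const_mul (1 / 2)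
  have t4 := (IsNull.sum fun i =>
    isNull_of_hasPartial (hD' i) (wD' i) (wD'' i) a a).const_mul (-(1 / 4))
  have t5 := (IsNull.sum fun i =>
    isNull_of_hasPartial (hX i i) (wX i) (wX' i i) a a).const_mul (1 / 2)
  refine ((((t1.add t2).add t3).add t4).add t5).congr fun x => ?_
  have c01 := lineDeriv_basis_comm a 0 1 x
  have c02 := lineDeriv_basis_comm a 0 2 x
  have c12 := lineDeriv_basis_comm a 1 2 x
  have h := wt_sq_mul hR x
  rw [laplacian_eq_sum_basis]
  simp only [Fin.sum_univ_three, add_apply, c01, c02, c12]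
  norm_num [show (2 : Fin 3) ≠ 0 by decide, show (0 : Fin 3) ≠ 2 by decide,
    show (2 : Fin 3) ≠ 1 by decide, show (1 : Fin 3) ≠ 2 by decide]
  set r := wt R x
  set a0 := (∂_{basis 0} a : 𝓢(E, ℝ)) x
  set a1 := (∂_{basis 1} a : 𝓢(E, ℝ)) x
  set a2 := (∂_{basis 2} a : 𝓢(E, ℝ)) x
  -- The coefficient collects the terms in which `|x|²` still occurs: the gradient and zero-order
  -- terms involving `div ∇h`, and the two parts of `Δ²h`.
  linear_combination ((1 / 2) * r * (a0 ^ 2 + a1 ^ 2 + a2 ^ 2) - (1 / 2) * r * a x ^ 2 -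
    (1 / 4) * (6 * r ^ 3 + 15 * R ^ 2 * r ^ 5) * a x ^ 2) * h

end Morawetz

/-! ### The uniform Morawetz estimate -/

/-- The real part of a Schwartz function. -/
def reS (v : 𝓢(E, ℂ)) : 𝓢(E, ℝ) := v.postcompCLM Complex.reCLM

/-- The imaginary part of a Schwartz function. -/
def imS (v : 𝓢(E, ℂ)) : 𝓢(E, ℝ) := v.postcompCLM Complex.imCLM

lemma laplacian_reS (v : 𝓢(E, ℂ)) (x : E) : (Δ (reS v)) x = ((Δ v) x).re := by
  rw [SchwartzMap.laplacian_apply, SchwartzMap.laplacian_apply]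
  exact (v.smooth 2).contDiffAt.laplacian_CLM_comp_left (l := Complex.reCLM)

lemma laplacian_imS (v : 𝓢(E, ℂ)) (x : E) : (Δ (imS v)) x = ((Δ v) x).im := by
  rw [SchwartzMap.laplacian_apply, SchwartzMap.laplacian_apply]
  exact (v.smooth 2).contDiffAt.laplacian_CLM_comp_left (l := Complex.imCLM)

/-- The square length of the gradient of a real Schwartz function. -/
def gradSq (a : 𝓢(E, ℝ)) (x : E) : ℝ := ∑ i, (∂_{basis i} a : 𝓢(E, ℝ)) x ^ 2

/-- The energy density `|v|² + |∇v|²`. -/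
def energy (v : 𝓢(E, ℂ)) (x : E) : ℝ :=
  (reS v x ^ 2 + imS v x ^ 2) + (gradSq (reS v) x + gradSq (imS v) x)

lemma gradSq_nonneg (a : 𝓢(E, ℝ)) (x : E) : 0 ≤ gradSq a x :=
  Finset.sum_nonneg fun _ _ => sq_nonneg _

lemma norm_sq_le_energy (v : 𝓢(E, ℂ)) (x : E) : ‖v x‖ ^ 2 ≤ energy v x := by
  have : ‖v x‖ ^ 2 = reS v x ^ 2 + imS v x ^ 2 := by
    rw [← Complex.normSq_eq_norm_sq, Complex.normSq_apply, sq, sq]; rfl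
  have h1 := gradSq_nonneg (reS v) x
  have h2 := gradSq_nonneg (imS v) x
  rw [energy]
  linarith

lemma energy_nonneg (v : 𝓢(E, ℂ)) (x : E) : 0 ≤ energy v x :=
  (sq_nonneg _).trans (norm_sq_le_energy v x)

lemma integrable_energy (v : 𝓢(E, ℂ)) : Integrable (energy v) := by
  have h : ∀ s : 𝓢(E, ℝ), Integrable fun x => s x ^ 2 := fun s => by
    simpa only [sq] using! (s.memLp 2 volume).integrable_mul (s.memLp 2 volume)
  exact ((h _).add (h _)).add ((integrable_finsetSum _ fun i _ => h _).add
    (integrable_finsetSum _ fun i _ => h _))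

lemma continuous_energy (v : 𝓢(E, ℂ)) : Continuous (energy v) := by
  unfold energy gradSq
  have h : ∀ s : 𝓢(E, ℝ), Continuous s := fun s => s.continuous
  have h1 := fun i : Fin 3 => h (∂_{basis i} (reS v))
  have h2 := fun i : Fin 3 => h (∂_{basis i} (imS v))
  have h3 := h (reS v)
  have h4 := h (imS v)
  fun_prop

lemma sq_coord_sum_le (a : 𝓢(E, ℝ)) (x : E) :
    (∑ i, x i * (∂_{basis i} a : 𝓢(E, ℝ)) x) ^ 2 ≤ (x 0 ^ 2 + x 1 ^ 2 + x 2 ^ 2) * gradSq a x := by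
  have := Finset.sum_mul_sq_le_sq_mul_sq Finset.univ (fun i => x i)
    (fun i => (∂_{basis i} a : 𝓢(E, ℝ)) x)
  rw [Fin.sum_univ_three (fun i => x i ^ 2)] at this
  exact this

lemma cross_le {a b p q F G : ℝ} (hF : 0 ≤ F) (hG : 0 ≤ G) (h1 : p ^ 2 + q ^ 2 = F ^ 2)
    (h2 : a ^ 2 + b ^ 2 ≤ G ^ 2) : |a * p + b * q| ≤ F * G := by
  refine abs_le_of_sq_le_sq ?_ (by positivity)
  have : (a * p + b * q) ^ 2 ≤ (a ^ 2 + b ^ 2) * (p ^ 2 + q ^ 2) := by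
    nlinarith [sq_nonneg (a * q - b * p)]
  calc _ ≤ (a ^ 2 + b ^ 2) * (p ^ 2 + q ^ 2) := this
    _ ≤ G ^ 2 * F ^ 2 := by rw [h1]; gcongr
    _ = _ := by ring

/-- Here `v = a + ib` and `(Δ + 1 - iδ) v = p + iq`, so that `Δa + a = p - δb` and `Δb + b = q +
δa`. The letters `Na`, `Nb` stand for squared gradients, `Sa`, `Sb` for the products of `x` with the
gradients, and `F`, `G` for `|p + iq|` and the square root of the energy. To `9FG` the right-hand
side adds twice the Morawetz terms, minus the energy terms with weight `R² r³`, plus twice the skew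
term, plus `δ` times the unweighted energy terms.

The Morawetz terms give `2 R² r³ |∇v|²`. The weighted energy trades one copy of this for `R² r³
|v|²`, which yields the left-hand side. Absorption enters the Morawetz terms through `-2δ r (b Sa -
a Sb)`, which is at least `-δ (|v|² + |∇v|²)`. The skew and unweighted energy terms produce exactly
`+δ (|v|² + |∇v|²)`, so no loss in `δ` remains. -/
lemma morawetz_pointwise {R δ r X2 a b p q Sa Sb Na Nb F G : ℝ} (hR : 1 ≤ R) (hδ : 0 < δ)
    (hδ1 : δ ≤ 1) (hr : 0 < r) (hX0 : 0 ≤ X2) (hw : r ^ 2 * (R ^ 2 + X2) = 1) (hF0 : 0 ≤ F)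
    (hG0 : 0 ≤ G) (hF : p ^ 2 + q ^ 2 = F ^ 2) (hG : a ^ 2 + b ^ 2 + (Na + Nb) = G ^ 2)
    (hNa : 0 ≤ Na) (hNb : 0 ≤ Nb) (hSa : Sa ^ 2 ≤ X2 * Na) (hSb : Sb ^ 2 ≤ X2 * Nb) :
    R ^ 2 * r ^ 3 * (a ^ 2 + b ^ 2 + (Na + Nb)) ≤ 9 * (F * G) +
      (2 * (((p - δ * b) * (r * Sa + (r + R ^ 2 / 2 * r ^ 3) * a) + (r * Na - r ^ 3 * Sa ^ 2) +
          15 / 4 * R ^ 4 * r ^ 7 * a ^ 2) +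
        ((q + δ * a) * (r * Sb + (r + R ^ 2 / 2 * r ^ 3) * b) + (r * Nb - r ^ 3 * Sb ^ 2) +
          15 / 4 * R ^ 4 * r ^ 7 * b ^ 2)) -
      ((R ^ 2 * r ^ 3 * (a * (p - δ * b - a) + Na) - (6 * R ^ 2 * r ^ 5 - 15 * R ^ 4 * r ^ 7) / 2 *
          a ^ 2) +
        (R ^ 2 * r ^ 3 * (b * (q + δ * a - b) + Nb) - (6 * R ^ 2 * r ^ 5 - 15 * R ^ 4 * r ^ 7) / 2 *
          b ^ 2)) +
      2 * (a * (q + δ * a - b) - b * (p - δ * b - a)) +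
      δ * ((a * (p - δ * b - a) + Na) + (b * (q + δ * a - b) + Nb))) := by
  have hR0 : 0 < R := by linarith
  have hsq := sq_nonneg r
  have hrR : r ^ 2 * R ^ 2 ≤ 1 := by nlinarith [mul_nonneg hsq hX0]
  have hrX : r ^ 2 * X2 ≤ 1 := by nlinarith [mul_nonneg hsq (sq_nonneg R)]
  have hr1 : r ≤ 1 := by
    have h1 : r ^ 2 * 1 ≤ r ^ 2 * R ^ 2 := by gcongr; exact one_le_pow₀ hR
    nlinarith
  have hSa' : (r * Sa) ^ 2 ≤ Na := by
    calc _ = r ^ 2 * Sa ^ 2 := by ring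
      _ ≤ r ^ 2 * (X2 * Na) := by gcongr
      _ = (r ^ 2 * X2) * Na := by ring
      _ ≤ _ := mul_le_of_le_one_left hNa hrX
  have hSb' : (r * Sb) ^ 2 ≤ Nb := by
    calc _ = r ^ 2 * Sb ^ 2 := by ring
      _ ≤ r ^ 2 * (X2 * Nb) := by gcongr
      _ = (r ^ 2 * X2) * Nb := by ring
      _ ≤ _ := mul_le_of_le_one_left hNb hrX
  have hFG : 0 ≤ F * G := by positivity
  have c1 := cross_le hF0 hG0 hF (a := a) (b := b) (by linarith)
  have c2 := cross_le hF0 hG0 hF (a := r * Sa) (b := r * Sb)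
    (by linarith [sq_nonneg a, sq_nonneg b])
  have c3 := cross_le hF0 hG0 hF (a := b) (b := -a) (by linarith [neg_sq a])
  have hφ1 : R ^ 2 * r ^ 3 ≤ 1 := by
    calc R ^ 2 * r ^ 3 = (r ^ 2 * R ^ 2) * r := by ring
      _ ≤ 1 * 1 := by gcongr
      _ = 1 := one_mul 1
  have hφ0 : 0 ≤ R ^ 2 * r ^ 3 := by positivity
  have hD : r + R ^ 2 / 2 * r ^ 3 ≤ 3 / 2 := by linarith
  have hD0 : 0 ≤ r + R ^ 2 / 2 * r ^ 3 := by positivity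
  have c4 : |(r + R ^ 2 / 2 * r ^ 3) * (a * p + b * q)| ≤ 3 / 2 * (F * G) := by
    rw [abs_mul, abs_of_nonneg hD0]; gcongr
  have c5 : r * (b * Sa - a * Sb) ≤ 1 / 2 * (a ^ 2 + b ^ 2 + (Na + Nb)) := by
    nlinarith [sq_nonneg (b - r * Sa), sq_nonneg (a + r * Sb)]
  have c6 : |R ^ 2 * r ^ 3 * (a * p + b * q)| ≤ 1 * (F * G) := by
    rw [abs_mul, abs_of_nonneg hφ0]; gcongr
  have c7 : R ^ 2 * r ^ 3 * (Na + Nb) ≤ r * (Na + Nb) - r ^ 3 * (Sa ^ 2 + Sb ^ 2) := by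
    have : r ^ 3 * (Sa ^ 2 + Sb ^ 2) ≤ r ^ 3 * (X2 * (Na + Nb)) := by gcongr; linarith
    have e : r ^ 3 * (X2 * (Na + Nb)) = r * (Na + Nb) - R ^ 2 * r ^ 3 * (Na + Nb) := by
      linear_combination r * (Na + Nb) * hw
    linarith
  have c8 : |δ * (a * p + b * q)| ≤ 1 * (F * G) := by
    rw [abs_mul, abs_of_pos hδ]; gcongr
  -- In the coefficient of `|v|²`, twice `15/4 R⁴ r⁷` cancels the `-15/2 R⁴ r⁷` coming from the
  -- Laplacian of the weight. What is left is `3 R² r⁵`, which has a good sign.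
  have c9 : 0 ≤ R ^ 2 * r ^ 5 * (a ^ 2 + b ^ 2) := by positivity
  have c5' := mul_le_mul_of_nonneg_left c5 hδ.le
  -- The constant is `9 = 2 + 3 + 1 + 2 + 1`, from `c2`, `c4`, `c6`, `c3`, `c8` with their
  -- multiplicities.
  linarith [(abs_le.1 c2).1, (abs_le.1 c3).2, (abs_le.1 c4).1, (abs_le.1 c6).2, (abs_le.1 c8).1]

/-- The uniform Morawetz estimate, with a weight at scale `R`. -/
lemma integral_weight_mul_energy_le {R δ : ℝ} (hR : 1 ≤ R) (hδ : 0 < δ) (hδ1 : δ ≤ 1)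
    (v : 𝓢(E, ℂ)) :
    ∫ x, R ^ 2 * wt R x ^ 3 * energy v x ≤ 9 * ∫ x, ‖helmholtz δ v x‖ * √(energy v x) := by
  have hR0 : 0 < R := by linarith
  set a := reS v with ha
  set b := imS v with hb
  have h1' : ∀ i, HasPartial (fun _ : E => (1 : ℝ)) (fun _ => 0) i := fun i x => by
    exact hasDerivAt_const _ _
  have h0' : ∀ i, HasPartial (fun _ : E => (0 : ℝ)) (fun _ => 0) i := fun i x => by
    exact hasDerivAt_const _ _
  have n1 := (isNull_morawetz hR0 a).add (isNull_morawetz hR0 b)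
  have n2 := isNull_skew a b
  have n3 := (isNull_energy h1' h0' (isWeight_const _) (fun _ => isWeight_const _)
    (fun _ => isWeight_const _) a).add (isNull_energy h1' h0' (isWeight_const _)
    (fun _ => isWeight_const _) (fun _ => isWeight_const _) b)
  have hφ : ∀ i, HasPartial (fun x => R ^ 2 * wt R x ^ (2 + 1)) _ i :=
    fun i => (hasPartial_wt_pow hR0 i 2).const_mul (R ^ 2)
  have hφ' := fun i => ((hasPartial_coord_mul_wt_pow hR0 i i 4).const_mul
    (-(((2 : ℕ) : ℝ) + 1))).const_mul (R ^ 2)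
  have wφ : IsWeight fun x => R ^ 2 * wt R x ^ (2 + 1) :=
    (isWeight_const (R ^ 2)).mul ((isWeight_wt hR0).pow _)
  have wφ' := fun i => (isWeight_const (R ^ 2)).mul ((isWeight_const (-(((2 : ℕ) : ℝ) + 1))).mul
    (isWeight_coord_mul_wt_pow hR0 i 4))
  have wφ'' := fun i => (isWeight_const (R ^ 2)).mul ((isWeight_const (-(((2 : ℕ) : ℝ) + 1))).mul
    (isWeight_deriv hR0 i i 4))
  have n4 := (isNull_energy hφ hφ' wφ wφ' wφ'' a).add (isNull_energy hφ hφ' wφ wφ' wφ'' b)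
  have nn := (((n1.const_mul 2).add (n4.const_mul (-1))).add (n2.const_mul 2)).add (n3.const_mul δ)
  have hJ : Integrable fun x => ‖helmholtz δ v x‖ * √(energy v x) := by
    have : MemLp (fun x => √(energy v x)) 2 volume := by
      refine (memLp_two_iff_integrable_sq
        (continuous_energy v).sqrt.aestronglyMeasurable).2 ?_
      simpa only [Real.sq_sqrt (energy_nonneg v _)] using integrable_energy v
    exact ((helmholtz δ v).memLp 2 volume).norm.integrable_mul this
  rw [← integral_const_mul]
  -- The combination `nn` has integral zero, so it may be added to the right-hand side for free. The
  -- inequality then holds pointwise.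
  have e0 := nn.2
  rw [← add_zero (∫ x, 9 * (‖helmholtz δ v x‖ * √(energy v x))), ← e0,
    ← integral_add (hJ.const_mul 9) nn.1]
  refine integral_mono_of_nonneg (.of_forall fun x => ?_) ((hJ.const_mul 9).add nn.1)
    (.of_forall fun x => ?_)
  · have := energy_nonneg v x
    have := (wt_pos hR0 x).le
    positivity
  simp only []
  have hp : (helmholtz δ v x).re = (Δ a) x + a x + δ * b x := by
    rw [laplacian_reS]
    simp [helmholtz]
    change _ + ((v x).re + δ * (v x).im) = _ + (v x).re + δ * (v x).im
    ring
  have hq : (helmholtz δ v x).im = (Δ b) x + b x - δ * a x := by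
    rw [laplacian_imS]
    simp [helmholtz]
    change _ + ((v x).im + -(δ * (v x).re)) = _ + (v x).im - δ * (v x).re
    ring
  have hF : (helmholtz δ v x).re ^ 2 + (helmholtz δ v x).im ^ 2 = ‖helmholtz δ v x‖ ^ 2 := by
    rw [← Complex.normSq_eq_norm_sq, Complex.normSq_apply, sq, sq]
  have hG : (a x ^ 2 + b x ^ 2) + (gradSq a x + gradSq b x) = √(energy v x) ^ 2 :=
    (Real.sq_sqrt (energy_nonneg v x)).symm
  have hG0 := Real.sqrt_nonneg (energy v x)
  have hF0 := norm_nonneg (helmholtz δ v x)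
  have hw := wt_sq_mul hR0 x
  have hr := wt_pos hR0 x
  have hSa := sq_coord_sum_le a x
  have hSb := sq_coord_sum_le b x
  have hNa := gradSq_nonneg a x
  have hNb := gradSq_nonneg b x
  rw [show R ^ 2 * wt R x ^ 3 * energy v x = R ^ 2 * wt R x ^ 3 * ((a x ^ 2 + b x ^ 2) +
    (gradSq a x + gradSq b x)) from rfl]
  change _ ≤ 9 * (‖helmholtz δ v x‖ * √(energy v x)) + _
  have hsum : ∀ a : 𝓢(E, ℝ), ∑ i, (∂_{basis i} a : 𝓢(E, ℝ)) x ^ 2 = gradSq a x := fun _ => rfl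
  simp only [hsum]
  set G := √(energy v x)
  set F := ‖helmholtz δ v x‖
  set p := (helmholtz δ v x).re
  set q := (helmholtz δ v x).im
  set r := wt R x
  set Sa := ∑ i, x i * (∂_{basis i} a : 𝓢(E, ℝ)) x
  set Sb := ∑ i, x i * (∂_{basis i} b : 𝓢(E, ℝ)) x
  set Na := gradSq a x
  set Nb := gradSq b x
  have hla : (Δ a) x = p - δ * b x - a x := by rw [hp]; ring
  have hlb : (Δ b) x = q + δ * a x - b x := by rw [hq]; ring
  rw [hla, hlb]
  simp only [Fin.sum_univ_three, if_true]
  -- The Laplacian of the weight `R² r³`, with `|x|²` eliminated.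
  have hΔφ : R ^ 2 * (-(((2 : ℕ) : ℝ) + 1) * (1 * r ^ (4 + 1) + -(((4 : ℕ) : ℝ) + 1) * (x 0 * x 0 *
      r ^ (4 + 3)))) + R ^ 2 * (-(((2 : ℕ) : ℝ) + 1) * (1 * r ^ (4 + 1) + -(((4 : ℕ) : ℝ) + 1) *
      (x 1 * x 1 * r ^ (4 + 3)))) + R ^ 2 * (-(((2 : ℕ) : ℝ) + 1) * (1 * r ^ (4 + 1) +
      -(((4 : ℕ) : ℝ) + 1) * (x 2 * x 2 * r ^ (4 + 3)))) = 6 * R ^ 2 * r ^ 5 - 15 * R ^ 4 * r ^ 7 := by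
    push_cast
    linear_combination 15 * R ^ 2 * r ^ 5 * hw
  rw [hΔφ]
  have key := morawetz_pointwise hR hδ hδ1 hr (by positivity) hw hF0 hG0 hF hG hNa hNb hSa hSb
  refine key.trans (le_of_eq ?_)
  ring

/-! ### The space `B`: duality and density of test functions -/

lemma measurableSet_ring (n : ℕ) : MeasurableSet (ring n) := by
  cases n with
  | zero => exact measurableSet_lt (f := fun x : E => ‖x‖) measurable_norm measurable_const
  | succ j =>
    exact (measurableSet_le (g := fun x : E => ‖x‖) measurable_const measurable_norm).inter
      (measurableSet_lt (f := fun x : E => ‖x‖) measurable_norm measurable_const)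

lemma norm_lt_of_mem_ring {n : ℕ} {x : E} (h : x ∈ ring n) : ‖x‖ < 2 ^ n := by
  cases n with
  | zero => simpa [ring] using h
  | succ j => exact h.2

lemma disjoint_ring_of_lt {m n : ℕ} (h : m < n) : Disjoint (ring m) (ring n) := by
  refine Set.disjoint_left.2 fun x hm hn => ?_
  obtain ⟨j, rfl⟩ : ∃ j, n = j + 1 := ⟨n - 1, by omega⟩
  have h1 := norm_lt_of_mem_ring hm
  have h2 : (2 : ℝ) ^ m ≤ 2 ^ j := pow_le_pow_right₀ one_le_two (by omega)
  exact absurd hn.1 (by linarith [h2])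

lemma pairwise_disjoint_ring : Pairwise (Function.onFun Disjoint ring) := by
  intro m n h
  rcases lt_or_gt_of_ne h with h | h
  · exact disjoint_ring_of_lt h
  · exact (disjoint_ring_of_lt h).symm

lemma iUnion_ring : ⋃ n, ring n = Set.univ := by
  refine Set.eq_univ_of_forall fun x => Set.mem_iUnion.2 ?_
  have hex : ∃ n : ℕ, ‖x‖ < 2 ^ n := pow_unbounded_of_one_lt _ one_lt_two
  classical
  refine ⟨Nat.find hex, ?_⟩
  have h1 := Nat.find_spec hex
  rcases h : Nat.find hex with _ | j
  · rw [h] at h1; simpa [ring] using h1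
  · rw [h] at h1
    exact ⟨not_lt.1 (Nat.find_min hex (m := j) (by omega)), h1⟩

lemma lintegral_eq_tsum_ring (g : E → ℝ≥0∞) :
    ∫⁻ x, g x = ∑' n, ∫⁻ x in ring n, g x := by
  rw [← lintegral_iUnion measurableSet_ring pairwise_disjoint_ring, iUnion_ring,
    Measure.restrict_univ]

/-- The contribution of one ring to the norm of `B`. -/
def ringNorm (n : ℕ) (f : E → ℂ) : ℝ≥0∞ :=
  (2 : ℝ≥0∞) ^ (n / 2 : ℝ) * eLpNorm f 2 (volume.restrict (ring n))

lemma eLpNorm_two_eq {μ : Measure E} (f : E → ℂ) :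
    eLpNorm f 2 μ = (∫⁻ x, ‖f x‖ₑ ^ 2 ∂μ) ^ (1 / 2 : ℝ) := by
  rw [eLpNorm_eq_lintegral_rpow_enorm_toReal (by simp) (by simp)]
  simp

lemma eLpNorm_two_sq {μ : Measure E} (f : E → ℂ) :
    eLpNorm f 2 μ ^ 2 = ∫⁻ x, ‖f x‖ₑ ^ 2 ∂μ := by
  rw [eLpNorm_two_eq, ← ENNReal.rpow_natCast, ← ENNReal.rpow_mul]
  simp

lemma normB_eq_tsum (f : E → ℂ) : normB f = ∑' n, ringNorm n f := by
  refine tsum_congr fun n => ?_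
  rw [ringNorm, eLpNorm_two_eq, ENNReal.mul_rpow_of_nonneg _ _ (by norm_num),
    ← ENNReal.rpow_natCast, ← ENNReal.rpow_mul]
  congr 2
  ring

lemma eLpNorm_ring_le (n : ℕ) (f : E → ℂ) :
    eLpNorm f 2 (volume.restrict (ring n)) ≤ ringNorm n f := by
  refine le_mul_of_one_le_left' ?_
  rw [← ENNReal.one_rpow (n / 2 : ℝ)]
  exact ENNReal.rpow_le_rpow (by norm_num) (by positivity)

/-- A sum of squares over the rings is at most the square of the sum, and the dyadic weights are at
least `1`. -/
lemma eLpNorm_le_normB (f : E → ℂ) : eLpNorm f 2 volume ≤ normB f := by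
  refine (ENNReal.pow_le_pow_left_iff two_ne_zero).1 ?_
  rw [eLpNorm_two_sq, lintegral_eq_tsum_ring, normB_eq_tsum, sq, ← ENNReal.tsum_mul_right]
  refine ENNReal.tsum_le_tsum fun n => ?_
  rw [← eLpNorm_two_sq, sq]
  exact mul_le_mul' (eLpNorm_ring_le n f) ((eLpNorm_ring_le n f).trans (ENNReal.le_tsum n))

lemma normB_add_le {f g : E → ℂ} (hf : AEStronglyMeasurable f volume)
    (hg : AEStronglyMeasurable g volume) : normB (fun x => f x + g x) ≤ normB f + normB g := by
  simp only [normB_eq_tsum]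
  rw [← ENNReal.tsum_add]
  refine ENNReal.tsum_le_tsum fun n => ?_
  rw [ringNorm, ringNorm, ringNorm, ← mul_add]
  gcongr
  exact eLpNorm_add_le hf.restrict hg.restrict (by norm_num)

lemma normB_neg (f : E → ℂ) : normB (fun x => -f x) = normB f := by
  simp [normB]

lemma normB_sub_comm (f g : E → ℂ) :
    normB (fun x => f x - g x) = normB (fun x => g x - f x) := by
  rw [← normB_neg]; simp

lemma normB_sub_le {f g h : E → ℂ} (hf : AEStronglyMeasurable f volume)
    (hg : AEStronglyMeasurable g volume) (hh : AEStronglyMeasurable h volume) :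
    normB (fun x => f x - h x) ≤ normB (fun x => f x - g x) + normB (fun x => g x - h x) := by
  have := normB_add_le (f := fun x => f x - g x) (g := fun x => g x - h x) (hf.sub hg) (hg.sub hh)
  simpa using this

lemma MemB.memLp {f : E → ℂ} (hf : MemB f) : MemLp f 2 volume :=
  ⟨hf.1, (eLpNorm_le_normB f).trans_lt hf.2⟩

lemma MemB.sub {f g : E → ℂ} (hf : MemB f) (hg : MemB g) : MemB fun x => f x - g x := by
  refine ⟨hf.1.sub hg.1, ?_⟩
  have := normB_add_le (g := fun x => -g x) hf.1 hg.1.neg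
  simp only [normB_neg, ← sub_eq_add_neg] at this
  exact this.trans_lt (ENNReal.add_lt_top.2 ⟨hf.2, hg.2⟩)

/-- Duality between `B` and the space of functions of bounded mean square growth. -/
lemma lintegral_mul_le_normB {f : E → ℂ} {g : E → ℂ} (hf : AEStronglyMeasurable f volume)
    (hg : AEStronglyMeasurable g volume) {K : ℝ≥0∞}
    (hK : ∀ n, ∫⁻ x in ring n, ‖g x‖ₑ ^ 2 ≤ 2 ^ n * K) :
    ∫⁻ x, ‖f x‖ₑ * ‖g x‖ₑ ≤ normB f * K ^ (1 / 2 : ℝ) := by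
  rw [lintegral_eq_tsum_ring, normB, ← ENNReal.tsum_mul_right]
  refine ENNReal.tsum_le_tsum fun n => ?_
  have h := ENNReal.lintegral_mul_le_Lp_mul_Lq (volume.restrict (ring n))
    Real.HolderConjugate.two_two hf.enorm.restrict hg.enorm.restrict
  refine h.trans ?_
  have e : ((2 : ℝ≥0∞) ^ n * ∫⁻ x in ring n, ‖f x‖ₑ ^ 2) ^ (1 / 2 : ℝ) * K ^ (1 / 2 : ℝ) =
      (∫⁻ x in ring n, ‖f x‖ₑ ^ 2) ^ (1 / 2 : ℝ) * (2 ^ n * K) ^ (1 / 2 : ℝ) := by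
    rw [ENNReal.mul_rpow_of_nonneg _ _ (by norm_num), ENNReal.mul_rpow_of_nonneg _ _ (by norm_num)]
    ring
  rw [e]
  simp only [ENNReal.rpow_two]
  exact mul_le_mul_right (ENNReal.rpow_le_rpow (z := 1 / 2) (hK n) (by norm_num)) _

lemma ringNorm_eq_zero {n : ℕ} {f : E → ℂ} (h : ∀ x ∈ ring n, f x = 0) : ringNorm n f = 0 := by
  have : f =ᵐ[volume.restrict (ring n)] 0 :=
    (ae_restrict_mem (measurableSet_ring n)).mono fun x hx => h x hx
  rw [ringNorm, eLpNorm_congr_ae this, eLpNorm_zero, mul_zero]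

lemma pow_le_norm_of_mem_ring {M n : ℕ} (h : M < n) {x : E} (hx : x ∈ ring n) :
    2 ^ M ≤ ‖x‖ := by
  obtain ⟨j, rfl⟩ : ∃ j, n = j + 1 := ⟨n - 1, by omega⟩
  exact (pow_le_pow_right₀ one_le_two (by omega)).trans hx.1

/-- On functions with support in a fixed ball, the norm of `B` is controlled by that of `L²`. -/
lemma normB_le_of_support {f : E → ℂ} {M : ℕ} (hf : ∀ x, 2 ^ M ≤ ‖x‖ → f x = 0) :
    normB f ≤ (∑ n ∈ Finset.range (M + 1), (2 : ℝ≥0∞) ^ (n / 2 : ℝ)) * eLpNorm f 2 volume := by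
  rw [normB_eq_tsum, tsum_eq_sum (s := Finset.range (M + 1)), Finset.sum_mul]
  · refine Finset.sum_le_sum fun n _ => ?_
    rw [ringNorm]
    gcongr
    exact Measure.restrict_le_self
  · intro n hn
    exact ringNorm_eq_zero fun x hx =>
      hf x (pow_le_norm_of_mem_ring (by simpa using hn) hx)

lemma sum_rpow_ne_top (M : ℕ) :
    ∑ n ∈ Finset.range (M + 1), (2 : ℝ≥0∞) ^ (n / 2 : ℝ) ≠ ⊤ :=
  ENNReal.sum_ne_top.2 fun n _ => ENNReal.rpow_ne_top_of_nonneg (by positivity) (by norm_num)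

lemma memB_of_support {f : E → ℂ} (hf : MemLp f 2 volume) {M : ℕ}
    (h : ∀ x, 2 ^ M ≤ ‖x‖ → f x = 0) : MemB f :=
  ⟨hf.1, (normB_le_of_support h).trans_lt (ENNReal.mul_lt_top (sum_rpow_ne_top M).lt_top hf.2)⟩

lemma IsTestFunction.memLp {f : E → ℂ} (hf : IsTestFunction f) (p : ℝ≥0∞) : MemLp f p volume :=
  hf.1.continuous.memLp_of_hasCompactSupport hf.2

lemma exists_pow_support {f : E → ℂ} (hf : HasCompactSupport f) :
    ∃ M : ℕ, ∀ x, 2 ^ M ≤ ‖x‖ → f x = 0 := by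
  obtain ⟨r, hr⟩ := hf.isCompact.isBounded.subset_ball 0
  obtain ⟨M, hM⟩ := pow_unbounded_of_one_lt r one_lt_two
  refine ⟨M, fun x hx => image_eq_zero_of_notMem_tsupport fun h => ?_⟩
  have := mem_ball_zero_iff.1 (hr h)
  linarith

lemma IsTestFunction.memB {f : E → ℂ} (hf : IsTestFunction f) : MemB f :=
  (exists_pow_support hf.2).elim fun _ h => memB_of_support (hf.memLp 2) h

/-- Restriction of a function to a dyadic ball. -/
def truncate (M : ℕ) (f : E → ℂ) : E → ℂ := Set.indicator {x | ‖x‖ < 2 ^ M} f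

lemma measurableSet_norm_lt (r : ℝ) : MeasurableSet {x : E | ‖x‖ < r} :=
  measurableSet_lt (f := fun x : E => ‖x‖) measurable_norm measurable_const

lemma tendsto_normB_sub_truncate {f : E → ℂ} (hf : MemB f) :
    Tendsto (fun M => normB fun x => f x - truncate M f x) atTop (𝓝 0) := by
  have h := ENNReal.tendsto_sum_nat_add (fun n => ringNorm n f)
    (by rw [← normB_eq_tsum]; exact hf.2.ne)
  refine tendsto_of_tendsto_of_tendsto_of_le_of_le tendsto_const_nhds h (fun _ => zero_le)
    fun M => ?_
  have h0 : ∀ n < M, ringNorm n (fun x => f x - truncate M f x) = 0 := fun n hn =>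
    ringNorm_eq_zero fun x hx => by
      have : ‖x‖ < 2 ^ M := (norm_lt_of_mem_ring hx).trans_le
        (pow_le_pow_right₀ one_le_two hn.le)
      simp [truncate, this]
  simp only [normB_eq_tsum]
  rw [← Summable.sum_add_tsum_nat_add' (k := M) ENNReal.summable,
    Finset.sum_eq_zero fun n hn => h0 n (Finset.mem_range.1 hn), zero_add]
  refine ENNReal.tsum_le_tsum fun n => ?_
  rw [ringNorm, ringNorm]
  refine mul_le_mul_right (eLpNorm_mono fun x => ?_) _
  by_cases hx : ‖x‖ < 2 ^ M <;> simp [truncate, hx]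

lemma tendsto_eLpNorm_one_sub_truncate {f : E → ℂ} (hf : Integrable f volume) :
    Tendsto (fun M => eLpNorm (fun x => f x - truncate M f x) 1 volume) atTop (𝓝 0) := by
  simp only [eLpNorm_one_eq_lintegral_enorm]
  rw [← lintegral_zero (μ := (volume : Measure E))]
  refine tendsto_lintegral_of_dominated_convergence' (fun x => ‖f x‖ₑ) (fun M => ?_)
    (fun M => .of_forall fun x => ?_) hf.2.ne (.of_forall fun x => ?_)
  · exact (hf.1.sub (hf.1.indicator (measurableSet_norm_lt _))).enorm
  · by_cases hx : ‖x‖ < 2 ^ M <;> simp [truncate, hx]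
  · obtain ⟨M, hM⟩ := pow_unbounded_of_one_lt ‖x‖ (one_lt_two (α := ℝ))
    refine tendsto_const_nhds.congr' ?_
    filter_upwards [eventually_ge_atTop M] with n hn
    have : ‖x‖ < 2 ^ n := hM.trans_le (pow_le_pow_right₀ one_le_two hn)
    simp [truncate, this]

lemma eLpNorm_one_le_of_support {f : E → ℂ} (hm : AEStronglyMeasurable f volume) {r : ℝ}
    (hf : ∀ x, r ≤ ‖x‖ → f x = 0) :
    eLpNorm f 1 volume ≤ volume (ball (0 : E) r) ^ (1 / 2 : ℝ) * eLpNorm f 2 volume := by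
  have hs : Function.support f ⊆ ball (0 : E) r := fun x hx => by
    by_contra h
    exact hx (hf x (by simpa using h))
  rw [← eLpNorm_restrict_eq_of_support_subset hs (p := 1)]
  refine (eLpNorm_le_eLpNorm_mul_rpow_measure_univ (q := 2) (by norm_num) hm.restrict).trans ?_
  rw [mul_comm, Measure.restrict_apply_univ]
  refine mul_le_mul' (le_of_eq ?_) (eLpNorm_mono_measure _ Measure.restrict_le_self)
  norm_num

/-- Smooth compactly supported functions are dense in `B`, and in `B ∩ L¹`. -/
lemma exists_testFunction_approx {f : E → ℂ} (hf : MemB f) {ε : ℝ≥0∞} (hε : 0 < ε) :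
    ∃ g, IsTestFunction g ∧ normB (fun x => f x - g x) ≤ ε ∧
      (Integrable f volume → eLpNorm (fun x => f x - g x) 1 volume ≤ ε) := by
  have hε2 : 0 < ε / 2 := ENNReal.half_pos hε.ne'
  obtain ⟨M, hM1, hM2⟩ : ∃ M, normB (fun x => f x - truncate M f x) ≤ ε / 2 ∧
      (Integrable f volume → eLpNorm (fun x => f x - truncate M f x) 1 volume ≤ ε / 2) := by
    have h1 := (tendsto_normB_sub_truncate hf).eventually (Iic_mem_nhds hε2)
    by_cases hi : Integrable f volume
    · obtain ⟨M, h⟩ := (h1.and ((tendsto_eLpNorm_one_sub_truncate hi).eventually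
        (Iic_mem_nhds hε2))).exists
      exact ⟨M, h.1, fun _ => h.2⟩
    · obtain ⟨M, h⟩ := h1.exists
      exact ⟨M, h, fun h => absurd h hi⟩
  set f₁ := truncate M f with hf₁
  have hf₁m : MemLp f₁ 2 volume := hf.memLp.indicator (measurableSet_norm_lt _)
  obtain ⟨m, hm⟩ := exists_nat_ge ((2 : ℝ) ^ M)
  obtain ⟨L, hL⟩ := exists_pow_support (isTestFunction_cutoff m).2
  set C := (∑ n ∈ Finset.range (L + 1), (2 : ℝ≥0∞) ^ (n / 2 : ℝ)) +
    volume (ball (0 : E) (2 ^ L)) ^ (1 / 2 : ℝ) with hC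
  have hCt : C ≠ ⊤ := ENNReal.add_ne_top.2 ⟨sum_rpow_ne_top L,
    ENNReal.rpow_ne_top_of_nonneg (by norm_num) measure_ball_lt_top.ne⟩
  -- After truncation and multiplication by a fixed cutoff everything lives in the ball of radius `2
  -- ^ L`. There `C` times the `L²` norm dominates both the `B` norm and the `L¹` norm, so an `L²`
  -- approximation with error `η` suffices for both.
  obtain ⟨η, hη, hηC⟩ : ∃ η : ℝ, 0 < η ∧ C * ENNReal.ofReal η ≤ ε / 2 := by
    have : Tendsto (fun η : ℝ => C * ENNReal.ofReal η) (𝓝[>] 0) (𝓝 0) := by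
      have h := (ENNReal.tendsto_ofReal (tendsto_id (α := ℝ) (x := 𝓝 0))).mono_left
        (nhdsWithin_le_nhds (s := Set.Ioi 0))
      have := ENNReal.Tendsto.const_mul (a := C) h (.inr hCt)
      simpa using this
    obtain ⟨η, h⟩ := ((this.eventually (Iic_mem_nhds hε2)).and self_mem_nhdsWithin).exists
    exact ⟨η, h.2, h.1⟩
  obtain ⟨g, hg1, hg2, hg3⟩ := hf₁m.exist_eLpNorm_sub_le (by norm_num) (by norm_num) hη
  have hg : IsTestFunction fun x => cutoff m x * g x :=
    ⟨(isTestFunction_cutoff m).1.mul hg2, hg1.mul_left⟩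
  have hd : ∀ x, f₁ x - cutoff m x * g x = cutoff m x * (f₁ x - g x) := fun x => by
    by_cases hx : ‖x‖ < 2 ^ M
    · rw [cutoff_eq_one (by linarith)]; simp
    · simp [hf₁, truncate, hx]
  have hs : ∀ x, 2 ^ L ≤ ‖x‖ → f₁ x - cutoff m x * g x = 0 := fun x hx => by
    rw [hd, hL x hx, zero_mul]
  have h2 : eLpNorm (fun x => f₁ x - cutoff m x * g x) 2 volume ≤ ENNReal.ofReal η := by
    refine le_trans (eLpNorm_mono fun x => ?_) hg3
    rw [hd, norm_mul]
    exact mul_le_of_le_one_left (norm_nonneg _) (norm_cutoff_le m x)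
  have hgm := (hg.memLp 2).1
  refine ⟨_, hg, ?_, fun hi => ?_⟩
  · refine (normB_sub_le hf.1 hf₁m.1 hgm).trans ?_
    rw [← ENNReal.add_halves ε]
    refine add_le_add hM1 (((normB_le_of_support hs).trans (mul_le_mul' ?_ h2)).trans hηC)
    exact le_self_add
  · have e : (fun x => f x - cutoff m x * g x) =
      (fun x => f x - f₁ x) + fun x => f₁ x - cutoff m x * g x := by ext x; simp
    rw [e, ← ENNReal.add_halves ε]
    refine (eLpNorm_add_le (hf.1.sub hf₁m.1) (hf₁m.1.sub hgm) le_rfl).trans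
      (add_le_add (hM2 hi) (((eLpNorm_one_le_of_support (hf₁m.1.sub hgm) hs).trans
        (mul_le_mul' ?_ h2)).trans hηC))
    exact le_add_self

/-! ### The resolvent from `B` to weighted `L²`, uniformly in the absorption -/

/-- The weighted measure `R² (R² + |x|²)^{-3/2} dx`. -/
def weightMeasure (R : ℝ) : Measure E :=
  volume.withDensity fun x => ENNReal.ofReal (R ^ 2 * wt R x ^ 3)

lemma measurable_weight {R : ℝ} (hR : 0 < R) :
    Measurable fun x : E => ENNReal.ofReal (R ^ 2 * wt R x ^ 3) :=
  (((continuous_wt hR).pow 3).const_mul (R ^ 2)).measurable.ennreal_ofReal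

lemma weightMeasure_le_volume {R : ℝ} (hR : 1 ≤ R) : weightMeasure R ≤ volume := by
  have h0 : 0 < R := by linarith
  have : weightMeasure R ≤ (volume : Measure E).withDensity 1 := by
    refine withDensity_mono (.of_forall fun x => ?_)
    rw [Pi.one_apply, ← ENNReal.ofReal_one]
    refine ENNReal.ofReal_le_ofReal ?_
    have h1 : wt R x ^ 3 ≤ R⁻¹ ^ 3 := pow_le_pow_left₀ (wt_pos h0 x).le (wt_le h0 x) 3
    calc R ^ 2 * wt R x ^ 3 ≤ R ^ 2 * R⁻¹ ^ 3 := by gcongr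
      _ = R⁻¹ := by field_simp
      _ ≤ 1 := inv_le_one_of_one_le₀ hR
  rwa [withDensity_one] at this

lemma weightMeasure_absolutelyContinuous (R : ℝ) : weightMeasure R ≪ volume :=
  withDensity_absolutelyContinuous _ _

lemma lintegral_weightMeasure {R : ℝ} (hR : 0 < R) {g : E → ℝ≥0∞} (hg : AEMeasurable g volume) :
    ∫⁻ x, g x ∂weightMeasure R = ∫⁻ x, ENNReal.ofReal (R ^ 2 * wt R x ^ 3) * g x :=
  lintegral_withDensity_eq_lintegral_mul₀ (measurable_weight hR).aemeasurable hg

lemma cube_ge_of_sq_ge {t : ℝ} (ht : 0 < t) (h : 1 / 2 ≤ t ^ 2) : 1 ≤ 3 * t ^ 3 := by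
  have h3 : (1 / 2) ^ 3 ≤ (t ^ 2) ^ 3 := pow_le_pow_left₀ (by norm_num) h 3
  nlinarith [pow_pos ht 3]

/-- Where `‖x‖ < R = 2 ^ n` one has `(R · wt R x)² ≥ 1/2`, hence `(R · wt R x)³ ≥ 2^{-3/2} > 1/3`.
So the Morawetz weight at scale `R` controls the whole ring up to the factor `3 R`. -/
lemma one_le_weight {n : ℕ} {x : E} (hx : x ∈ ring n) :
    1 ≤ 3 * 2 ^ n * (((2 : ℝ) ^ n) ^ 2 * wt (2 ^ n) x ^ 3) := by
  set R : ℝ := 2 ^ n with hR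
  have h0 : 0 < R := by positivity
  have h1 : ‖x‖ < R := norm_lt_of_mem_ring hx
  have h2 := wt_sq_mul h0 x
  rw [← norm_sq_eq_sum] at h2
  have h3 : ‖x‖ ^ 2 ≤ R ^ 2 := pow_le_pow_left₀ (norm_nonneg _) h1.le 2
  have hw := wt_pos h0 x
  have := cube_ge_of_sq_ge (mul_pos h0 hw) (by nlinarith [sq_nonneg (wt R x)])
  linarith [this, show 3 * R * (R ^ 2 * wt R x ^ 3) = 3 * (R * wt R x) ^ 3 by ring]

lemma memLp_sqrt_energy (v : 𝓢(E, ℂ)) :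
    MemLp (fun x => √(energy v x)) 2 volume := by
  have hc : Continuous fun x => √(energy v x) := (continuous_energy v).sqrt
  refine (memLp_two_iff_integrable_sq hc.aestronglyMeasurable).2 ?_
  exact (integrable_energy v).congr (.of_forall fun x => (Real.sq_sqrt (energy_nonneg v x)).symm)

lemma integrable_weight_mul_energy {R : ℝ} (hR : 0 < R) (v : 𝓢(E, ℂ)) :
    Integrable fun x => R ^ 2 * wt R x ^ 3 * energy v x := by
  refine (integrable_energy v).bdd_mul (c := R ^ 2 * R⁻¹ ^ 3)
    (((continuous_wt hR).pow 3).const_mul _).aestronglyMeasurable (.of_forall fun x => ?_)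
  have := wt_pos hR x
  rw [Real.norm_of_nonneg (by positivity)]
  have := wt_le hR x
  gcongr

/-- The Morawetz estimate used at the scale of each ring separately. The constant is `27 = 3 · 9`.
The bound says that the root of the energy lies in the dual of `B`. -/
lemma lintegral_ring_energy_le {δ : ℝ} (hδ : 0 < δ) (hδ1 : δ ≤ 1) (v : 𝓢(E, ℂ)) (n : ℕ) :
    ∫⁻ x in ring n, ‖((√(energy v x) : ℝ) : ℂ)‖ₑ ^ 2 ≤
      2 ^ n * ENNReal.ofReal (27 * ∫ x, ‖helmholtz δ v x‖ * √(energy v x)) := by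
  have hR : (1 : ℝ) ≤ 2 ^ n := one_le_pow₀ one_le_two
  have e : ∀ x, ‖((√(energy v x) : ℝ) : ℂ)‖ₑ ^ 2 = ENNReal.ofReal (energy v x) := fun x => by
    rw [← ofReal_norm, Complex.norm_real, Real.norm_of_nonneg (Real.sqrt_nonneg _),
      ← ENNReal.ofReal_pow (Real.sqrt_nonneg _), Real.sq_sqrt (energy_nonneg v x)]
  simp only [e]
  calc ∫⁻ x in ring n, ENNReal.ofReal (energy v x)
      ≤ ∫⁻ x in ring n, ENNReal.ofReal (3 * 2 ^ n * ((2 ^ n) ^ 2 * wt (2 ^ n) x ^ 3 * energy v x)) := by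
        refine setLIntegral_mono' (measurableSet_ring n) fun x hx => ENNReal.ofReal_le_ofReal ?_
        have := mul_le_mul_of_nonneg_right (one_le_weight hx) (energy_nonneg v x)
        linarith
    _ ≤ ∫⁻ x, ENNReal.ofReal (3 * 2 ^ n * ((2 ^ n) ^ 2 * wt (2 ^ n) x ^ 3 * energy v x)) :=
        setLIntegral_le_lintegral _ _
    _ = ENNReal.ofReal (∫ x, 3 * 2 ^ n * ((2 ^ n) ^ 2 * wt (2 ^ n) x ^ 3 * energy v x)) := by
        rw [ofReal_integral_eq_lintegral_ofReal]
        · exact (integrable_weight_mul_energy (by positivity) v).const_mul _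
        · refine .of_forall fun x => ?_
          have := (wt_pos (show (0 : ℝ) < 2 ^ n by positivity) x).le
          have := energy_nonneg v x
          simp only [Pi.zero_apply]
          positivity
    _ ≤ ENNReal.ofReal (2 ^ n * (27 * ∫ x, ‖helmholtz δ v x‖ * √(energy v x))) := by
        refine ENNReal.ofReal_le_ofReal ?_
        rw [integral_const_mul]
        have := mul_le_mul_of_nonneg_left (integral_weight_mul_energy_le hR hδ hδ1 v)
          (show (0 : ℝ) ≤ 3 * 2 ^ n by positivity)
        linarith
    _ = _ := by
        rw [ENNReal.ofReal_mul (by positivity), ENNReal.ofReal_pow (by norm_num)]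
        simp

/-- Squaring and dividing by `J`; this is why `J` must be known to be finite beforehand. -/
lemma le_of_le_mul_rpow_half {J B c : ℝ≥0∞} (hJ : J ≠ ⊤)
    (h : J ≤ B * (c * J) ^ (1 / 2 : ℝ)) : J ≤ c * B ^ 2 := by
  rcases eq_or_ne J 0 with rfl | hJ0
  · exact zero_le
  have h2 : J * J ≤ B ^ 2 * (c * J) := by
    have := pow_le_pow_left₀ zero_le h 2
    rw [mul_pow, ← ENNReal.rpow_natCast ((c * J) ^ (1 / 2 : ℝ)), ← ENNReal.rpow_mul] at this
    simpa [sq] using this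
  rw [show B ^ 2 * (c * J) = (c * B ^ 2) * J by ring] at h2
  exact (ENNReal.mul_le_mul_iff_left hJ0 hJ).1 h2

/-- The quantity `J = ∫ |f| √energy` bounds its own dual factor: pairing `f ∈ B` with the root of
the energy gives `J ≤ ‖f‖_B (27 J)^{1/2}`, and `J` is then absorbed. -/
lemma ofReal_integral_helmholtz_mul_energy_le {δ : ℝ} (hδ : 0 < δ) (hδ1 : δ ≤ 1) (v : 𝓢(E, ℂ)) :
    ENNReal.ofReal (∫ x, ‖helmholtz δ v x‖ * √(energy v x)) ≤
      27 * normB (helmholtz δ v) ^ 2 := by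
  set J := ∫ x, ‖helmholtz δ v x‖ * √(energy v x) with hJ
  have hi : Integrable (fun x => ‖helmholtz δ v x‖ * √(energy v x)) volume :=
    MemLp.integrable_mul (p := 2) (q := 2) ((helmholtz δ v).memLp 2 volume).norm
      (memLp_sqrt_energy v)
  have hm : AEStronglyMeasurable (fun x => ((√(energy v x) : ℝ) : ℂ)) volume :=
    (Complex.continuous_ofReal.comp (continuous_energy v).sqrt).aestronglyMeasurable
  have h := lintegral_mul_le_normB ((helmholtz δ v).memLp 2 volume).1 hm
    (lintegral_ring_energy_le hδ hδ1 v)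
  refine le_of_le_mul_rpow_half ENNReal.ofReal_ne_top (le_trans (le_of_eq ?_)
    (h.trans_eq ?_))
  · rw [hJ, ofReal_integral_eq_lintegral_ofReal hi (.of_forall fun x => by
      simp only [Pi.zero_apply]; positivity)]
    refine lintegral_congr fun x => ?_
    rw [ENNReal.ofReal_mul (norm_nonneg _), ofReal_norm, ← ofReal_norm,
      ← ofReal_norm ((√(energy v x) : ℝ) : ℂ), Complex.norm_real,
      Real.norm_of_nonneg (Real.sqrt_nonneg _)]
  · rw [← hJ, ENNReal.ofReal_mul (by norm_num)]
    simp

/-- The uniform estimate for Schwartz functions. -/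
lemma eLpNorm_weight_le {R δ : ℝ} (hR : 1 ≤ R) (hδ : 0 < δ) (hδ1 : δ ≤ 1) (v : 𝓢(E, ℂ)) :
    eLpNorm v 2 (weightMeasure R) ≤ 16 * normB (helmholtz δ v) := by
  have h0 : 0 < R := by linarith
  refine (ENNReal.pow_le_pow_left_iff two_ne_zero).1 ?_
  rw [eLpNorm_two_sq, lintegral_weightMeasure h0 (v.continuous.enorm.measurable.pow_const 2).aemeasurable]
  calc ∫⁻ x, ENNReal.ofReal (R ^ 2 * wt R x ^ 3) * ‖v x‖ₑ ^ 2
      ≤ ∫⁻ x, ENNReal.ofReal (R ^ 2 * wt R x ^ 3 * energy v x) := by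
        refine lintegral_mono fun x => ?_
        have := (wt_pos h0 x).le
        rw [ENNReal.ofReal_mul (p := R ^ 2 * wt R x ^ 3) (by positivity), ← ofReal_norm,
          ← ENNReal.ofReal_pow (norm_nonneg _)]
        gcongr
        exact norm_sq_le_energy v x
    _ = ENNReal.ofReal (∫ x, R ^ 2 * wt R x ^ 3 * energy v x) := by
        rw [ofReal_integral_eq_lintegral_ofReal (integrable_weight_mul_energy h0 v)]
        refine .of_forall fun x => ?_
        have := (wt_pos h0 x).le
        have := energy_nonneg v x
        simp only [Pi.zero_apply]
        positivity
    _ ≤ ENNReal.ofReal (9 * ∫ x, ‖helmholtz δ v x‖ * √(energy v x)) :=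
        ENNReal.ofReal_le_ofReal (integral_weight_mul_energy_le hR hδ hδ1 v)
    _ ≤ 9 * (27 * normB (helmholtz δ v) ^ 2) := by
        rw [ENNReal.ofReal_mul (by norm_num), ENNReal.ofReal_ofNat]
        gcongr
        exact ofReal_integral_helmholtz_mul_energy_le hδ hδ1 v
    -- `9 · 27 = 243 ≤ 256 = 16²`.
    _ ≤ (16 * normB (helmholtz δ v)) ^ 2 := by
        rw [mul_pow, ← mul_assoc]
        gcongr
        norm_num

lemma aestronglyMeasurable_weightMeasure {f : E → ℂ} (hf : AEStronglyMeasurable f volume) (R : ℝ) :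
    AEStronglyMeasurable f (weightMeasure R) :=
  hf.mono_ac (weightMeasure_absolutelyContinuous R)

/-- The uniform estimate for the resolvent on `B`. -/
lemma eLpNorm_resolvent_weight_le {R δ : ℝ} (hR : 1 ≤ R) (hδ : 0 < δ) (hδ1 : δ ≤ 1) {f : E → ℂ}
    (hf : MemB f) :
    eLpNorm (resolvent δ (hf.memLp.toLp f)) 2 (weightMeasure R) ≤ 16 * normB f := by
  set F := hf.memLp.toLp f with hF
  refine ENNReal.le_of_forall_pos_le_add fun η hη _ => ?_
  -- The approximation error is measured with the operator norm on `L²`, which is not uniform in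
  -- `δ`. This does no harm: `δ` is fixed and `ε` is chosen after it.
  set C : ℝ≥0∞ := 16 + ‖resolvent δ‖ₑ with hC
  have hCt : C ≠ ⊤ := by simp [hC]
  obtain ⟨ε, hε, hεC⟩ : ∃ ε : ℝ≥0∞, 0 < ε ∧ C * ε ≤ η := by
    refine ⟨η / C, ENNReal.div_pos (by simpa using hη.ne') hCt, ENNReal.mul_div_le⟩
  obtain ⟨g, hg, hgB, -⟩ := exists_testFunction_approx hf hε
  let s : 𝓢(E, ℂ) := hg.2.toSchwartzMap hg.1
  have hs : ∀ x, s x = g x := fun x => rfl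
  set v := schwartzResolvent δ s
  have hv : helmholtz δ v = s := helmholtz_schwartzResolvent hδ s
  have h1 : eLpNorm v 2 (weightMeasure R) ≤ 16 * normB s := by
    have := eLpNorm_weight_le hR hδ hδ1 v
    rwa [hv] at this
  have h2 : normB s ≤ normB f + ε := by
    have := normB_sub_le (h := fun _ => (0 : ℂ)) (g := f) (hg.memLp 2).1 hf.1
      aestronglyMeasurable_const
    simp only [sub_zero] at this
    rw [normB_sub_comm, add_comm] at this
    exact this.trans (by gcongr)
  have hR' : resolvent δ (s.toLp 2 volume) = v.toLp 2 volume := resolvent_toLp hδ s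
  have h3 : eLpNorm (fun x => resolvent δ F x - v x) 2 (weightMeasure R) ≤ ‖resolvent δ‖ₑ * ε := by
    calc eLpNorm (fun x => resolvent δ F x - v x) 2 (weightMeasure R)
        ≤ eLpNorm (fun x => resolvent δ F x - v x) 2 volume :=
          eLpNorm_mono_measure _ (weightMeasure_le_volume hR)
      _ = ‖resolvent δ (F - s.toLp 2 volume)‖ₑ := by
          rw [map_sub, hR', Lp.enorm_def]
          refine eLpNorm_congr_ae ?_
          filter_upwards [Lp.coeFn_sub (resolvent δ F) (v.toLp 2 volume),
            SchwartzMap.coeFn_toLp v 2 volume] with x h1 h2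
          rw [h1, Pi.sub_apply, h2]
      _ ≤ ‖resolvent δ‖ₑ * ‖F - s.toLp 2 volume‖ₑ := ContinuousLinearMap.le_opENorm _ _
      _ ≤ ‖resolvent δ‖ₑ * ε := by
          gcongr
          rw [Lp.enorm_def]
          refine le_trans (le_of_eq (eLpNorm_congr_ae ?_)) ((eLpNorm_le_normB _).trans hgB)
          filter_upwards [Lp.coeFn_sub F (s.toLp 2 volume), hf.memLp.coeFn_toLp,
            SchwartzMap.coeFn_toLp s 2 volume] with x h1 h2 h3
          rw [h1, Pi.sub_apply, h3, hF, h2, hs]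
  have e : (resolvent δ F : E → ℂ) = (fun x => resolvent δ F x - v x) + v := by ext x; simp
  have hm1 := aestronglyMeasurable_weightMeasure (Lp.aestronglyMeasurable (resolvent δ F)) R
  have hm2 := aestronglyMeasurable_weightMeasure (v.memLp 2 volume).1 R
  rw [e]
  refine (eLpNorm_add_le (hm1.sub hm2) hm2 (by norm_num)).trans ?_
  calc _ ≤ ‖resolvent δ‖ₑ * ε + 16 * (normB f + ε) := add_le_add h3 (h1.trans (by gcongr))
    _ = 16 * normB f + C * ε := by rw [hC]; ring
    _ ≤ _ := by gcongr

/-! ### The outgoing fundamental solution -/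

lemma integral_mul_laplacian_eq {K : E → ℂ} {K' K'' : Fin 3 → E → ℂ}
    (h : ∀ i, HasPartial K (K' i) i) (h' : ∀ i, HasPartial (K' i) (K'' i) i) (hK : IsWeight K)
    (hK' : ∀ i, IsWeight (K' i)) (hK'' : ∀ i, IsWeight (K'' i)) (ψ : 𝓢(E, ℂ)) :
    ∫ x, K x * (Δ ψ) x = ∫ x, (∑ i, K'' i x) * ψ x := by
  have int : ∀ {w : E → ℂ} (s : 𝓢(E, ℂ)), IsWeight w → Integrable fun x => w x * s x :=
    fun s hw => by
      obtain ⟨C, hC⟩ := hw.2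
      exact s.integrable.bdd_mul hw.1.aestronglyMeasurable (.of_forall hC)
  have ibp : ∀ {w w' : E → ℂ} {i : Fin 3} (s : 𝓢(E, ℂ)), HasPartial w w' i → IsWeight w →
      IsWeight w' → ∫ x, w x * (∂_{basis i} s : 𝓢(E, ℂ)) x = -∫ x, w' x * s x :=
    fun {w w' i} s h hw hw' =>
      integral_bilinear_hasLineDerivAt_right_eq_neg_left_of_integrable (μ := volume)
        (B := ContinuousLinearMap.mul ℝ ℂ) (v := basis i) (f := w) (f' := w')
        (int s hw') (int _ hw) (int s hw) (fun x _ => h x) (fun x _ => hasPartial_schwartz s i x)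
  rw [laplacian_eq_sum_basis]
  calc ∫ x, K x * (∑ i, (∂_{basis i} (∂_{basis i} ψ : 𝓢(E, ℂ)) : 𝓢(E, ℂ))) x
      = ∑ i, ∫ x, K x * (∂_{basis i} (∂_{basis i} ψ : 𝓢(E, ℂ)) : 𝓢(E, ℂ)) x := by
        rw [← integral_finsetSum _ fun i _ => int _ hK]
        congr 1 with x
        rw [sum_apply, Finset.mul_sum]
    _ = ∑ i, ∫ x, K'' i x * ψ x := by
        refine Finset.sum_congr rfl fun i _ => ?_
        rw [ibp _ (h i) hK (hK' i), ibp _ (h' i) (hK' i) (hK'' i), neg_neg]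
    _ = _ := by
        rw [← integral_finsetSum _ fun i _ => int _ (hK'' i)]
        simp only [Finset.sum_mul]

section Kernel

variable {η : ℝ} (hη : 0 < η) {κ : ℂ}

/-- The oscillating factor `exp (iκ √(η² + |x|²))`. -/
def osc (κ : ℂ) (η : ℝ) (x : E) : ℂ := Complex.exp (Complex.I * κ * (√(η ^ 2 + ‖x‖ ^ 2) : ℝ))

lemma norm_osc_le (hκ : 0 ≤ κ.im) (η : ℝ) (x : E) : ‖osc κ η x‖ ≤ 1 := by
  rw [osc, Complex.norm_exp, Real.exp_le_one_iff]
  simp only [Complex.mul_re, Complex.I_re, Complex.I_im, Complex.ofReal_re, Complex.ofReal_im,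
    Complex.mul_im]
  have := mul_nonneg hκ (Real.sqrt_nonneg (η ^ 2 + ‖x‖ ^ 2))
  linarith

lemma continuous_osc (κ : ℂ) (η : ℝ) : Continuous (osc κ η) := by
  unfold osc; fun_prop

include hη

lemma hasPartial_osc (i : Fin 3) :
    HasPartial (osc κ η) (fun x => Complex.I * κ * (x i * wt η x : ℝ) * osc κ η x) i := fun x => by
  have h1 : HasDerivAt (fun t : ℝ => η ^ 2 + ‖x + t • basis i‖ ^ 2) (2 * x i) 0 := by
    have := ((hasStrictFDerivAt_norm_sq x).hasFDerivAt.const_add (η ^ 2)).hasLineDerivAt (basis i)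
    have e : (2 • innerSL ℝ x) (basis i) = 2 * x i := by
      simp [basis, EuclideanSpace.inner_single_right]
    rw [e] at this
    exact this
  have h2 := h1.sqrt (by simp only [zero_smul, add_zero]; positivity)
  have h3 := (h2.ofReal_comp.const_mul (Complex.I * κ)).cexp
  refine HasDerivAt.congr_deriv h3 ?_
  simp only [zero_smul, add_zero]
  rw [mul_comm, osc]
  congr 3
  rw [wt]
  field_simp

lemma hasPartial_ofReal_wt (i : Fin 3) :
    HasPartial (fun x => (wt η x : ℂ)) (fun x => ((-(x i) * wt η x ^ 3 : ℝ) : ℂ)) i := fun x =>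
  HasDerivAt.ofReal_comp (hasPartial_wt hη i x)

omit hη in
lemma hasPartial_ofReal_coord (i : Fin 3) :
    HasPartial (fun x : E => (x i : ℂ)) (fun _ => 1) i := fun x => by
  refine HasDerivAt.congr_deriv (HasDerivAt.ofReal_comp (hasPartial_coord i i x)) (by simp)

lemma hasPartial_kernel (i : Fin 3) :
    HasPartial (fun x => osc κ η x * wt η x)
      (fun x => osc κ η x * (x i * (Complex.I * κ * wt η x ^ 2 - wt η x ^ 3))) i := fun x => by
  have := HasDerivAt.mul (hasPartial_osc hη (κ := κ) i x) (hasPartial_ofReal_wt hη i x)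
  refine HasDerivAt.congr_deriv this ?_
  simp only [zero_smul, add_zero]
  push_cast
  ring

lemma hasPartial_kernel_partial (i : Fin 3) :
    HasPartial (fun x => osc κ η x * (x i * (Complex.I * κ * wt η x ^ 2 - wt η x ^ 3)))
      (fun x => osc κ η x * ((Complex.I * κ * wt η x ^ 2 - wt η x ^ 3) + (x i) ^ 2 *
        (-κ ^ 2 * wt η x ^ 3 - 3 * Complex.I * κ * wt η x ^ 4 + 3 * wt η x ^ 5))) i := fun x => by
  have hw := hasPartial_ofReal_wt hη i x
  have := HasDerivAt.mul (hasPartial_osc hη (κ := κ) i x) (HasDerivAt.mul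
    (hasPartial_ofReal_coord i x) (HasDerivAt.sub
      (HasDerivAt.const_mul (Complex.I * κ) (HasDerivAt.pow hw 2)) (HasDerivAt.pow hw 3)))
  refine HasDerivAt.congr_deriv this ?_
  simp only [Pi.mul_apply, Pi.sub_apply, Pi.pow_apply, zero_smul, add_zero]
  push_cast
  linear_combination (osc κ η x * x i ^ 2 * wt η x ^ 3 * κ ^ 2) * Complex.I_sq

omit hη in
lemma isWeight_osc_mul (hκ : 0 ≤ κ.im) {w : E → ℂ} (hw : IsWeight w) :
    IsWeight fun x => osc κ η x * w x := by
  obtain ⟨C, hC⟩ := hw.2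
  refine ⟨(continuous_osc κ η).mul hw.1, C, fun x => ?_⟩
  rw [norm_mul]
  exact (mul_le_of_le_one_left (norm_nonneg _) (norm_osc_le hκ η x)).trans (hC x)

end Kernel

lemma IsWeight.ofReal {w : E → ℝ} (hw : IsWeight w) : IsWeight fun x => (w x : ℂ) := by
  obtain ⟨C, hC⟩ := hw.2
  exact ⟨Complex.continuous_ofReal.comp hw.1, C, fun x => by rw [Complex.norm_real]; exact hC x⟩

lemma IsWeight.add_complex {w s : E → ℂ} (hw : IsWeight w) (hs : IsWeight s) :
    IsWeight fun x => w x + s x := by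
  obtain ⟨C, hC⟩ := hw.2
  obtain ⟨D, hD⟩ := hs.2
  exact ⟨hw.1.add hs.1, C + D, fun x => (norm_add_le _ _).trans (add_le_add (hC x) (hD x))⟩

lemma IsWeight.const_mul_complex {w : E → ℂ} (hw : IsWeight w) (c : ℂ) :
    IsWeight fun x => c * w x := by
  obtain ⟨C, hC⟩ := hw.2
  refine ⟨hw.1.const_mul c, ‖c‖ * C, fun x => ?_⟩
  rw [norm_mul]
  gcongr
  exact hC x

lemma IsWeight.congr_complex {w s : E → ℂ} (hw : IsWeight w) (h : ∀ x, w x = s x) : IsWeight s :=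
  funext h ▸ hw

/-- Replacing `|x|` by `ρ = √(η² + |x|²)` makes the kernel `e^{iκρ}/ρ` smooth. In its Laplacian
write `|x|² = ρ² - η²`. The part with `ρ²` cancels against `κ² e^{iκρ}/ρ`, exactly as for the true
fundamental solution away from the origin, and only a remainder proportional to `η²` survives. -/
lemma integral_kernel_mul_helmholtz {η : ℝ} (hη : 0 < η) {κ : ℂ} (hκ : 0 ≤ κ.im) (ψ : 𝓢(E, ℂ)) :
    ∫ x, osc κ η x * wt η x * ((Δ ψ) x + κ ^ 2 * ψ x) =
      -∫ x, osc κ η x * (η ^ 2 * (-κ ^ 2 * wt η x ^ 3 - 3 * Complex.I * κ * wt η x ^ 4 +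
        3 * wt η x ^ 5)) * ψ x := by
  have hw := isWeight_wt hη
  have w0 : IsWeight fun x : E => osc κ η x * wt η x := isWeight_osc_mul hκ hw.ofReal
  have hc : ∀ i, IsWeight fun x : E => x i * wt η x := isWeight_coord_mul_wt hη
  have w1 : ∀ i : Fin 3, IsWeight fun x =>
      osc κ η x * (x i * (Complex.I * κ * wt η x ^ 2 - wt η x ^ 3)) := fun i => by
    refine isWeight_osc_mul hκ ((((((hc i).mul hw).ofReal.const_mul_complex
      (Complex.I * κ)).add_complex (((hc i).mul (hw.pow 2)).ofReal.const_mul_complex (-1)))).congr_complex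
      fun x => ?_)
    push_cast
    ring
  have w2 : ∀ i : Fin 3, IsWeight fun x => osc κ η x * ((Complex.I * κ * wt η x ^ 2 - wt η x ^ 3) +
      (x i) ^ 2 * (-κ ^ 2 * wt η x ^ 3 - 3 * Complex.I * κ * wt η x ^ 4 + 3 * wt η x ^ 5)) :=
    fun i => by
    have a := (hw.pow 2).ofReal.const_mul_complex (Complex.I * κ)
    have b := (hw.pow 3).ofReal.const_mul_complex (-1)
    have c := ((((hc i).pow 2).mul hw).ofReal.const_mul_complex (-κ ^ 2))
    have d := ((((hc i).pow 2).mul (hw.pow 2)).ofReal.const_mul_complex (-3 * Complex.I * κ))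
    have e := ((((hc i).pow 2).mul (hw.pow 3)).ofReal.const_mul_complex 3)
    refine isWeight_osc_mul hκ (((((a.add_complex b).add_complex c).add_complex d).add_complex
      e).congr_complex fun x => ?_)
    push_cast
    ring
  have key := integral_mul_laplacian_eq (fun i => hasPartial_kernel hη i)
    (fun i => hasPartial_kernel_partial hη i) w0 w1 w2 ψ
  have int : ∀ {w : E → ℂ} (s : 𝓢(E, ℂ)), IsWeight w → Integrable fun x => w x * s x :=
    fun s hw => by
      obtain ⟨C, hC⟩ := hw.2
      exact s.integrable.bdd_mul hw.1.aestronglyMeasurable (.of_forall hC)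
  have w3 : IsWeight fun x => ∑ i : Fin 3, osc κ η x * ((Complex.I * κ * wt η x ^ 2 - wt η x ^ 3) +
      (x i) ^ 2 * (-κ ^ 2 * wt η x ^ 3 - 3 * Complex.I * κ * wt η x ^ 4 + 3 * wt η x ^ 5)) := by
    simp only [Fin.sum_univ_three]
    exact ((w2 0).add_complex (w2 1)).add_complex (w2 2)
  calc ∫ x, osc κ η x * wt η x * ((Δ ψ) x + κ ^ 2 * ψ x)
      = (∫ x, osc κ η x * wt η x * (Δ ψ) x) + ∫ x, κ ^ 2 * (osc κ η x * wt η x) * ψ x := by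
        rw [← integral_add (int _ w0) (int _ (w0.const_mul_complex _))]
        congr 1 with x
        ring
    _ = _ := by
        rw [key, ← integral_add (int _ w3) (int _ (w0.const_mul_complex _)), ← integral_neg]
        congr 1 with x
        have h := congrArg ((↑) : ℝ → ℂ) (wt_sq_mul hη x)
        push_cast at h
        simp only [Fin.sum_univ_three]
        linear_combination (osc κ η x * ψ x * (-κ ^ 2 * wt η x - 3 * Complex.I * κ * wt η x ^ 2 +
          3 * wt η x ^ 3)) * h

lemma wt_le_one {x : E} : wt 1 x ≤ 1 := by simpa using wt_le one_pos x

lemma inv_one_add_norm_le_wt (x : E) : (1 + ‖x‖)⁻¹ ≤ wt 1 x := by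
  unfold wt
  have h : √(1 ^ 2 + ‖x‖ ^ 2) ≤ 1 + ‖x‖ :=
    Real.sqrt_le_iff.2 ⟨by positivity, by nlinarith [norm_nonneg x]⟩
  gcongr

lemma integrable_wt_pow_four : Integrable fun x : E => wt 1 x ^ 4 := by
  have h := integrable_rpow_neg_one_add_norm_sq (E := E) (μ := volume) (r := 4)
    (by simp; norm_num)
  refine h.congr (.of_forall fun x => ?_)
  have h0 : 0 < 1 + ‖x‖ ^ 2 := by positivity
  simp only
  rw [wt, inv_pow, one_pow, show √(1 + ‖x‖ ^ 2) ^ 4 = (√(1 + ‖x‖ ^ 2) ^ 2) ^ 2 by ring,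
    Real.sq_sqrt h0.le, show (-4 / 2 : ℝ) = -(2 : ℕ) by norm_num, Real.rpow_neg h0.le,
    Real.rpow_natCast]

lemma volume_real_ball_one : (volume : Measure E).real (ball 0 1) = 4 * Real.pi / 3 := by
  rw [measureReal_def, EuclideanSpace.volume_ball_fin_three, ENNReal.toReal_mul,
    ENNReal.toReal_pow, ENNReal.toReal_ofReal zero_le_one, ENNReal.toReal_ofReal (by positivity)]
  ring

/-- Three times this mass is the `4π` of the fundamental solution. In polar coordinates `(r/√(1 +
r²))³/3` is a primitive. -/
lemma integral_wt_pow_five : ∫ x : E, wt 1 x ^ 5 = 4 * Real.pi / 3 := by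
  have h1 := integral_fun_norm_addHaar (volume : Measure E)
    (fun r : ℝ => (√(1 ^ 2 + r ^ 2))⁻¹ ^ 5)
  have h2 : ∀ r : ℝ, HasDerivAt (fun r : ℝ => (r * (√(1 ^ 2 + r ^ 2))⁻¹) ^ 3 / 3)
      (r ^ 2 * (√(1 ^ 2 + r ^ 2))⁻¹ ^ 5) r := fun r => by
    have hp : 0 < 1 ^ 2 + r ^ 2 := by positivity
    have hs : HasDerivAt (fun r : ℝ => √(1 ^ 2 + r ^ 2)) (2 * r / (2 * √(1 ^ 2 + r ^ 2))) r := by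
      have := ((hasDerivAt_pow 2 r).const_add (1 ^ 2 : ℝ)).sqrt hp.ne'
      simpa using this
    have h := (((hasDerivAt_id r).mul (hs.inv (Real.sqrt_pos.2 hp).ne')).pow 3).div_const 3
    refine h.congr_deriv ?_
    have hq := Real.sq_sqrt hp.le
    have hs0 := (Real.sqrt_pos.2 hp).ne'
    simp only [Pi.mul_apply, id, Pi.inv_apply, Nat.cast_ofNat]
    generalize √(1 ^ 2 + r ^ 2) = s at hq hs0 ⊢
    simp only [inv_pow, mul_pow]
    field_simp
    linear_combination (r ^ 2 * s ^ 2) * hq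
  have h3 : Tendsto (fun r : ℝ => (r * (√(1 ^ 2 + r ^ 2))⁻¹) ^ 3 / 3) atTop (𝓝 (1 / 3)) := by
    have : Tendsto (fun r : ℝ => r * (√(1 ^ 2 + r ^ 2))⁻¹) atTop (𝓝 1) := by
      have h4 : Tendsto (fun r : ℝ => (√(1 + (r⁻¹) ^ 2))⁻¹) atTop (𝓝 1) := by
        have := (((tendsto_inv_atTop_zero (𝕜 := ℝ)).pow 2).const_add 1).sqrt.inv₀ (by simp)
        simpa using this
      refine h4.congr' ?_
      filter_upwards [eventually_gt_atTop 0] with r hr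
      rw [show (1 : ℝ) ^ 2 + r ^ 2 = r ^ 2 * (1 + r⁻¹ ^ 2) by field_simp; ring,
        Real.sqrt_mul (by positivity), Real.sqrt_sq hr.le, mul_inv, ← mul_assoc,
        mul_inv_cancel₀ hr.ne', one_mul]
    have := (this.pow 3).div_const 3
    simpa using this
  have h4 := integral_Ioi_of_hasDerivAt_of_nonneg' (fun r (_ : r ∈ Set.Ici (0 : ℝ)) => h2 r)
    (fun r _ => by positivity) h3
  have e : ∫ x : E, wt 1 x ^ 5 = ∫ x : E, (√(1 ^ 2 + ‖x‖ ^ 2))⁻¹ ^ 5 := rfl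
  rw [e, h1]
  simp only [finrank_euclideanSpace, Fintype.card_fin, smul_eq_mul, Nat.add_one_sub_one]
  rw [h4, volume_real_ball_one]
  simp
  ring

lemma integrableOn_inv_norm_ball : IntegrableOn (fun x : E => ‖x‖⁻¹) (ball 0 1) := by
  refine (integrableOn_fun_norm_addHaar (volume : Measure E) (f := fun r => r⁻¹)).2 ?_
  have : IntegrableOn (fun r : ℝ => r) (Set.Ioo 0 1) :=
    (continuous_id.integrableOn_Icc (a := (0 : ℝ)) (b := 1)).mono_set Set.Ioo_subset_Icc_self
  refine this.congr_fun (fun r hr => ?_) measurableSet_Ioo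
  have := hr.1.ne'
  simp only [finrank_euclideanSpace, Fintype.card_fin, smul_eq_mul, Nat.add_one_sub_one]
  field_simp

/-- A bound for the Newtonian potential. -/
lemma integrable_norm_mul_inv_norm {f : E → ℂ} (hf : Integrable f) {C : ℝ} (hC : ∀ x, ‖f x‖ ≤ C) :
    Integrable (fun x => ‖f x‖ * ‖x‖⁻¹) ∧
      ∫ x, ‖f x‖ * ‖x‖⁻¹ ≤ C * (∫ x in ball (0 : E) 1, ‖x‖⁻¹) + ∫ x, ‖f x‖ := by
  have hi : Integrable ((ball (0 : E) 1).indicator fun x => ‖x‖⁻¹) :=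
    (integrable_indicator_iff measurableSet_ball).2 integrableOn_inv_norm_ball
  have hle : ∀ x, ‖f x‖ * ‖x‖⁻¹ ≤ C * (ball (0 : E) 1).indicator (fun x => ‖x‖⁻¹) x + ‖f x‖ :=
    fun x => by
    have hC0 := (norm_nonneg _).trans (hC x)
    by_cases hx : ‖x‖ < 1
    · rw [Set.indicator_of_mem (by simpa using hx)]
      have := mul_le_mul_of_nonneg_right (hC x) (inv_nonneg.2 (norm_nonneg x))
      linarith [norm_nonneg (f x)]
    · rw [Set.indicator_of_notMem (by simpa using hx), mul_zero, zero_add]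
      exact mul_le_of_le_one_right (norm_nonneg _) (inv_le_one_of_one_le₀ (not_lt.1 hx))
  have hI : Integrable fun x => C * (ball (0 : E) 1).indicator (fun x => ‖x‖⁻¹) x + ‖f x‖ :=
    (hi.const_mul C).add hf.norm
  have hm : Integrable (fun x => ‖f x‖ * ‖x‖⁻¹) := by
    refine hI.mono' (hf.1.norm.mul (measurable_norm.inv.aestronglyMeasurable)) (.of_forall fun x => ?_)
    rw [Real.norm_of_nonneg (by positivity)]
    exact hle x
  refine ⟨hm, (integral_mono hm hI hle).trans (le_of_eq ?_)⟩
  rw [integral_add (hi.const_mul C) hf.norm, integral_const_mul,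
    integral_indicator measurableSet_ball]

/-- The outgoing fundamental solution, tested at the origin. -/
lemma integral_green_origin {κ : ℂ} (hκ : 0 ≤ κ.im) (ψ : 𝓢(E, ℂ)) :
    ∫ x, Complex.exp (Complex.I * κ * ‖x‖) * ((‖x‖⁻¹ : ℝ) : ℂ) * ((Δ ψ) x + κ ^ 2 * ψ x) =
      -(4 * Real.pi * ψ 0) := by
  set f : 𝓢(E, ℂ) := Δ ψ + κ ^ 2 • ψ with hf
  have hfx : ∀ x, (Δ ψ) x + κ ^ 2 * ψ x = f x := fun x => by simp [hf]
  simp only [hfx]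
  obtain ⟨C, hC⟩ : ∃ C, ∀ x, ‖f x‖ ≤ C := ⟨_, fun x => SchwartzMap.norm_le_seminorm ℝ f x⟩
  have hint := (integrable_norm_mul_inv_norm f.integrable hC).1
  have hm : ∀ η : ℝ, AEStronglyMeasurable (fun x => osc κ η x * wt η x * f x) volume := fun η => by
    refine Measurable.aestronglyMeasurable ?_
    unfold wt
    have := (continuous_osc κ η).measurable
    have := f.continuous.measurable
    fun_prop
  have lim1 : Tendsto (fun η : ℝ => ∫ x, osc κ η x * wt η x * f x) (𝓝[>] 0)
      (𝓝 (∫ x, Complex.exp (Complex.I * κ * ‖x‖) * ((‖x‖⁻¹ : ℝ) : ℂ) * f x)) := by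
    refine tendsto_integral_filter_of_dominated_convergence (fun x => ‖f x‖ * ‖x‖⁻¹)
      (.of_forall hm) ?_ hint ?_
    · filter_upwards [self_mem_nhdsWithin] with η hη
      have hne : ∀ᵐ x : E, x ≠ 0 := by simp [ae_iff, measure_singleton]
      filter_upwards [hne] with x hx
      rw [norm_mul, norm_mul, Complex.norm_real, Real.norm_of_nonneg (wt_pos hη x).le, mul_comm]
      have h1 : wt η x ≤ ‖x‖⁻¹ := by
        unfold wt
        have := norm_pos_iff.2 hx
        gcongr
        exact Real.le_sqrt_of_sq_le (by nlinarith [sq_nonneg η])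
      have := norm_osc_le hκ η x
      have h2 : ‖osc κ η x‖ * wt η x ≤ 1 * ‖x‖⁻¹ :=
        mul_le_mul this h1 (wt_pos hη x).le zero_le_one
      rw [one_mul] at h2
      gcongr
    · have hne : ∀ᵐ x : E, x ≠ 0 := by simp [ae_iff, measure_singleton]
      filter_upwards [hne] with x hx
      have hs : Tendsto (fun η : ℝ => √(η ^ 2 + ‖x‖ ^ 2)) (𝓝[>] 0) (𝓝 ‖x‖) := by
        have : Continuous fun η : ℝ => √(η ^ 2 + ‖x‖ ^ 2) := by fun_prop
        have := (this.tendsto 0).mono_left (nhdsWithin_le_nhds (s := Set.Ioi 0))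
        simpa using this
      have hw := hs.inv₀ (norm_ne_zero_iff.2 hx)
      have ho := ((Complex.continuous_ofReal.tendsto _).comp hs).const_mul (Complex.I * κ)
      exact (((Complex.continuous_exp.tendsto _).comp ho).mul
        ((Complex.continuous_ofReal.tendsto _).comp hw)).mul_const _
  -- Substituting `x = ηz` exhibits the remainder as an approximate identity: the term with `wt ^ 5`
  -- is scale invariant, and the other two carry factors `η` and `η²`.
  have scal : ∀ η : ℝ, 0 < η → ∫ x, osc κ η x * wt η x * f x =
      -∫ z, osc κ η (η • z) * (-κ ^ 2 * η ^ 2 * wt 1 z ^ 3 - 3 * Complex.I * κ * η * wt 1 z ^ 4 +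
        3 * wt 1 z ^ 5) * ψ (η • z) := fun η hη => by
    have h := integral_kernel_mul_helmholtz hη hκ ψ
    simp only [hfx] at h
    rw [h]
    congr 1
    have h2 := Measure.integral_comp_smul (volume : Measure E) (fun x => osc κ η x *
      (η ^ 2 * (-κ ^ 2 * wt η x ^ 3 - 3 * Complex.I * κ * wt η x ^ 4 + 3 * wt η x ^ 5)) * ψ x) η
    rw [finrank_euclideanSpace, Fintype.card_fin, abs_of_pos (by positivity)] at h2
    have h3 : ∫ x, osc κ η x * (η ^ 2 * (-κ ^ 2 * wt η x ^ 3 - 3 * Complex.I * κ * wt η x ^ 4 +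
        3 * wt η x ^ 5)) * ψ x = (η ^ 3 : ℝ) • ∫ x, osc κ η (η • x) * (η ^ 2 * (-κ ^ 2 *
        wt η (η • x) ^ 3 - 3 * Complex.I * κ * wt η (η • x) ^ 4 + 3 * wt η (η • x) ^ 5)) *
        ψ (η • x) := by
      rw [h2, smul_inv_smul₀ (by positivity)]
    rw [h3, ← integral_smul]
    congr 1 with z
    have hw : wt η (η • z) = η⁻¹ * wt 1 z := by
      unfold wt
      rw [norm_smul, Real.norm_of_nonneg hη.le, show η ^ 2 + (η * ‖z‖) ^ 2 = η ^ 2 *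
        (1 ^ 2 + ‖z‖ ^ 2) by ring, Real.sqrt_mul (by positivity), Real.sqrt_sq hη.le, mul_inv]
    have hη' : (η : ℂ) ≠ 0 := by exact_mod_cast hη.ne'
    rw [hw, Complex.real_smul]
    push_cast
    field_simp
  have lim2 : Tendsto (fun η : ℝ => ∫ z, osc κ η (η • z) * (-κ ^ 2 * η ^ 2 * wt 1 z ^ 3 -
        3 * Complex.I * κ * η * wt 1 z ^ 4 + 3 * wt 1 z ^ 5) * ψ (η • z)) (𝓝[>] 0)
      (𝓝 (∫ z : E, 3 * (wt 1 z : ℂ) ^ 5 * ψ 0)) := by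
    obtain ⟨D, hD⟩ := exists_schwartz_decay ψ 1 0
    have hD' : ∀ x, ‖ψ x‖ ≤ D * (1 + ‖x‖)⁻¹ := fun x => by
      have := hD 0 le_rfl x
      simpa using this
    have hD0 : 0 ≤ D := by
      have := (norm_nonneg _).trans (hD' 0)
      simpa using this
    refine tendsto_integral_filter_of_dominated_convergence
      (fun z => (‖κ‖ ^ 2 + 3 * ‖κ‖ + 3) * D * wt 1 z ^ 4) ?_ ?_
      (integrable_wt_pow_four.const_mul _) (.of_forall fun z => ?_)
    · refine .of_forall fun η => Continuous.aestronglyMeasurable ?_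
      have := (continuous_osc κ η)
      have := ψ.continuous
      have := continuous_wt (R := 1) one_pos
      fun_prop
    · filter_upwards [Ioc_mem_nhdsGT (show (0 : ℝ) < 1 by norm_num)] with η hη
      refine .of_forall fun z => ?_
      have hw := wt_pos one_pos z
      have hw1 := wt_le_one (x := z)
      have a1 : ‖ψ (η • z)‖ ≤ D := (hD' _).trans (mul_le_of_le_one_right hD0
        (inv_le_one_of_one_le₀ (by linarith [norm_nonneg (η • z)])))
      -- The weight `wt 1 ^ 3` is not integrable in dimension three. One factor `η` combined with
      -- the decay of `ψ` supplies the missing fourth power.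
      have a2 : η * ‖ψ (η • z)‖ ≤ D * wt 1 z := by
        have h1 := hD' (η • z)
        rw [norm_smul, Real.norm_of_nonneg hη.1.le] at h1
        have h2 : η * (1 + η * ‖z‖)⁻¹ ≤ (1 + ‖z‖)⁻¹ := by
          have hz := norm_nonneg z
          have := hη.1
          rw [← div_eq_mul_inv, ← one_div, div_le_div_iff₀ (by positivity) (by positivity)]
          nlinarith [hη.2]
        calc η * ‖ψ (η • z)‖ ≤ η * (D * (1 + η * ‖z‖)⁻¹) := by
              have := hη.1
              gcongr
          _ = D * (η * (1 + η * ‖z‖)⁻¹) := by ring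
          _ ≤ D * wt 1 z := by
              have := h2.trans (inv_one_add_norm_le_wt z)
              gcongr
      have n1 : ‖-κ ^ 2 * (η : ℂ) ^ 2 * (wt 1 z : ℂ) ^ 3 - 3 * Complex.I * κ * η * (wt 1 z : ℂ) ^ 4 +
          3 * (wt 1 z : ℂ) ^ 5‖ ≤ ‖κ‖ ^ 2 * η ^ 2 * wt 1 z ^ 3 + 3 * ‖κ‖ * η * wt 1 z ^ 4 +
          3 * wt 1 z ^ 5 := by
        refine (norm_add_le _ _).trans (add_le_add ((norm_sub_le _ _).trans (le_of_eq ?_))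
          (le_of_eq ?_))
        · simp [abs_of_pos hη.1, abs_of_pos hw]
        · simp [abs_of_pos hw]
      rw [norm_mul, norm_mul]
      have n2 := norm_osc_le hκ η (η • z)
      have hη0 := hη.1.le
      have hη1 := hη.2
      calc _ ≤ 1 * (‖κ‖ ^ 2 * η ^ 2 * wt 1 z ^ 3 + 3 * ‖κ‖ * η * wt 1 z ^ 4 +
          3 * wt 1 z ^ 5) * ‖ψ (η • z)‖ := by gcongr
        _ = ‖κ‖ ^ 2 * η * wt 1 z ^ 3 * (η * ‖ψ (η • z)‖) + 3 * ‖κ‖ * η * wt 1 z ^ 4 *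
            ‖ψ (η • z)‖ + 3 * wt 1 z ^ 4 * wt 1 z * ‖ψ (η • z)‖ := by ring
        _ ≤ ‖κ‖ ^ 2 * 1 * wt 1 z ^ 3 * (D * wt 1 z) + 3 * ‖κ‖ * 1 * wt 1 z ^ 4 *
            D + 3 * wt 1 z ^ 4 * 1 * D := by gcongr
        _ = _ := by ring
    · have c1 : Continuous fun η : ℝ => osc κ η (η • z) * (-κ ^ 2 * η ^ 2 * wt 1 z ^ 3 -
          3 * Complex.I * κ * η * wt 1 z ^ 4 + 3 * wt 1 z ^ 5) * ψ (η • z) := by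
        have := ψ.continuous
        unfold osc
        fun_prop
      have := (c1.tendsto 0).mono_left (nhdsWithin_le_nhds (s := Set.Ioi 0))
      simpa [osc] using this
  have e2 : ∫ z : E, 3 * (wt 1 z : ℂ) ^ 5 * ψ 0 = 4 * Real.pi * ψ 0 := by
    rw [integral_mul_const, integral_const_mul]
    have : ∫ z : E, (wt 1 z : ℂ) ^ 5 = ((4 * Real.pi / 3 : ℝ) : ℂ) := by
      rw [← integral_wt_pow_five, ← integral_complex_ofReal]
      push_cast
      rfl
    rw [this]
    push_cast
    ring
  rw [e2] at lim2
  refine tendsto_nhds_unique lim1 (lim2.neg.congr' ?_)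
  filter_upwards [self_mem_nhdsWithin] with η hη using (scal η hη).symm

/-! ### Polar coordinates and far fields -/

instance : IsFiniteMeasure deltaSphere :=
  Measure.smul_finite _ (by norm_num)

lemma two_mul_lintegral_deltaSphere {g : E → ℝ≥0∞} (hg : Measurable g) :
    2 * ∫⁻ θ, g θ ∂deltaSphere =
      ∫⁻ θ : sphere (0 : E) 1, g θ ∂(volume : Measure E).toSphere := by
  rw [deltaSphere, lintegral_smul_measure, lintegral_map hg measurable_subtype_coe, smul_eq_mul,
    ← mul_assoc, ENNReal.mul_inv_cancel (by norm_num) (by norm_num), one_mul]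

lemma ae_deltaSphere_norm : ∀ᵐ θ ∂deltaSphere, ‖θ‖ = 1 := by
  refine Measure.ae_smul_measure ?_ _
  rw [ae_map_iff measurable_subtype_coe.aemeasurable
    (measurableSet_eq_fun (f := fun θ : E => ‖θ‖) measurable_norm measurable_const)]
  exact .of_forall fun θ => by simp

/-- Polar coordinates. -/
lemma lintegral_polar {f : E → ℝ≥0∞} (hf : Measurable f) :
    ∫⁻ x, f x =
      2 * ∫⁻ θ, (∫⁻ r in Set.Ioi (0 : ℝ), ENNReal.ofReal (r ^ 2) * f (r • θ)) ∂deltaSphere := by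
  have hm : Measurable fun p : E × ℝ => ENNReal.ofReal (p.2 ^ 2) * f (p.2 • p.1) := by fun_prop
  rw [two_mul_lintegral_deltaSphere hm.lintegral_prod_right']
  have h1 := (volume : Measure E).measurePreserving_homeomorphUnitSphereProd
  have h2 := h1.lintegral_comp_emb (Homeomorph.measurableEmbedding _)
    (fun p => f (p.2.1 • p.1.1))
  have e : ∀ x : ({0}ᶜ : Set E), f ((homeomorphUnitSphereProd E x).2.1 •
      (homeomorphUnitSphereProd E x).1.1) = f x := fun x => by
    congr 1
    have hx : ‖x.1‖ ≠ 0 := norm_ne_zero_iff.2 x.2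
    simp [smul_smul, mul_inv_cancel₀ hx]
  simp only [e] at h2
  rw [lintegral_subtype_comap (measurableSet_singleton (0 : E)).compl f,
    restrict_compl_singleton] at h2
  rw [h2, lintegral_prod _ (by fun_prop)]
  refine lintegral_congr fun θ => ?_
  rw [Measure.volumeIoiPow, lintegral_withDensity_eq_lintegral_mul _ (by fun_prop) (by fun_prop)]
  simp only [Pi.mul_apply, finrank_euclideanSpace, Fintype.card_fin, Nat.add_one_sub_one]
  exact lintegral_subtype_comap measurableSet_Ioi fun r : ℝ =>
    ENNReal.ofReal (r ^ 2) * f (r • θ.1)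

/-- The radial measure `2 r² dr` on the half line. -/
def radialMeasure : Measure ℝ :=
  (volume.restrict (Set.Ioi (0 : ℝ))).withDensity fun r => ENNReal.ofReal (2 * r ^ 2)

instance : SFinite radialMeasure := by unfold radialMeasure; infer_instance

/-- The density `2 r²` of `radialMeasure` makes up for the one half in `deltaSphere`. Writing polar
coordinates as an image measure lets the Bochner integral follow by change of variables. -/
lemma map_polar : (deltaSphere.prod radialMeasure).map (fun p : E × ℝ => p.2 • p.1) =
    (volume : Measure E) := by
  have hc : Measurable fun p : E × ℝ => p.2 • p.1 := by fun_prop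
  refine Measure.ext_of_lintegral _ fun f hf => ?_
  rw [lintegral_map hf hc, lintegral_prod _ (by fun_prop), lintegral_polar hf,
    ← lintegral_const_mul _ (Measurable.lintegral_prod_right' (f := fun p : E × ℝ =>
      ENNReal.ofReal (p.2 ^ 2) * f (p.2 • p.1)) (by fun_prop))]
  refine lintegral_congr fun θ => ?_
  rw [radialMeasure, lintegral_withDensity_eq_lintegral_mul _ (by fun_prop) (by fun_prop),
    ← lintegral_const_mul _ (by fun_prop)]
  refine lintegral_congr fun r => ?_
  rw [Pi.mul_apply, ENNReal.ofReal_mul (by norm_num), ENNReal.ofReal_ofNat, mul_assoc]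

/-- Polar coordinates for integrable functions. -/
lemma integral_polar {f : E → ℂ} (hf : Integrable f) :
    ∫ x, f x = 2 * ∫ θ, (∫ r in Set.Ioi (0 : ℝ), (r : ℂ) ^ 2 * f (r • θ)) ∂deltaSphere := by
  have hc : Measurable fun p : E × ℝ => p.2 • p.1 := by fun_prop
  have hf' : Integrable (fun p : E × ℝ => f (p.2 • p.1)) (deltaSphere.prod radialMeasure) := by
    rw [← map_polar] at hf
    exact hf.comp_measurable hc
  conv_lhs => rw [← map_polar]
  rw [integral_map hc.aemeasurable (by rw [map_polar]; exact hf.1), integral_prod _ hf',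
    ← integral_const_mul]
  refine integral_congr_ae (.of_forall fun θ => ?_)
  simp only
  rw [radialMeasure, integral_withDensity_eq_integral_toReal_smul (by fun_prop)
    (.of_forall fun _ => ENNReal.ofReal_lt_top), ← integral_const_mul]
  refine integral_congr_ae (.of_forall fun r => ?_)
  simp only
  rw [ENNReal.toReal_ofReal (by positivity), Complex.real_smul]
  push_cast
  ring

/-- The Wigner-side profile of an outgoing spherical wave. -/
def farField (T : E → ℂ) (x : E) : ℂ :=
  -((2 * Real.pi ^ 2 * ‖x‖⁻¹ : ℝ) : ℂ) * T (-(‖x‖⁻¹ • x))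

/-- The square of the ratio of the weighted norm of the far field and the norm of the trace. -/
def farFieldConst : ℝ≥0∞ :=
  ∫⁻ r in Set.Ioi (0 : ℝ), 2 * ENNReal.ofReal (4 * Real.pi ^ 4 * (√(1 + r ^ 2))⁻¹ ^ 3)

lemma farFieldConst_ne_top : farFieldConst ≠ ⊤ := by
  have h := integrable_rpow_neg_one_add_norm_sq (E := ℝ) (μ := volume) (r := 3) (by simp)
  have h2 : Integrable (fun r : ℝ => 4 * Real.pi ^ 4 * (√(1 + r ^ 2))⁻¹ ^ 3) := by
    refine (h.const_mul (4 * Real.pi ^ 4)).congr (.of_forall fun r => ?_)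
    have h0 : 0 < 1 + r ^ 2 := by positivity
    simp only [Real.norm_eq_abs, sq_abs]
    rw [Real.sqrt_eq_rpow, ← Real.rpow_neg h0.le, ← Real.rpow_natCast ((1 + r ^ 2) ^ (-(1 / 2 : ℝ))),
      ← Real.rpow_mul h0.le]
    norm_num
  rw [farFieldConst, lintegral_const_mul' _ _ (by norm_num)]
  exact ENNReal.mul_ne_top (by norm_num) (ne_of_lt h2.integrableOn.lintegral_lt_top)

lemma farFieldConst_ne_zero : farFieldConst ≠ 0 := by
  rw [farFieldConst]
  refine (setLIntegral_pos_iff (by fun_prop)).2 ?_ |>.ne'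
  refine lt_of_lt_of_le ?_ (measure_mono (s := Set.Ioo (0 : ℝ) 1) fun r hr => ⟨?_, hr.1⟩)
  · simp
  · rw [Function.mem_support]
    have : 0 < 4 * Real.pi ^ 4 * (√(1 + r ^ 2))⁻¹ ^ 3 := by positivity
    exact mul_ne_zero two_ne_zero (ENNReal.ofReal_pos.2 this).ne'

/-- The factor `|x|⁻²` of the squared far field cancels the Jacobian `r²`, leaving the convergent
radial integral of `(1 + r²)^{-3/2}`. Being an equality, this transfers estimates between the far
field and the trace in both directions. -/
lemma lintegral_farField {T : E → ℂ} (hT : Measurable T) :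
    ∫⁻ x, ‖farField T x‖ₑ ^ 2 ∂weightMeasure 1 =
      farFieldConst * ∫⁻ θ, ‖T θ‖ₑ ^ 2 ∂deltaSphere := by
  have hm : Measurable (farField T) := by unfold farField; fun_prop
  have hw : Measurable (wt 1) := (continuous_wt one_pos).measurable
  rw [lintegral_weightMeasure one_pos (by fun_prop),
    ← lintegral_neg_eq_self _, lintegral_polar (by fun_prop),
    ← lintegral_const_mul' _ _ (by norm_num), ← lintegral_const_mul _ (by fun_prop)]
  refine lintegral_congr_ae ?_
  filter_upwards [ae_deltaSphere_norm] with θ hθ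
  rw [farFieldConst, ← lintegral_mul_const' _ _ (by simp), ← lintegral_const_mul' _ _ (by norm_num)]
  refine setLIntegral_congr_fun measurableSet_Ioi fun r hr => ?_
  have hr' : 0 < r := hr
  have hn : ‖r • θ‖ = r := by rw [norm_smul, hθ, mul_one, Real.norm_of_nonneg hr'.le]
  simp only [farField, wt, norm_neg, hn, smul_neg, neg_neg, smul_smul, inv_mul_cancel₀ hr'.ne',
    one_smul, enorm_mul, enorm_neg, mul_pow, one_pow, one_mul]
  rw [← ofReal_norm, Complex.norm_real, Real.norm_of_nonneg (by positivity),
    ← ENNReal.ofReal_pow (by positivity), ← mul_assoc, ← mul_assoc, ← mul_assoc, mul_assoc 2,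
    ← ENNReal.ofReal_mul (by positivity), mul_assoc 2, ← ENNReal.ofReal_mul (by positivity)]
  congr 3
  field_simp
  ring

/-! ### The Green function representation and the WKB limit -/

/-- Choose the root with `Re κ ≤ 0`. From `2 Re κ Im κ = -δ` one gets `Im κ ≥ 0`, so `e^{iκr}` stays
bounded and is close to `e^{-ir}`. Moreover `|κ + 1| |κ - 1| = δ` with `|κ - 1| ≥ 1`. For `δ = εa`
the linear bound gives `|κ + 1|/ε ≤ a`, so the phase error stays small at distances of order `1/ε`.
-/
lemma exists_kappa {δ : ℝ} (hδ : 0 < δ) :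
    ∃ κ : ℂ, κ ^ 2 = 1 - Complex.I * δ ∧ 0 ≤ κ.im ∧ ‖κ + 1‖ ≤ δ := by
  obtain ⟨z, hz⟩ := IsAlgClosed.exists_pow_nat_eq (1 - Complex.I * (δ : ℂ)) two_pos
  obtain ⟨κ, hκ, hre⟩ : ∃ κ : ℂ, κ ^ 2 = 1 - Complex.I * δ ∧ κ.re ≤ 0 := by
    rcases le_total z.re 0 with h | h
    · exact ⟨z, hz, h⟩
    · exact ⟨-z, by rw [neg_sq, hz], by simpa using h⟩
  have h1 := congrArg Complex.re hκ
  have h2 := congrArg Complex.im hκ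
  simp [sq] at h1 h2
  have him : 0 ≤ κ.im := by
    by_contra h
    nlinarith
  refine ⟨κ, hκ, him, ?_⟩
  have h3 : (κ + 1) * (κ - 1) = -(Complex.I * δ) := by linear_combination hκ
  have h4 : ‖κ + 1‖ * ‖κ - 1‖ = δ := by
    rw [← norm_mul, h3]
    simp [abs_of_pos hδ]
  have h5 : 1 ≤ ‖κ - 1‖ := by
    have := Complex.abs_re_le_norm (κ - 1)
    rw [Complex.sub_re, Complex.one_re, abs_of_nonpos (by linarith)] at this
    linarith
  nlinarith [norm_nonneg (κ + 1)]

/-- The resolvent is the convolution with the outgoing fundamental solution. -/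
lemma schwartzResolvent_eq_integral {δ : ℝ} (hδ : 0 < δ) {κ : ℂ} (hκ : κ ^ 2 = 1 - Complex.I * δ)
    (him : 0 ≤ κ.im) (f : 𝓢(E, ℂ)) (x : E) :
    schwartzResolvent δ f x = -(4 * Real.pi : ℂ)⁻¹ *
      ∫ y, Complex.exp (Complex.I * κ * ‖y - x‖) * ((‖y - x‖⁻¹ : ℝ) : ℂ) * f y := by
  set v := schwartzResolvent δ f with hv
  have h := integral_green_origin him (v.compSubConstCLM ℂ (-x))
  have hL : ∀ y, (Δ (v.compSubConstCLM ℂ (-x))) y + κ ^ 2 * v.compSubConstCLM ℂ (-x) y =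
      f (y + x) := fun y => by
    rw [SchwartzMap.laplacian_apply, SchwartzMap.compSubConstCLM_apply]
    have e := laplacian_comp_sub v (-x) y
    have e2 : Δ (⇑(v.compSubConstCLM ℂ (-x))) y = Δ (v : E → ℂ) (y - -x) := e
    rw [e2, hκ, ← helmholtz_apply, hv, helmholtz_schwartzResolvent hδ, sub_neg_eq_add]
  simp only [hL] at h
  have h2 := integral_add_right_eq_self (μ := (volume : Measure E)) (fun y =>
    Complex.exp (Complex.I * κ * ‖y - x‖) * ((‖y - x‖⁻¹ : ℝ) : ℂ) * f y) x
  simp only [add_sub_cancel_right] at h2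
  rw [← h2, h, SchwartzMap.compSubConstCLM_apply, zero_sub, neg_neg]
  have : (Real.pi : ℂ) ≠ 0 := by exact_mod_cast Real.pi_ne_zero
  field_simp

lemma norm_exp_mul_inv_le {κ : ℂ} (him : 0 ≤ κ.im) {r : ℝ} (hr : 0 ≤ r) :
    ‖Complex.exp (Complex.I * κ * r)‖ ≤ 1 := by
  rw [Complex.norm_exp, Real.exp_le_one_iff]
  simp only [Complex.mul_re, Complex.I_re, Complex.I_im, Complex.ofReal_re, Complex.ofReal_im,
    Complex.mul_im]
  nlinarith [mul_nonneg him hr]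

/-- Uniform decay of the resolvent of a compactly supported function. -/
lemma exists_norm_mul_schwartzResolvent_le (f : 𝓢(E, ℂ)) (hf : HasCompactSupport f) :
    ∃ C, 0 ≤ C ∧ ∀ δ, 0 < δ → ∀ x, ‖x‖ * ‖schwartzResolvent δ f x‖ ≤ C := by
  obtain ⟨M, hM⟩ := exists_pow_support hf
  obtain ⟨D, hD⟩ : ∃ D, ∀ x, ‖f x‖ ≤ D := ⟨_, fun x => SchwartzMap.norm_le_seminorm ℝ f x⟩
  set R : ℝ := 2 ^ M with hR
  have hR0 : 0 < R := by positivity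
  set B := D * (∫ x in ball (0 : E) 1, ‖x‖⁻¹) + ∫ x, ‖f x‖ with hB
  -- The potential of `f` is bounded by the supremum and the `L¹` norm of `f`, which are translation
  -- invariant, so `B` does not depend on `x`.
  have pot : ∀ x, Integrable (fun y => ‖f y‖ * ‖y - x‖⁻¹) ∧ ∫ y, ‖f y‖ * ‖y - x‖⁻¹ ≤ B := fun x => by
    have h := integrable_norm_mul_inv_norm (f := fun y => f (y + x))
      (f.integrable.comp_add_right x) (fun y => hD _)
    have i2 := integral_add_right_eq_self (μ := (volume : Measure E))
      (fun y => ‖f y‖ * ‖y - x‖⁻¹) x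
    have i3 := integral_add_right_eq_self (μ := (volume : Measure E)) (fun y => ‖f y‖) x
    simp only [add_sub_cancel_right] at i2
    refine ⟨?_, ?_⟩
    · have := h.1.comp_sub_right x
      simpa using this
    · rw [← i2, hB, ← i3]; exact h.2
  have hB0 : 0 ≤ B := (integral_nonneg fun y => by positivity).trans (pot 0).2
  have hI0 : 0 ≤ ∫ x, ‖f x‖ := integral_nonneg fun y => norm_nonneg _
  refine ⟨(4 * Real.pi)⁻¹ * ((∫ x, ‖f x‖) + R * B), by positivity, fun δ hδ x => ?_⟩
  obtain ⟨κ, hκ, him, -⟩ := exists_kappa hδ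
  rw [schwartzResolvent_eq_integral hδ hκ him, norm_mul, ← mul_assoc, mul_comm ‖x‖, mul_assoc]
  have e : ‖-(4 * Real.pi : ℂ)⁻¹‖ = (4 * Real.pi)⁻¹ := by
    simp [abs_of_pos Real.pi_pos]
  rw [e]
  gcongr
  have hle : ‖∫ y, Complex.exp (Complex.I * κ * ‖y - x‖) * ((‖y - x‖⁻¹ : ℝ) : ℂ) * f y‖ ≤
      ∫ y, ‖f y‖ * ‖y - x‖⁻¹ := by
    refine norm_integral_le_of_norm_le (pot x).1 (.of_forall fun y => ?_)
    rw [norm_mul, norm_mul, Complex.norm_real, Real.norm_of_nonneg (by positivity), mul_comm]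
    gcongr
    exact mul_le_of_le_one_left (by positivity) (norm_exp_mul_inv_le him (norm_nonneg _))
  calc ‖x‖ * _ ≤ ‖x‖ * ∫ y, ‖f y‖ * ‖y - x‖⁻¹ := by gcongr
    _ = ∫ y, ‖x‖ * (‖f y‖ * ‖y - x‖⁻¹) := (integral_const_mul _ _).symm
    _ ≤ ∫ y, ‖f y‖ + R * (‖f y‖ * ‖y - x‖⁻¹) := by
        refine integral_mono ((pot x).1.const_mul _) (f.integrable.norm.add ((pot x).1.const_mul _))
          fun y => ?_
        by_cases hy : R ≤ ‖y‖
        · simp [hM y hy]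
        have h1 : ‖x‖ ≤ ‖y - x‖ + R := by
          have := norm_sub_norm_le x y
          rw [norm_sub_rev] at this
          linarith
        have h2 : ‖y - x‖ * ‖y - x‖⁻¹ ≤ 1 := mul_inv_le_one
        have h3 : 0 ≤ ‖f y‖ * ‖y - x‖⁻¹ := by positivity
        simp only
        calc ‖x‖ * (‖f y‖ * ‖y - x‖⁻¹) ≤ (‖y - x‖ + R) * (‖f y‖ * ‖y - x‖⁻¹) := by gcongr
          _ = ‖f y‖ * (‖y - x‖ * ‖y - x‖⁻¹) + R * (‖f y‖ * ‖y - x‖⁻¹) := by ring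
          _ ≤ ‖f y‖ * 1 + R * (‖f y‖ * ‖y - x‖⁻¹) := by gcongr
          _ = _ := by rw [mul_one]
    _ = (∫ y, ‖f y‖) + R * ∫ y, ‖f y‖ * ‖y - x‖⁻¹ := by
        rw [integral_add f.integrable.norm ((pot x).1.const_mul _), integral_const_mul]
    _ ≤ _ := by
        have := (pot x).2
        gcongr

/-- Sequences of scales and absorption coefficients tending to zero. -/
structure Scales (e a : ℕ → ℝ) : Prop where
  pos : ∀ k, 0 < e k
  le_one : ∀ k, e k ≤ 1
  tendsto : Tendsto e atTop (𝓝 0)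
  absorption_pos : ∀ k, 0 < a k
  absorption_le : ∀ k, a k ≤ 1
  absorption_tendsto : Tendsto a atTop (𝓝 0)

/-- The difference of norms multiplied by its conjugate expression; it gives the first-order
expansion of the distance directly. -/
lemma norm_sub_norm_sub_div {x y : E} (hx : x ≠ 0) {ε : ℝ} (hε : 0 < ε) :
    (‖x‖ - ‖ε • y - x‖) / ε = (2 * inner ℝ x y - ε * ‖y‖ ^ 2) / (‖x‖ + ‖ε • y - x‖) := by
  have hx' := norm_pos_iff.2 hx
  have h : ‖ε • y - x‖ ^ 2 = ‖x‖ ^ 2 - 2 * ε * inner ℝ x y + ε ^ 2 * ‖y‖ ^ 2 := by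
    rw [norm_sub_sq_real, norm_smul, inner_smul_left, real_inner_comm, Real.norm_of_nonneg hε.le]
    simp
    ring
  rw [div_eq_div_iff hε.ne' (by positivity)]
  linear_combination -h

lemma tendsto_norm_sub_norm_sub_div {x : E} (hx : x ≠ 0) (y : E) {e : ℕ → ℝ}
    (he : ∀ k, 0 < e k) (h0 : Tendsto e atTop (𝓝 0)) :
    Tendsto (fun k => (‖x‖ - ‖e k • y - x‖) / e k) atTop (𝓝 (‖x‖⁻¹ * inner ℝ x y)) := by
  have hx' := norm_pos_iff.2 hx
  simp only [norm_sub_norm_sub_div hx (he _)]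
  have h1 : Tendsto (fun k => ‖e k • y - x‖) atTop (𝓝 ‖x‖) := by
    have := ((h0.smul_const y).sub_const x).norm
    simpa using this
  have h2 := ((h0.mul_const (‖y‖ ^ 2)).const_sub (2 * inner ℝ x y)).div (h1.const_add ‖x‖)
    (by positivity)
  convert! h2 using 2
  field_simp
  ring

/-- The wave emitted by a Schwartz source, with its phase removed. -/
def modulatedWave (ε a : ℝ) (f : 𝓢(E, ℂ)) (x : E) : ℂ :=
  Complex.exp (Complex.I * (‖x‖ / ε : ℝ)) * ((ε : ℂ)⁻¹ * schwartzResolvent (ε * a) f (ε⁻¹ • x))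

/-- The total phase is split into `(|x| - |εy - x|)/ε`, which converges, and `(κ + 1)|εy - x|/ε`,
which tends to `0`. -/
lemma modulatedWave_eq_integral {ε a : ℝ} (hε : 0 < ε) (ha : 0 < a) {κ : ℂ}
    (hκ : κ ^ 2 = 1 - Complex.I * ((ε * a : ℝ) : ℂ)) (him : 0 ≤ κ.im) (f : 𝓢(E, ℂ)) (x : E) :
    modulatedWave ε a f x = -(4 * Real.pi : ℂ)⁻¹ *
      ∫ y, Complex.exp (Complex.I * (((‖x‖ - ‖ε • y - x‖) / ε : ℝ) : ℂ)) *
        Complex.exp (Complex.I * ((κ + 1) / ε) * ‖ε • y - x‖) *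
          ((‖ε • y - x‖⁻¹ : ℝ) : ℂ) * f y := by
  rw [modulatedWave, schwartzResolvent_eq_integral (mul_pos hε ha) hκ him, mul_left_comm (ε : ℂ)⁻¹,
    mul_left_comm, ← mul_assoc (Complex.exp _), ← integral_const_mul]
  congr 2 with y
  have hn : ‖y - ε⁻¹ • x‖ = ε⁻¹ * ‖ε • y - x‖ := by
    rw [← Real.norm_of_nonneg (inv_nonneg.2 hε.le), ← norm_smul, Real.norm_of_nonneg
      (inv_nonneg.2 hε.le), smul_sub, inv_smul_smul₀ hε.ne']
  have hε' : (ε : ℂ) ≠ 0 := by exact_mod_cast hε.ne'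
  rw [hn, ← Complex.exp_add]
  have e1 : Complex.exp (Complex.I * (((‖x‖ - ‖ε • y - x‖) / ε : ℝ) : ℂ) +
      Complex.I * ((κ + 1) / ε) * ‖ε • y - x‖) = Complex.exp (Complex.I * (‖x‖ / ε : ℝ)) *
      Complex.exp (Complex.I * κ * ((ε⁻¹ * ‖ε • y - x‖ : ℝ) : ℂ)) := by
    rw [← Complex.exp_add]
    congr 1
    push_cast
    field_simp
    ring
  rw [e1]
  push_cast
  field_simp

/-- The WKB limit of the wave emitted by a test function. -/
lemma tendsto_modulatedWave {e a : ℕ → ℝ} (h : Scales e a) (f : 𝓢(E, ℂ))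
    (hf : HasCompactSupport f) {x : E} (hx : x ≠ 0) :
    Tendsto (fun k => modulatedWave (e k) (a k) f x) atTop (𝓝 (farField (fourier f) x)) := by
  choose κ hκ him hκ1 using fun k => exists_kappa (mul_pos (h.pos k) (h.absorption_pos k))
  simp only [fun k => modulatedWave_eq_integral (h.pos k) (h.absorption_pos k) (hκ k) (him k) f x]
  have hx' := norm_pos_iff.2 hx
  obtain ⟨M, hM⟩ := exists_pow_support hf
  set R : ℝ := 2 ^ M with hR
  have hR0 : 0 < R := by positivity
  -- The far field constant is `(4π)⁻¹ (2π)³ = 2π²`: the first factor is from the Green function,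
  -- the second undoes the normalization of `fourier`.
  have hlim : farField (fourier f) x = -(4 * Real.pi : ℂ)⁻¹ *
      ∫ y, Complex.exp (Complex.I * ((‖x‖⁻¹ * inner ℝ x y : ℝ) : ℂ)) * 1 * ((‖x‖⁻¹ : ℝ) : ℂ) * f y := by
    rw [farField, fourier]
    have e : ∀ y, Complex.exp (-Complex.I * ((inner ℝ y (-(‖x‖⁻¹ • x)) : ℝ) : ℂ)) * f y =
        Complex.exp (Complex.I * ((‖x‖⁻¹ * inner ℝ x y : ℝ) : ℂ)) * f y := fun y => by
      rw [inner_neg_right, inner_smul_right, real_inner_comm]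
      push_cast
      congr 2
      ring
    have e2 : ∀ y, Complex.exp (Complex.I * ((‖x‖⁻¹ * inner ℝ x y : ℝ) : ℂ)) * 1 *
        ((‖x‖⁻¹ : ℝ) : ℂ) * f y = ((‖x‖⁻¹ : ℝ) : ℂ) *
        (Complex.exp (Complex.I * ((‖x‖⁻¹ * inner ℝ x y : ℝ) : ℂ)) * f y) := fun y => by ring
    simp only [e, e2]
    rw [integral_const_mul]
    have : (Real.pi : ℂ) ≠ 0 := by exact_mod_cast Real.pi_ne_zero
    push_cast
    field_simp
    ring
  rw [hlim]
  refine Tendsto.const_mul _ (tendsto_integral_filter_of_dominated_convergence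
    (fun y => 2 * ‖x‖⁻¹ * ‖f y‖) ?_ ?_ (f.integrable.norm.const_mul _) (.of_forall fun y => ?_))
  · refine .of_forall fun k => Measurable.aestronglyMeasurable ?_
    have := f.continuous.measurable
    fun_prop
  -- For small `ε` the scaled support stays in the ball of radius `|x|/2`, away from the singularity
  -- of the kernel at `x`.
  · have hs : ∀ᶠ k in atTop, e k * R ≤ ‖x‖ / 2 := by
      have := h.tendsto.mul_const R
      rw [zero_mul] at this
      exact this.eventually (Iic_mem_nhds (by positivity))
    filter_upwards [hs] with k hk
    refine .of_forall fun y => ?_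
    by_cases hy : R ≤ ‖y‖
    · simp [hM y hy]
    have hε := h.pos k
    have hy2 : ‖x‖ / 2 ≤ ‖e k • y - x‖ := by
      have h1 := norm_sub_norm_le x (e k • y)
      rw [norm_sub_rev, norm_smul, Real.norm_of_nonneg hε.le] at h1
      have : e k * ‖y‖ ≤ e k * R := by gcongr; linarith
      linarith
    have hinv : ‖e k • y - x‖⁻¹ ≤ 2 * ‖x‖⁻¹ := by
      rw [show 2 * ‖x‖⁻¹ = (‖x‖ / 2)⁻¹ by field_simp]
      gcongr
    have p1 : ‖Complex.exp (Complex.I * (((‖x‖ - ‖e k • y - x‖) / e k : ℝ) : ℂ))‖ = 1 := by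
      rw [mul_comm, Complex.norm_exp_ofReal_mul_I]
    have p2 : ‖Complex.exp (Complex.I * ((κ k + 1) / e k) * ‖e k • y - x‖)‖ ≤ 1 := by
      refine norm_exp_mul_inv_le ?_ (norm_nonneg _)
      rw [Complex.div_ofReal_im]
      have := him k
      simp
      positivity
    rw [norm_mul, norm_mul, norm_mul, p1, one_mul, Complex.norm_real,
      Real.norm_of_nonneg (by positivity)]
    refine mul_le_mul_of_nonneg_right ?_ (norm_nonneg _)
    exact (mul_le_mul p2 hinv (by positivity) zero_le_one).trans_eq (one_mul _)
  · have h1 : Tendsto (fun k => ‖e k • y - x‖) atTop (𝓝 ‖x‖) := by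
      have := ((h.tendsto.smul_const y).sub_const x).norm
      simpa using this
    have h2 := tendsto_norm_sub_norm_sub_div hx y h.pos h.tendsto
    -- This is where the vanishing of the absorption enters: the quotient is at most `a k`.
    have h3 : Tendsto (fun k => (κ k + 1) / e k) atTop (𝓝 0) := by
      refine squeeze_zero_norm (fun k => ?_) h.absorption_tendsto
      rw [norm_div, Complex.norm_real, Real.norm_of_nonneg (h.pos k).le, div_le_iff₀ (h.pos k),
        mul_comm]
      exact hκ1 k
    have h4 : Tendsto (fun k => Complex.exp (Complex.I * ((κ k + 1) / e k) * ‖e k • y - x‖)) atTop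
        (𝓝 1) := by
      have := (Complex.continuous_exp.tendsto _).comp ((h3.const_mul Complex.I).mul
        ((Complex.continuous_ofReal.tendsto _).comp h1))
      simpa [Function.comp_def] using this
    have h5 := (Complex.continuous_exp.tendsto _).comp
      (((Complex.continuous_ofReal.tendsto _).comp h2).const_mul Complex.I)
    have h6 := (Complex.continuous_ofReal.tendsto _).comp (h1.inv₀ hx'.ne')
    exact ((h5.mul h4).mul h6).mul_const _

/-! ### Amplitudes in the weighted space -/

lemma lintegral_comp_inv_smul {ε : ℝ} (hε : 0 < ε) (g : E → ℝ≥0∞) :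
    ∫⁻ x, g (ε⁻¹ • x) = ENNReal.ofReal (ε ^ 3) * ∫⁻ x, g x := by
  have h := (Homeomorph.smulOfNeZero ε⁻¹ (inv_ne_zero hε.ne')).measurableEmbedding.lintegral_map
    (μ := (volume : Measure E)) g
  have h2 := Measure.map_addHaar_smul (volume : Measure E) (inv_ne_zero hε.ne')
  simp only [Homeomorph.smulOfNeZero_apply] at h
  rw [← h, h2, lintegral_smul_measure, smul_eq_mul]
  congr 2
  rw [finrank_euclideanSpace, Fintype.card_fin, inv_pow, inv_inv, abs_of_pos (by positivity)]

lemma wt_inv_smul {ε : ℝ} (hε : 0 < ε) (y : E) : wt 1 (ε • y) = ε⁻¹ * wt ε⁻¹ y := by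
  unfold wt
  rw [norm_smul, Real.norm_of_nonneg hε.le, show 1 ^ 2 + (ε * ‖y‖) ^ 2 = ε ^ 2 *
    (ε⁻¹ ^ 2 + ‖y‖ ^ 2) by field_simp, Real.sqrt_mul (by positivity), Real.sqrt_sq hε.le, mul_inv]

/-- The volume contributes `ε³`, the squared amplitude `ε⁻²` and the weight `ε⁻³`; the total is `ε⁻²
= R²` for `R = 1/ε`. So the estimate at all scales `R ≥ 1` in the wavelength variable is one
estimate in a fixed space in the original variable. -/
lemma eLpNorm_rescale {ε : ℝ} (hε : 0 < ε) {h : E → ℂ} (hm : AEStronglyMeasurable h volume) :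
    eLpNorm (fun x => (ε : ℂ)⁻¹ * h (ε⁻¹ • x)) 2 (weightMeasure 1) =
      eLpNorm h 2 (weightMeasure ε⁻¹) := by
  have hm' : AEStronglyMeasurable (fun x => h (ε⁻¹ • x)) volume :=
    hm.comp_quasiMeasurePreserving
      (Measure.quasiMeasurePreserving_smul volume (inv_ne_zero hε.ne'))
  rw [eLpNorm_two_eq, eLpNorm_two_eq]
  congr 1
  rw [lintegral_weightMeasure one_pos ((hm'.const_mul _).enorm.pow_const 2),
    lintegral_weightMeasure (inv_pos.2 hε) (hm.enorm.pow_const 2)]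
  have e : ∀ x : E, ENNReal.ofReal (1 ^ 2 * wt 1 x ^ 3) * ‖(ε : ℂ)⁻¹ * h (ε⁻¹ • x)‖ₑ ^ 2 =
      (fun y => ENNReal.ofReal (1 ^ 2 * wt 1 (ε • y) ^ 3) * ‖(ε : ℂ)⁻¹ * h y‖ₑ ^ 2) (ε⁻¹ • x) :=
    fun x => by simp only [smul_inv_smul₀ hε.ne']
  simp only [e]
  rw [lintegral_comp_inv_smul hε (fun y => ENNReal.ofReal (1 ^ 2 * wt 1 (ε • y) ^ 3) *
    ‖(ε : ℂ)⁻¹ * h y‖ₑ ^ 2), ← lintegral_const_mul' _ _ ENNReal.ofReal_ne_top]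
  refine lintegral_congr fun y => ?_
  have hw := wt_pos (inv_pos.2 hε) y
  rw [wt_inv_smul hε, enorm_mul, mul_pow ‖(ε : ℂ)⁻¹‖ₑ, ← ofReal_norm, norm_inv, Complex.norm_real,
    Real.norm_of_nonneg hε.le, ← ENNReal.ofReal_pow (by positivity), ← mul_assoc, ← mul_assoc,
    ← ENNReal.ofReal_mul (by positivity), ← ENNReal.ofReal_mul (by positivity)]
  congr 2
  field_simp

/-- The wave emitted by a source of `L²`, with its phase removed. -/
def amplitude (ε a : ℝ) (S : Lp ℂ 2 (volume : Measure E)) (x : E) : ℂ :=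
  Complex.exp (Complex.I * (‖x‖ / ε : ℝ)) * wave ε a S x

lemma norm_exp_I_mul (r : ℝ) : ‖Complex.exp (Complex.I * r)‖ = 1 := by
  rw [mul_comm, Complex.norm_exp_ofReal_mul_I]

lemma aestronglyMeasurable_amplitude {ε : ℝ} (hε : 0 < ε) (a : ℝ)
    (S : Lp ℂ 2 (volume : Measure E)) : AEStronglyMeasurable (amplitude ε a S) volume := by
  refine (Continuous.aestronglyMeasurable ?_).mul (memLp_wave hε a S).1
  fun_prop

lemma eLpNorm_amplitude_le {ε a : ℝ} (hε : 0 < ε) (hε1 : ε ≤ 1) (ha : 0 < a) (ha1 : a ≤ 1)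
    {f : E → ℂ} (hf : MemB f) :
    eLpNorm (amplitude ε a (hf.memLp.toLp f)) 2 (weightMeasure 1) ≤ 16 * normB f := by
  have h : eLpNorm (amplitude ε a (hf.memLp.toLp f)) 2 (weightMeasure 1) =
      eLpNorm (wave ε a (hf.memLp.toLp f)) 2 (weightMeasure 1) :=
    eLpNorm_congr_norm_ae (.of_forall fun x => by rw [amplitude, norm_mul, norm_exp_I_mul, one_mul])
  rw [h]
  unfold wave
  rw [eLpNorm_rescale hε (Lp.aestronglyMeasurable _)]
  exact eLpNorm_resolvent_weight_le (one_le_inv₀ hε |>.2 hε1) (mul_pos hε ha)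
    (mul_le_one₀ hε1 ha.le ha1) hf

lemma wave_sub_ae {ε : ℝ} (hε : 0 < ε) (a : ℝ) (S T : Lp ℂ 2 (volume : Measure E)) :
    (fun x => wave ε a S x - wave ε a T x) =ᵐ[volume] wave ε a (S - T) := by
  have h : (resolvent (ε * a) (S - T) : E → ℂ) =ᵐ[volume]
      fun x => resolvent (ε * a) S x - resolvent (ε * a) T x := by
    rw [map_sub]
    exact Lp.coeFn_sub _ _
  have h2 := (Measure.quasiMeasurePreserving_smul (volume : Measure E)
    (inv_ne_zero hε.ne')).ae_eq_comp h
  filter_upwards [h2] with x hx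
  simp only [Function.comp_apply] at hx
  rw [wave, wave, wave, hx]
  ring

lemma amplitude_toLp_ae {ε a : ℝ} (hε : 0 < ε) (ha : 0 < a) (f : 𝓢(E, ℂ)) :
    amplitude ε a (f.toLp 2 volume) =ᵐ[volume] modulatedWave ε a f := by
  have h : (resolvent (ε * a) (f.toLp 2 volume) : E → ℂ) =ᵐ[volume]
      schwartzResolvent (ε * a) f := by
    rw [resolvent_toLp (mul_pos hε ha)]
    exact SchwartzMap.coeFn_toLp _ _ _
  have h2 := (Measure.quasiMeasurePreserving_smul (volume : Measure E)
    (inv_ne_zero hε.ne')).ae_eq_comp h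
  filter_upwards [h2] with x hx
  simp only [Function.comp_apply] at hx
  rw [amplitude, wave, hx, modulatedWave]

lemma eLpNorm_farField {T : E → ℂ} (hT : Measurable T) :
    eLpNorm (farField T) 2 (weightMeasure 1) =
      farFieldConst ^ (1 / 2 : ℝ) * eLpNorm T 2 deltaSphere := by
  rw [eLpNorm_two_eq, lintegral_farField hT, ENNReal.mul_rpow_of_nonneg _ _ (by norm_num),
    eLpNorm_two_eq]

lemma ae_weightMeasure_ne_zero : ∀ᵐ x ∂weightMeasure 1, x ≠ 0 := by
  have h : ∀ᵐ x : E, x ≠ 0 := by simp [ae_iff, measure_singleton]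
  exact (weightMeasure_absolutelyContinuous 1).ae_le h

lemma tendsto_eLpNorm_two_zero {μ : Measure E} {F : ℕ → E → ℂ} {b : E → ℝ}
    (hF : ∀ k, AEStronglyMeasurable (F k) μ) (hb : ∀ k, ∀ᵐ x ∂μ, ‖F k x‖ ≤ b x)
    (hb2 : ∫⁻ x, ENNReal.ofReal (b x) ^ 2 ∂μ ≠ ⊤)
    (hl : ∀ᵐ x ∂μ, Tendsto (fun k => F k x) atTop (𝓝 0)) :
    Tendsto (fun k => eLpNorm (F k) 2 μ) atTop (𝓝 0) := by
  have h : Tendsto (fun k => ∫⁻ x, ‖F k x‖ₑ ^ 2 ∂μ) atTop (𝓝 (∫⁻ _, 0 ∂μ)) := by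
    refine tendsto_lintegral_of_dominated_convergence' _ (fun k => (hF k).enorm.pow_const 2)
      (fun k => ?_) hb2 ?_
    · filter_upwards [hb k] with x hx
      gcongr
      rw [← ofReal_norm]
      exact ENNReal.ofReal_le_ofReal hx
    · filter_upwards [hl] with x hx
      have := (ENNReal.continuous_pow 2).tendsto _ |>.comp hx.enorm
      simpa [Function.comp_def] using this
  rw [lintegral_zero] at h
  simp only [eLpNorm_two_eq]
  have := (ENNReal.continuous_rpow_const (y := (1 / 2 : ℝ))).tendsto 0 |>.comp h
  simpa [Function.comp_def] using this

lemma norm_modulatedWave_le {f : 𝓢(E, ℂ)} {C : ℝ}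
    (hC : ∀ δ, 0 < δ → ∀ x, ‖x‖ * ‖schwartzResolvent δ f x‖ ≤ C) {ε a : ℝ} (hε : 0 < ε)
    (ha : 0 < a) {x : E} (hx : x ≠ 0) : ‖modulatedWave ε a f x‖ ≤ C * ‖x‖⁻¹ := by
  have hx' := norm_pos_iff.2 hx
  rw [modulatedWave, norm_mul, norm_exp_I_mul, one_mul, norm_mul, norm_inv, Complex.norm_real,
    Real.norm_of_nonneg hε.le, ← div_eq_mul_inv, le_div_iff₀ hx']
  have := hC (ε * a) (mul_pos hε ha) (ε⁻¹ • x)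
  rw [norm_smul, Real.norm_of_nonneg (inv_nonneg.2 hε.le)] at this
  linarith

lemma continuous_modulatedWave (ε a : ℝ) (f : 𝓢(E, ℂ)) : Continuous (modulatedWave ε a f) := by
  unfold modulatedWave
  have := (schwartzResolvent (ε * a) f).continuous
  fun_prop

lemma continuous_fourier {f : E → ℂ} (hf : Integrable f) : Continuous (fourier f) := by
  refine continuous_const.mul (continuous_of_dominated (bound := fun x => ‖f x‖) (fun ξ => ?_)
    (fun ξ => .of_forall fun x => ?_) hf.norm (.of_forall fun x => by fun_prop))
  · exact (Continuous.aestronglyMeasurable (by fun_prop)).mul hf.1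
  · rw [norm_mul, neg_mul, ← mul_neg, ← Complex.ofReal_neg, norm_exp_I_mul, one_mul]

lemma measurable_farField {T : E → ℂ} (hT : Measurable T) : Measurable (farField T) := by
  unfold farField; fun_prop

lemma tendsto_eLpNorm_modulatedWave_sub {e a : ℕ → ℝ} (h : Scales e a) (f : 𝓢(E, ℂ))
    (hf : HasCompactSupport f) :
    Tendsto (fun k => eLpNorm (fun x => modulatedWave (e k) (a k) f x - farField (fourier f) x) 2
      (weightMeasure 1)) atTop (𝓝 0) := by
  obtain ⟨C, hC0, hC⟩ := exists_norm_mul_schwartzResolvent_le f hf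
  have hT := (continuous_fourier f.integrable).measurable
  refine tendsto_eLpNorm_two_zero (b := fun x => 2 * C * ‖x‖⁻¹) (fun k => ?_) (fun k => ?_) ?_ ?_
  · exact ((continuous_modulatedWave _ _ f).measurable.sub
      (measurable_farField hT)).aestronglyMeasurable
  · filter_upwards [ae_weightMeasure_ne_zero] with x hx
    have h1 := fun k => norm_modulatedWave_le hC (h.pos k) (h.absorption_pos k) hx
    have h2 := le_of_tendsto (tendsto_modulatedWave h f hf hx).norm (.of_forall h1)
    refine (norm_sub_le _ _).trans ?_
    linarith [h1 k]
  -- The dominating function is a constant times `1/|x|`, itself the modulus of the far field of a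
  -- constant trace, so its weighted norm is already known to be finite.
  · have h1 := lintegral_farField (T := fun _ => 1) measurable_const
    have h2 : ∀ x : E, ENNReal.ofReal (2 * C * ‖x‖⁻¹) ^ 2 =
        ENNReal.ofReal (C / Real.pi ^ 2) ^ 2 * ‖farField (fun _ => 1) x‖ₑ ^ 2 := fun x => by
      rw [farField, mul_one, enorm_neg, ← ofReal_norm, Complex.norm_real,
        Real.norm_of_nonneg (by positivity), ← mul_pow, ← ENNReal.ofReal_mul (by positivity)]
      congr 2
      field_simp
    simp only [h2]
    rw [lintegral_const_mul' _ _ (by simp), h1]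
    refine ENNReal.mul_ne_top (by simp) (ENNReal.mul_ne_top farFieldConst_ne_top ?_)
    simp
  · filter_upwards [ae_weightMeasure_ne_zero] with x hx
    have := (tendsto_modulatedWave h f hf hx).sub_const (farField (fourier f) x)
    simpa using this

/-! ### The trace theorem and strong convergence for sources in `B` -/

/-- The trace theorem does not involve `ε`; any one family of scales serves to extract it from the
resolvent estimate. -/
lemma scales_inv_succ : Scales (fun k => ((k : ℝ) + 1)⁻¹) (fun k => ((k : ℝ) + 1)⁻¹) := by
  have h : Tendsto (fun k : ℕ => ((k : ℝ) + 1)⁻¹) atTop (𝓝 0) := by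
    simpa using tendsto_one_div_add_atTop_nhds_zero_nat (𝕜 := ℝ)
  have p : ∀ k : ℕ, (0 : ℝ) < ((k : ℝ) + 1)⁻¹ := fun k => by positivity
  have l : ∀ k : ℕ, ((k : ℝ) + 1)⁻¹ ≤ 1 := fun k => inv_le_one_of_one_le₀ (by simp)
  exact ⟨p, l, h, p, l, h⟩

/-- The convergence of the amplitudes to the far field, for test functions. -/
lemma tendsto_amplitude_testFunction {e a : ℕ → ℝ} (h : Scales e a) {g : E → ℂ}
    (hg : IsTestFunction g) :
    Tendsto (fun k => eLpNorm (fun x => amplitude (e k) (a k) (hg.memB.memLp.toLp g) x -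
      farField (fourier g) x) 2 (weightMeasure 1)) atTop (𝓝 0) := by
  let s : 𝓢(E, ℂ) := hg.2.toSchwartzMap hg.1
  have hs : s.toLp 2 volume = hg.memB.memLp.toLp g := rfl
  refine (tendsto_eLpNorm_modulatedWave_sub h s hg.2).congr fun k => eLpNorm_congr_ae ?_
  filter_upwards [(weightMeasure_absolutelyContinuous 1).ae_le
    (amplitude_toLp_ae (h.pos k) (h.absorption_pos k) s)] with x hx
  rw [← hs, hx]
  rfl

lemma IsTestFunction.integrable {g : E → ℂ} (hg : IsTestFunction g) : Integrable g :=
  memLp_one_iff_integrable.1 (hg.memLp 1)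

/-- The constant in the trace theorem. -/
def traceConst : ℝ≥0∞ := (farFieldConst ^ (1 / 2 : ℝ))⁻¹ * 16

lemma farFieldConst_rpow_ne_zero : farFieldConst ^ (1 / 2 : ℝ) ≠ 0 := by
  simp [ENNReal.rpow_eq_zero_iff, farFieldConst_ne_zero, farFieldConst_ne_top]

lemma farFieldConst_rpow_ne_top : farFieldConst ^ (1 / 2 : ℝ) ≠ ⊤ :=
  ENNReal.rpow_ne_top_of_nonneg (by norm_num) farFieldConst_ne_top

lemma traceConst_ne_top : traceConst ≠ ⊤ :=
  ENNReal.mul_ne_top (ENNReal.inv_ne_top.2 farFieldConst_rpow_ne_zero) (by norm_num)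

/-- The trace theorem for test functions. -/
lemma IsTestFunction.eLpNorm_fourier_le {g : E → ℂ} (hg : IsTestFunction g) :
    eLpNorm (fourier g) 2 deltaSphere ≤ traceConst * normB g := by
  have h := scales_inv_succ
  have hT := (continuous_fourier hg.integrable).measurable
  -- The far field is the limit of amplitudes that all obey the uniform bound. Together with the
  -- exact ratio between far field and trace this is the trace estimate.
  have key : eLpNorm (farField (fourier g)) 2 (weightMeasure 1) ≤ 16 * normB g := by
    have h1 := (tendsto_amplitude_testFunction h hg).add_const (16 * normB g)
    rw [zero_add] at h1
    refine ge_of_tendsto' h1 fun k => ?_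
    set A := amplitude (((k : ℝ) + 1)⁻¹) (((k : ℝ) + 1)⁻¹) (hg.memB.memLp.toLp g) with hA
    have e : farField (fourier g) = (fun x => farField (fourier g) x - A x) + A := by ext x; simp
    have mA := aestronglyMeasurable_weightMeasure (aestronglyMeasurable_amplitude (h.pos k)
      (((k : ℝ) + 1)⁻¹) (hg.memB.memLp.toLp g)) 1
    have mF := (measurable_farField hT).aestronglyMeasurable (μ := weightMeasure 1)
    conv_lhs => rw [e]
    refine (eLpNorm_add_le (mF.sub mA) mA (by norm_num)).trans (add_le_add (le_of_eq ?_) ?_)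
    · exact eLpNorm_sub_comm (farField (fourier g)) A 2 (weightMeasure 1)
    · exact eLpNorm_amplitude_le (h.pos k) (h.le_one k) (h.absorption_pos k) (h.absorption_le k) hg.memB
  rw [eLpNorm_farField hT] at key
  rw [traceConst, mul_assoc]
  rwa [← ENNReal.mul_le_iff_le_inv farFieldConst_rpow_ne_zero farFieldConst_rpow_ne_top]

lemma fourier_sub {f g : E → ℂ} (hf : Integrable f) (hg : Integrable g) (ξ : E) :
    fourier (fun x => f x - g x) ξ = fourier f ξ - fourier g ξ := by
  have int : ∀ {f : E → ℂ}, Integrable f → Integrable fun x =>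
      Complex.exp (-Complex.I * ((inner ℝ x ξ : ℝ) : ℂ)) * f x := fun hf => by
    refine hf.bdd_mul (c := 1) (Continuous.aestronglyMeasurable (by fun_prop))
      (.of_forall fun x => ?_)
    rw [neg_mul, ← mul_neg, ← Complex.ofReal_neg, norm_exp_I_mul]
  rw [fourier, fourier, fourier, ← mul_sub, ← integral_sub (int hf) (int hg)]
  simp only [mul_sub]

lemma enorm_fourier_le (f : E → ℂ) (ξ : E) : ‖fourier f ξ‖ₑ ≤ eLpNorm f 1 volume := by
  rw [fourier, enorm_mul, eLpNorm_one_eq_lintegral_enorm]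
  have h1 : ‖((2 * Real.pi : ℝ) : ℂ)⁻¹ ^ 3‖ₑ ≤ 1 := by
    rw [← ofReal_norm, norm_pow, norm_inv, Complex.norm_real, Real.norm_of_nonneg (by positivity)]
    refine ENNReal.ofReal_le_one.2 (pow_le_one₀ (by positivity) (inv_le_one_of_one_le₀ ?_))
    linarith [Real.two_le_pi]
  refine (mul_le_mul' h1 (enorm_integral_le_lintegral_enorm _)).trans ?_
  rw [one_mul]
  refine lintegral_mono fun x => ?_
  rw [enorm_mul, ← ofReal_norm, neg_mul, ← mul_neg, ← Complex.ofReal_neg, norm_exp_I_mul]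
  simp

/-- The trace theorem for integrable functions. -/
lemma eLpNorm_fourier_le {f : E → ℂ} (hf : Integrable f) :
    eLpNorm (fourier f) 2 deltaSphere ≤ traceConst * normB f := by
  rcases eq_or_ne (normB f) ⊤ with hB | hB
  · rw [hB, ENNReal.mul_top]
    · exact le_top
    · exact mul_ne_zero (ENNReal.inv_ne_zero.2 farFieldConst_rpow_ne_top) (by norm_num)
  have hfB : MemB f := ⟨hf.1, hB.lt_top⟩
  refine ENNReal.le_of_forall_pos_le_add fun η hη _ => ?_
  set D : ℝ≥0∞ := deltaSphere Set.univ ^ (1 / 2 : ℝ) with hD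
  have hDt : D ≠ ⊤ := ENNReal.rpow_ne_top_of_nonneg (by norm_num) (measure_ne_top _ _)
  set C := D + traceConst with hC
  have hCt : C ≠ ⊤ := ENNReal.add_ne_top.2 ⟨hDt, traceConst_ne_top⟩
  obtain ⟨ε, hε, hεC⟩ : ∃ ε : ℝ≥0∞, 0 < ε ∧ C * ε ≤ η :=
    ⟨η / C, ENNReal.div_pos (by simpa using hη.ne') hCt, ENNReal.mul_div_le⟩
  -- The approximation is simultaneous in `B` and in `L¹`: smallness in `L¹` makes the Fourier
  -- transforms uniformly close on the sphere, and smallness in `B` keeps the constant.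
  obtain ⟨g, hg, hgB, hg1⟩ := exists_testFunction_approx hfB hε
  have hsub := hf.sub hg.integrable
  have e : fourier f = fourier (fun x => f x - g x) + fourier g := by
    ext ξ
    rw [Pi.add_apply, fourier_sub hf hg.integrable, sub_add_cancel]
  have h1 : eLpNorm (fourier (fun x => f x - g x)) 2 deltaSphere ≤ D * ε := by
    rw [eLpNorm_two_eq]
    have : ∫⁻ ξ, ‖fourier (fun x => f x - g x) ξ‖ₑ ^ 2 ∂deltaSphere ≤
        ε ^ 2 * deltaSphere Set.univ := by
      rw [← lintegral_const]
      refine lintegral_mono fun ξ => ?_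
      gcongr
      exact (enorm_fourier_le _ _).trans (hg1 hf)
    refine (ENNReal.rpow_le_rpow this (by norm_num)).trans (le_of_eq ?_)
    rw [ENNReal.mul_rpow_of_nonneg _ _ (by norm_num), ← ENNReal.rpow_natCast, ← ENNReal.rpow_mul,
      mul_comm]
    norm_num
    rfl
  have h2 : normB g ≤ normB f + ε := by
    have := normB_sub_le (h := fun _ => (0 : ℂ)) (g := f) (hg.memLp 2).1 hf.1
      aestronglyMeasurable_const
    simp only [sub_zero] at this
    rw [normB_sub_comm, add_comm] at this
    exact this.trans (by gcongr)
  rw [e]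
  refine (eLpNorm_add_le (continuous_fourier hsub).aestronglyMeasurable
    (continuous_fourier hg.integrable).aestronglyMeasurable (by norm_num)).trans ?_
  calc _ ≤ D * ε + traceConst * (normB f + ε) :=
        add_le_add h1 (hg.eLpNorm_fourier_le.trans (by gcongr))
    _ = traceConst * normB f + C * ε := by rw [hC]; ring
    _ ≤ _ := by gcongr

lemma memLp_fourier {f : E → ℂ} (hf : IsTestFunction f) : MemLp (fourier f) 2 deltaSphere :=
  ⟨(continuous_fourier hf.integrable).aestronglyMeasurable,
    hf.eLpNorm_fourier_le.trans_lt (ENNReal.mul_lt_top traceConst_ne_top.lt_top hf.memB.2)⟩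

/-- Functions in `B` have a trace: the common limit of the Fourier transforms of a sequence of
test functions. -/
lemma exists_trace {S : E → ℂ} (hS : MemB S) :
    ∃ T : E → ℂ, Measurable T ∧ MemLp T 2 deltaSphere ∧
      ∃ g : ℕ → E → ℂ, (∀ n, IsTestFunction (g n)) ∧
        Tendsto (fun n => normB fun x => S x - g n x) atTop (𝓝 0) ∧
        Tendsto (fun n => eLpNorm (fun ξ => fourier (g n) ξ - T ξ) 2 deltaSphere) atTop (𝓝 0) := by
  have hpos : ∀ n : ℕ, (0 : ℝ≥0∞) < 2⁻¹ ^ n := fun n => ENNReal.pow_pos (by simp) n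
  choose g hg hgB _ using fun n => exists_testFunction_approx hS (hpos n)
  have hlim : Tendsto (fun n : ℕ => (2⁻¹ : ℝ≥0∞) ^ n) atTop (𝓝 0) :=
    ENNReal.tendsto_pow_atTop_nhds_zero_of_lt_one (by norm_num)
  -- The summand `1` in the constant only serves to make the inequality strict, as the completeness
  -- criterion below demands.
  have hcau : ∀ N n m : ℕ, N ≤ n → N ≤ m → eLpNorm (fourier (g n) - fourier (g m)) 2 deltaSphere <
      (traceConst * 2 + 1) * 2⁻¹ ^ N := fun N n m hn hm => by
    have e : fourier (g n) - fourier (g m) = fourier (fun x => g n x - g m x) := by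
      ext ξ
      rw [fourier_sub (hg n).integrable (hg m).integrable, Pi.sub_apply]
    have h1 : normB (fun x => g n x - g m x) ≤ 2 * 2⁻¹ ^ N := by
      refine (normB_sub_le ((hg n).memLp 2).1 hS.1 ((hg m).memLp 2).1).trans ?_
      rw [two_mul, normB_sub_comm]
      have anti : ∀ n, N ≤ n → (2⁻¹ : ℝ≥0∞) ^ n ≤ 2⁻¹ ^ N := fun n hn =>
        pow_le_pow_of_le_one zero_le (by norm_num) hn
      exact add_le_add ((hgB n).trans (anti n hn)) ((hgB m).trans (anti m hm))
    rw [e]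
    refine (eLpNorm_fourier_le ((hg n).integrable.sub (hg m).integrable)).trans_lt ?_
    refine lt_of_le_of_lt (b := traceConst * (2 * 2⁻¹ ^ N)) (mul_le_mul_right h1 _) ?_
    rw [add_mul, one_mul, ← mul_assoc]
    exact ENNReal.lt_add_right (ENNReal.mul_ne_top (ENNReal.mul_ne_top traceConst_ne_top
      (by norm_num)) (by simp)) (hpos N).ne'
  obtain ⟨T, hT, hTl⟩ := Lp.cauchy_complete_eLpNorm (by norm_num) (fun n => memLp_fourier (hg n))
    (B := fun N => (traceConst * 2 + 1) * 2⁻¹ ^ N) (by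
      rw [ENNReal.tsum_mul_left, ENNReal.tsum_geometric]
      refine ENNReal.mul_ne_top (ENNReal.add_ne_top.2 ⟨ENNReal.mul_ne_top traceConst_ne_top
        (by norm_num), by norm_num⟩) ?_
      simp) hcau
  refine ⟨hT.1.mk T, hT.1.stronglyMeasurable_mk.measurable, hT.ae_eq hT.1.ae_eq_mk, g, hg, ?_, ?_⟩
  · exact tendsto_of_tendsto_of_tendsto_of_le_of_le tendsto_const_nhds hlim (fun _ => zero_le) hgB
  · refine hTl.congr fun n => eLpNorm_congr_ae ?_
    filter_upwards [hT.1.ae_eq_mk] with ξ hξ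
    rw [Pi.sub_apply, hξ]

/-- The common limit is the trace. -/
lemma isFourierTrace_of_tendsto {S T : E → ℂ} (hS : MemB S) (hT : MemLp T 2 deltaSphere)
    {g : ℕ → E → ℂ} (hg : ∀ n, IsTestFunction (g n))
    (h1 : Tendsto (fun n => normB fun x => S x - g n x) atTop (𝓝 0))
    (h2 : Tendsto (fun n => eLpNorm (fun ξ => fourier (g n) ξ - T ξ) 2 deltaSphere) atTop (𝓝 0)) :
    IsFourierTrace S T := by
  refine ⟨hT, fun f hf hfS => ?_⟩
  have h3 := (ENNReal.Tendsto.const_mul (hfS.add h1) (.inr traceConst_ne_top)).add h2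
  simp only [add_zero, mul_zero] at h3
  refine tendsto_of_tendsto_of_tendsto_of_le_of_le tendsto_const_nhds h3 (fun _ => zero_le)
    fun n => ?_
  have e : (fun ξ => fourier (f n) ξ - T ξ) = fourier (fun x => f n x - g n x) +
      fun ξ => fourier (g n) ξ - T ξ := by
    ext ξ
    rw [Pi.add_apply, fourier_sub (hf n) (hg n).integrable, sub_add_sub_cancel]
  have hi := (hf n).sub (hg n).integrable
  rw [e]
  refine (eLpNorm_add_le (continuous_fourier hi).aestronglyMeasurable
    ((continuous_fourier (hg n).integrable).aestronglyMeasurable.sub hT.1) (by norm_num)).trans ?_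
  refine add_le_add ((eLpNorm_fourier_le hi).trans ?_) le_rfl
  gcongr
  exact normB_sub_le (hf n).1 hS.1 ((hg n).memLp 2).1

/-- The amplitudes converge to the far field of the trace. -/
lemma tendsto_amplitude {e a : ℕ → ℝ} (h : Scales e a) {S T : E → ℂ} (hS : MemB S)
    (hT : Measurable T) {g : ℕ → E → ℂ} (hg : ∀ n, IsTestFunction (g n))
    (h1 : Tendsto (fun n => normB fun x => S x - g n x) atTop (𝓝 0))
    (h2 : Tendsto (fun n => eLpNorm (fun ξ => fourier (g n) ξ - T ξ) 2 deltaSphere) atTop (𝓝 0)) :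
    Tendsto (fun k => eLpNorm (fun x => amplitude (e k) (a k) (hS.memLp.toLp S) x - farField T x) 2
      (weightMeasure 1)) atTop (𝓝 0) := by
  set c := farFieldConst ^ (1 / 2 : ℝ) with hc
  have h3 : Tendsto (fun n => 16 * normB (fun x => S x - g n x) +
      c * eLpNorm (fun ξ => fourier (g n) ξ - T ξ) 2 deltaSphere) atTop (𝓝 0) := by
    have := (ENNReal.Tendsto.const_mul (a := 16) h1 (.inr (by norm_num))).add
      (ENNReal.Tendsto.const_mul (a := c) h2 (.inr farFieldConst_rpow_ne_top))
    simpa using this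
  -- Comparison through the test function `g n`. The first two errors are uniform in `k`, by the
  -- resolvent estimate and by the isometry between far fields and traces up to a constant. So `n`
  -- is fixed first and `k` sent to infinity afterwards.
  have main : ∀ n k, eLpNorm (fun x => amplitude (e k) (a k) (hS.memLp.toLp S) x - farField T x) 2
      (weightMeasure 1) ≤ (16 * normB (fun x => S x - g n x) +
        c * eLpNorm (fun ξ => fourier (g n) ξ - T ξ) 2 deltaSphere) +
      eLpNorm (fun x => amplitude (e k) (a k) ((hg n).memB.memLp.toLp (g n)) x -
        farField (fourier (g n)) x) 2 (weightMeasure 1) := fun n k => by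
    set A := amplitude (e k) (a k) (hS.memLp.toLp S)
    set G := amplitude (e k) (a k) ((hg n).memB.memLp.toLp (g n))
    have hF := (continuous_fourier (hg n).integrable).measurable
    have mA : AEStronglyMeasurable A (weightMeasure 1) :=
      aestronglyMeasurable_weightMeasure (aestronglyMeasurable_amplitude (h.pos k) _ _) 1
    have mG : AEStronglyMeasurable G (weightMeasure 1) :=
      aestronglyMeasurable_weightMeasure (aestronglyMeasurable_amplitude (h.pos k) _ _) 1
    have m1 := (measurable_farField hF).aestronglyMeasurable (μ := weightMeasure 1)
    have m2 := (measurable_farField hT).aestronglyMeasurable (μ := weightMeasure 1)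
    have t1 : eLpNorm (fun x => A x - G x) 2 (weightMeasure 1) ≤
        16 * normB (fun x => S x - g n x) := by
      have hm := hS.sub (hg n).memB
      refine le_trans (le_of_eq (eLpNorm_congr_ae ?_)) (eLpNorm_amplitude_le (h.pos k) (h.le_one k)
        (h.absorption_pos k) (h.absorption_le k) hm)
      filter_upwards [(weightMeasure_absolutelyContinuous 1).ae_le (wave_sub_ae (h.pos k) (a k)
        (hS.memLp.toLp S) ((hg n).memB.memLp.toLp (g n)))] with x hx
      have e : hm.memLp.toLp (fun x => S x - g n x) =
        hS.memLp.toLp S - (hg n).memB.memLp.toLp (g n) := MemLp.toLp_sub _ _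
      simp only [A, G, amplitude]
      rw [← mul_sub, hx, e]
    have t2 : eLpNorm (fun x => farField (fourier (g n)) x - farField T x) 2 (weightMeasure 1) =
        c * eLpNorm (fun ξ => fourier (g n) ξ - T ξ) 2 deltaSphere := by
      rw [hc, ← eLpNorm_farField (T := fun ξ => fourier (g n) ξ - T ξ) (hF.sub hT)]
      congr 1 with x
      simp only [farField]
      ring
    have e : (fun x => A x - farField T x) = ((fun x => A x - G x) +
        fun x => farField (fourier (g n)) x - farField T x) +
        fun x => G x - farField (fourier (g n)) x := by
      ext x; simp only [Pi.add_apply]; ring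
    rw [e]
    refine (eLpNorm_add_le ((mA.sub mG).add (m1.sub m2)) (mG.sub m1) (by norm_num)).trans
      (add_le_add ((eLpNorm_add_le (mA.sub mG) (m1.sub m2) (by norm_num)).trans
        (add_le_add t1 t2.le)) le_rfl)
  refine ENNReal.tendsto_nhds_zero.2 fun η hη => ?_
  have hη2 := ENNReal.half_pos hη.ne'
  obtain ⟨n, hn⟩ := (h3.eventually (Iic_mem_nhds hη2)).exists
  filter_upwards [(tendsto_amplitude_testFunction h (hg n)).eventually (Iic_mem_nhds hη2)] with k hk
  rw [← ENNReal.add_halves η]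
  exact (main n k).trans (add_le_add hn hk)

/-! ### Fourier transform of test functions in the momentum variable -/

lemma contDiff_slice {φ : E × E → ℂ} (hφ : ContDiff ℝ ∞ φ) (x : E) :
    ContDiff ℝ ∞ fun ξ => φ (x, ξ) :=
  hφ.comp (contDiff_const.prodMk contDiff_id)

/-- Uniform decay of the derivatives of the restrictions of a test function to fibres. -/
lemma exists_norm_iteratedFDeriv_slice_le {φ : E × E → ℂ} (hφ : IsTestFunction φ) (n : ℕ) :
    ∃ C, ∀ x ξ, ‖iteratedFDeriv ℝ n (fun ξ => φ (x, ξ)) ξ‖ ≤ C * ((1 + ‖ξ‖) ^ 4)⁻¹ := by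
  let s : 𝓢(E × E, ℂ) := hφ.2.toSchwartzMap hφ.1
  refine ⟨2 ^ 4 * (Finset.Iic (4, n)).sup (fun m => SchwartzMap.seminorm ℝ m.1 m.2) s,
    fun x ξ => ?_⟩
  have h1 := SchwartzMap.one_add_le_sup_seminorm_apply (𝕜 := ℝ) (m := (4, n)) le_rfl le_rfl s (x, ξ)
  have h2 : ‖iteratedFDeriv ℝ n (fun ξ => φ (x, ξ)) ξ‖ ≤ ‖iteratedFDeriv ℝ n φ (x, ξ)‖ := by
    have e : (fun ξ => φ (x, ξ)) = (fun p => φ ((x, 0) + p)) ∘ ContinuousLinearMap.inr ℝ E E := by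
      ext ξ; simp
    have hc : ContDiff ℝ n fun p => φ ((x, 0) + p) := (hφ.1.of_le (mod_cast le_top)).comp (by fun_prop)
    rw [e, ContinuousLinearMap.iteratedFDeriv_comp_right _ hc _ le_rfl, iteratedFDeriv_comp_add_left]
    refine (ContinuousMultilinearMap.norm_compContinuousLinearMap_le _ _).trans ?_
    simp only [ContinuousLinearMap.inr_apply, Prod.mk_add_mk, add_zero, zero_add]
    refine mul_le_of_le_one_right (norm_nonneg _) (Finset.prod_le_one (fun _ _ => norm_nonneg _)
      fun _ _ => ContinuousLinearMap.norm_inr_le_one _ _ _)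
  rw [← div_eq_mul_inv, le_div_iff₀ (by positivity), mul_comm]
  refine le_trans ?_ h1
  have h3 : ‖ξ‖ ≤ ‖(x, ξ)‖ := norm_snd_le (x, ξ)
  have h4 : iteratedFDeriv ℝ n s (x, ξ) = iteratedFDeriv ℝ n φ (x, ξ) := rfl
  rw [h4]
  gcongr

lemma integrable_inv_one_add_norm_pow_four : Integrable fun y : E => ((1 + ‖y‖) ^ 4)⁻¹ := by
  have h := integrable_one_add_norm (E := E) (μ := volume) (r := 4) (by simp; norm_num)
  refine h.congr (.of_forall fun y => ?_)
  have h0 : 0 ≤ 1 + ‖y‖ := by positivity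
  simp only
  rw [show (-4 : ℝ) = -((4 : ℕ) : ℝ) by norm_num, Real.rpow_neg h0, Real.rpow_natCast]

/-- The Fourier transform of a function on phase space in the momentum variable. -/
def partialFourier (φ : E × E → ℂ) (p : E × E) : ℂ := fourier (fun ξ => φ (p.1, ξ)) p.2

lemma fourier_eq_smul (f : E → ℂ) (y : E) :
    fourier f y = ((2 * Real.pi : ℝ) : ℂ)⁻¹ ^ 3 * 𝓕 f ((2 * Real.pi)⁻¹ • y) := by
  rw [fourier, Real.fourier_eq']
  congr 2 with ξ
  rw [inner_smul_right, smul_eq_mul]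
  congr 2
  have : (Real.pi : ℂ) ≠ 0 := by exact_mod_cast Real.pi_ne_zero
  push_cast
  field_simp

section partialFourier

variable {φ : E × E → ℂ} (hφ : IsTestFunction φ)
include hφ

lemma integrable_slice (x : E) : Integrable fun ξ => φ (x, ξ) := by
  obtain ⟨C, hC⟩ := exists_norm_iteratedFDeriv_slice_le hφ 0
  refine (integrable_inv_one_add_norm_pow_four.const_mul C).mono'
    (contDiff_slice hφ.1 x).continuous.aestronglyMeasurable (.of_forall fun ξ => ?_)
  simpa using hC x ξ

lemma continuous_partialFourier : Continuous (partialFourier φ) := by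
  obtain ⟨C, hC⟩ := exists_norm_iteratedFDeriv_slice_le hφ 0
  have := hφ.1.continuous
  refine continuous_const.mul (continuous_of_dominated (bound := fun ξ => C * ((1 + ‖ξ‖) ^ 4)⁻¹)
    (fun p => (Continuous.aestronglyMeasurable (by fun_prop))) (fun p => .of_forall fun ξ => ?_)
    (integrable_inv_one_add_norm_pow_four.const_mul C) (.of_forall fun ξ => by fun_prop))
  rw [norm_mul, neg_mul, ← mul_neg, ← Complex.ofReal_neg, norm_exp_I_mul, one_mul]
  simpa using hC p.1 ξ

lemma exists_norm_partialFourier_le (n : ℕ) :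
    ∃ D, 0 ≤ D ∧ ∀ x y, ‖y‖ ^ n * ‖partialFourier φ (x, y)‖ ≤ D := by
  choose C hC using exists_norm_iteratedFDeriv_slice_le hφ
  have hint : ∀ x m, Integrable fun ξ => ‖iteratedFDeriv ℝ m (fun ξ => φ (x, ξ)) ξ‖ := fun x m => by
    refine (integrable_inv_one_add_norm_pow_four.const_mul (C m)).mono' ?_ (.of_forall fun ξ => ?_)
    · exact ((contDiff_slice hφ.1 x).continuous_iteratedFDeriv (mod_cast le_top)).norm.aestronglyMeasurable
    · rw [norm_norm]; exact hC m x ξ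
  set D₀ : ℝ := 2 ^ n * ∑ p ∈ Finset.range (0 + 1) ×ˢ Finset.range (n + 1),
    ∫ ξ : E, C p.2 * ((1 + ‖ξ‖) ^ 4)⁻¹ with hD₀
  have key : ∀ x w, ‖w‖ ^ n * ‖𝓕 (fun ξ => φ (x, ξ)) w‖ ≤ D₀ := fun x w => by
    have h := Real.pow_mul_norm_iteratedFDeriv_fourier_le (f := fun ξ => φ (x, ξ)) (K := 0)
      (N := (n : ℕ∞)) (k := 0) (n := n) ((contDiff_slice hφ.1 x).of_le (mod_cast le_top))
      (fun k m hk hm => by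
        have : k = 0 := by simpa using hk
        subst this
        simpa using hint x m) le_rfl le_rfl w
    simp only [norm_iteratedFDeriv_zero, pow_zero, one_mul, CharP.cast_eq_zero, mul_zero,
      zero_add] at h
    refine h.trans ?_
    rw [hD₀]
    simp only [zero_add]
    gcongr with p hp
    · have : p.1 = 0 := by simpa using (Finset.mem_product.1 hp).1
      simpa [this] using hint x p.2
    · exact integrable_inv_one_add_norm_pow_four.const_mul _
    · have : p.1 = 0 := by simpa using (Finset.mem_product.1 hp).1
      intro ξ
      simpa [this] using hC p.2 x ξ
  have hπ := Real.pi_pos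
  have hD : 0 ≤ D₀ := le_trans (by positivity) (key 0 0)
  refine ⟨(2 * Real.pi) ^ n * (((2 * Real.pi)⁻¹) ^ 3 * D₀), by positivity, fun x y => ?_⟩
  rw [partialFourier, fourier_eq_smul, norm_mul, norm_pow, norm_inv, Complex.norm_real,
    Real.norm_of_nonneg (by positivity)]
  have h := key x ((2 * Real.pi)⁻¹ • y)
  rw [norm_smul, Real.norm_of_nonneg (by positivity), mul_pow] at h
  calc _ = (2 * Real.pi) ^ n * ((2 * Real.pi)⁻¹ ^ 3 * ((2 * Real.pi)⁻¹ ^ n * ‖y‖ ^ n *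
        ‖𝓕 (fun ξ => φ (x, ξ)) ((2 * Real.pi)⁻¹ • y)‖)) := by
        have h1 : (2 * Real.pi) ^ n * (2 * Real.pi)⁻¹ ^ n = 1 := by
          rw [← mul_pow, mul_inv_cancel₀ (by positivity), one_pow]
        linear_combination (-(2 * Real.pi)⁻¹ ^ 3 * ‖y‖ ^ n *
          ‖𝓕 (fun ξ => φ (x, ξ)) ((2 * Real.pi)⁻¹ • y)‖) * h1
    _ ≤ _ := by gcongr

/-- The exponent is `7 = 4 + 3`: four powers make the kernel integrable in `y`, and three pay for
moving the weight, which decays like `|x|⁻³`, from `x` to `x ± s y`. -/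
lemma exists_norm_partialFourier_decay :
    ∃ D K, 0 ≤ D ∧ 0 ≤ K ∧ (∀ x y, ‖partialFourier φ (x, y)‖ ≤ D * ((1 + ‖y‖) ^ 7)⁻¹) ∧
      ∀ x y, K < ‖x‖ → partialFourier φ (x, y) = 0 := by
  obtain ⟨D₁, h1, hD₁⟩ := exists_norm_partialFourier_le hφ 0
  obtain ⟨D₂, h2, hD₂⟩ := exists_norm_partialFourier_le hφ 7
  obtain ⟨K, hK⟩ := hφ.2.isCompact.isBounded.subset_closedBall 0
  refine ⟨2 ^ 7 * (D₁ + D₂), max K 0, by positivity, le_max_right _ _, fun x y => ?_, fun x y hx => ?_⟩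
  · rw [← div_eq_mul_inv, le_div_iff₀ (by positivity)]
    have h := hD₁ x y
    have h' := hD₂ x y
    rw [pow_zero, one_mul] at h
    have h3 : (1 + ‖y‖) ^ 7 ≤ 2 ^ 7 * (1 + ‖y‖ ^ 7) := by
      have h0 := norm_nonneg y
      rcases le_total ‖y‖ 1 with h | h
      · calc (1 + ‖y‖) ^ 7 ≤ 2 ^ 7 := by gcongr; linarith
          _ ≤ _ := by linarith [pow_nonneg h0 7]
      · calc (1 + ‖y‖) ^ 7 ≤ (2 * ‖y‖) ^ 7 := by gcongr; linarith
          _ ≤ _ := by rw [mul_pow]; linarith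
    calc _ ≤ ‖partialFourier φ (x, y)‖ * (2 ^ 7 * (1 + ‖y‖ ^ 7)) := by gcongr
      _ = 2 ^ 7 * (‖partialFourier φ (x, y)‖ + ‖y‖ ^ 7 * ‖partialFourier φ (x, y)‖) := by ring
      _ ≤ _ := by gcongr
  · have : ∀ ξ, φ (x, ξ) = 0 := fun ξ => by
      refine image_eq_zero_of_notMem_tsupport fun h => ?_
      have h1 := mem_closedBall_zero_iff.1 (hK h)
      have h2 : ‖x‖ ≤ ‖(x, ξ)‖ := norm_fst_le (x, ξ)
      linarith [le_max_left K 0]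
    simp [partialFourier, fourier, this]

/-- Fourier inversion in the momentum variable. -/
lemma integral_exp_mul_partialFourier (x n : E) :
    ∫ y, Complex.exp (-Complex.I * ((inner ℝ y n : ℝ) : ℂ)) * partialFourier φ (x, y) = φ (x, -n) := by
  obtain ⟨D, K, hD, hK, hdec, -⟩ := exists_norm_partialFourier_decay hφ
  set f : E → ℂ := fun ξ => φ (x, ξ) with hf
  have hfc : Continuous f := (contDiff_slice hφ.1 x).continuous
  have hfi : Integrable f := integrable_slice hφ x
  have hπ : (Real.pi : ℂ) ≠ 0 := by exact_mod_cast Real.pi_ne_zero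
  have hP : ∀ y, partialFourier φ (x, y) =
      ((2 * Real.pi : ℝ) : ℂ)⁻¹ ^ 3 * 𝓕 f ((2 * Real.pi)⁻¹ • y) := fun y => fourier_eq_smul f y
  have hpi : Integrable fun y => partialFourier φ (x, y) := by
    refine (integrable_inv_one_add_norm_pow_four.const_mul D).mono'
      ((continuous_partialFourier hφ).comp (by fun_prop)).aestronglyMeasurable
      (.of_forall fun y => (hdec x y).trans ?_)
    gcongr
    · linarith [norm_nonneg y]
    · norm_num
  have hFi : Integrable (𝓕 f) := by
    have h := (hpi.comp_smul (R := 2 * Real.pi) (by positivity)).const_mul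
      (((2 * Real.pi : ℝ) : ℂ) ^ 3)
    refine h.congr (.of_forall fun w => ?_)
    simp only [hP]
    rw [inv_smul_smul₀ (by positivity), ← mul_assoc, ← mul_pow, mul_inv_cancel₀, one_pow, one_mul]
    exact_mod_cast (by positivity : 2 * Real.pi ≠ 0)
  have inv := congrFun (hfc.fourierInv_fourier_eq hfi hFi) (-n)
  rw [Real.fourierInv_eq'] at inv
  rw [show φ (x, -n) = f (-n) from rfl, ← inv]
  have hs := Measure.integral_comp_smul (volume : Measure E) (fun w =>
    Complex.exp (((2 * Real.pi * inner ℝ w (-n) : ℝ) : ℂ) * Complex.I) • 𝓕 f w) (2 * Real.pi)⁻¹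
  have h2 : ∫ w, Complex.exp (((2 * Real.pi * inner ℝ w (-n) : ℝ) : ℂ) * Complex.I) • 𝓕 f w =
      (((2 * Real.pi)⁻¹ : ℝ) ^ 3 : ℝ) • ∫ y : E, Complex.exp (((2 * Real.pi * inner ℝ
        ((2 * Real.pi)⁻¹ • y) (-n) : ℝ) : ℂ) * Complex.I) • 𝓕 f ((2 * Real.pi)⁻¹ • y) := by
    rw [hs, finrank_euclideanSpace, Fintype.card_fin, abs_of_pos (by positivity),
      smul_inv_smul₀ (by positivity)]
  rw [h2, ← integral_smul]
  congr 1 with y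
  rw [hP, inner_smul_left, inner_neg_right, Complex.real_smul, smul_eq_mul]
  have e : Complex.exp (-Complex.I * ((inner ℝ y n : ℝ) : ℂ)) = Complex.exp (((2 * Real.pi *
      ((starRingEnd ℝ) (2 * Real.pi)⁻¹ * -inner ℝ y n) : ℝ) : ℂ) * Complex.I) := by
    congr 1
    simp only [conj_trivial]
    push_cast
    field_simp
  rw [e]
  push_cast
  ring

end partialFourier

/-! ### Uniformly bounded sesquilinear forms -/

/-- Kernels on `E × E` which are compactly supported in the first variable and rapidly decaying
in the second one. -/
structure IsKernel (Φ : E × E → ℂ) : Prop where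
  continuous : Continuous Φ
  decay : ∃ D K, 0 ≤ D ∧ 0 ≤ K ∧ (∀ x y, ‖Φ (x, y)‖ ≤ D * ((1 + ‖y‖) ^ 7)⁻¹) ∧
    ∀ x y, K < ‖x‖ → Φ (x, y) = 0

lemma IsTestFunction.isKernel {φ : E × E → ℂ} (hφ : IsTestFunction φ) :
    IsKernel (partialFourier φ) :=
  ⟨continuous_partialFourier hφ, exists_norm_partialFourier_decay hφ⟩

/-- For each `y` the map is a translation in `x`, so Fubini applies for every `s`, including `s =
0`, which occurs in the limit form. -/
lemma quasiMeasurePreserving_add_smul (s : ℝ) :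
    Measure.QuasiMeasurePreserving (fun p : E × E => p.1 + s • p.2) volume volume := by
  refine ⟨by fun_prop, Measure.AbsolutelyContinuous.mk fun N hN h0 => ?_⟩
  have hm : Measurable fun p : E × E => p.1 + s • p.2 := by fun_prop
  rw [Measure.map_apply hm hN, Measure.volume_eq_prod, Measure.prod_apply_symm (hm hN)]
  simp only [Set.preimage_preimage]
  have : ∀ y : E, volume ((fun x : E => x + s • y) ⁻¹' N) = 0 := fun y => by
    rw [measure_preimage_add_right, h0]
  simp [this]

lemma quasiMeasurePreserving_sub_smul (s : ℝ) :
    Measure.QuasiMeasurePreserving (fun p : E × E => p.1 - s • p.2) volume volume := by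
  have := quasiMeasurePreserving_add_smul (-s)
  simpa only [neg_smul, ← sub_eq_add_neg] using this

lemma volume_absolutelyContinuous_weightMeasure : (volume : Measure E) ≪ weightMeasure 1 :=
  withDensity_absolutelyContinuous' (measurable_weight one_pos).aemeasurable
    (.of_forall fun x => by
      have := wt_pos one_pos x
      exact (ENNReal.ofReal_pos.2 (by positivity)).ne')

/-- For `|x| ≤ K` and `|s| ≤ 1` the weight at `x + s y` is at least a constant times `(1 + |y|)⁻³`.
The decay of the kernel therefore lets the weight be inserted, and the integral in `x` is
translation invariant. -/
lemma IsKernel.exists_lintegral_comp_le {Φ : E × E → ℂ} (hΦ : IsKernel Φ) :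
    ∃ C : ℝ≥0∞, C ≠ ⊤ ∧ ∀ s : ℝ, |s| ≤ 1 → ∀ g : E → ℝ≥0∞, Measurable g →
      ∫⁻ p : E × E, g (p.1 + s • p.2) * ‖Φ p‖ₑ ≤ C * ∫⁻ x, g x ∂weightMeasure 1 := by
  obtain ⟨D, K, hD, hK, hdec, hsupp⟩ := hΦ.decay
  refine ⟨ENNReal.ofReal (D * (1 + K) ^ 3) * ∫⁻ y : E, ENNReal.ofReal ((1 + ‖y‖) ^ 4)⁻¹,
    ENNReal.mul_ne_top ENNReal.ofReal_ne_top ?_, fun s hs g hg => ?_⟩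
  · exact ne_of_lt integrable_inv_one_add_norm_pow_four.lintegral_lt_top
  have hb : ∀ x y, ‖Φ (x, y)‖ ≤ D * (1 + K) ^ 3 * ((1 + ‖y‖) ^ 4)⁻¹ * wt 1 (x + s • y) ^ 3 :=
    fun x y => by
    have hw := wt_pos one_pos (x + s • y)
    by_cases hx : K < ‖x‖
    · rw [hsupp x y hx, norm_zero]; positivity
    have h1 : 1 + ‖x + s • y‖ ≤ (1 + K) * (1 + ‖y‖) := by
      have h2 := norm_add_le x (s • y)
      rw [norm_smul, Real.norm_eq_abs] at h2
      have h3 : |s| * ‖y‖ ≤ 1 * ‖y‖ := by gcongr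
      nlinarith [norm_nonneg y]
    have h2 : ((1 + K) * (1 + ‖y‖))⁻¹ ≤ wt 1 (x + s • y) :=
      (inv_anti₀ (by positivity) h1).trans (inv_one_add_norm_le_wt _)
    calc ‖Φ (x, y)‖ ≤ D * ((1 + ‖y‖) ^ 7)⁻¹ := hdec x y
      _ = D * (1 + K) ^ 3 * ((1 + ‖y‖) ^ 4)⁻¹ * ((1 + K) * (1 + ‖y‖))⁻¹ ^ 3 := by
          field_simp
      _ ≤ _ := by gcongr
  have hwm : Measurable (wt 1) := (continuous_wt one_pos).measurable
  have hF : Measurable fun z : E => ENNReal.ofReal (1 ^ 2 * wt 1 z ^ 3) * g z :=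
    (measurable_weight one_pos).mul hg
  calc ∫⁻ p : E × E, g (p.1 + s • p.2) * ‖Φ p‖ₑ
      ≤ ∫⁻ p : E × E, ENNReal.ofReal (D * (1 + K) ^ 3) * (ENNReal.ofReal ((1 + ‖p.2‖) ^ 4)⁻¹ *
          (ENNReal.ofReal (1 ^ 2 * wt 1 (p.1 + s • p.2) ^ 3) * g (p.1 + s • p.2))) := by
        refine lintegral_mono fun p => ?_
        have hw := wt_pos one_pos (p.1 + s • p.2)
        rw [← mul_assoc, ← mul_assoc, ← ENNReal.ofReal_mul (by positivity),
          ← ENNReal.ofReal_mul (by positivity), mul_comm, ← ofReal_norm]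
        refine mul_le_mul_left (ENNReal.ofReal_le_ofReal ((hb p.1 p.2).trans (le_of_eq ?_))) _
        ring
    _ = _ := by
        rw [lintegral_const_mul _ (by fun_prop), Measure.volume_eq_prod,
          lintegral_prod_symm _ (by fun_prop), lintegral_weightMeasure one_pos hg.aemeasurable,
          mul_assoc, ← lintegral_mul_const _ (by fun_prop)]
        congr 1
        refine lintegral_congr fun y => ?_
        simp only
        rw [lintegral_const_mul _ (by fun_prop)]
        congr 1
        exact lintegral_add_right_eq_self (μ := (volume : Measure E))
          (fun z => ENNReal.ofReal (1 ^ 2 * wt 1 z ^ 3) * g z) (s • y)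

/-- The Hilbert space of the uniform estimates. -/
abbrev WeightedL2 : Type := Lp ℂ 2 (weightMeasure 1)

/-- Cauchy–Schwarz after splitting `|Φ|` into two square roots, one for each argument. Only absolute
values occur, so the constant is independent of the phases. -/
lemma IsKernel.exists_lintegral_mul_le {Φ : E × E → ℂ} (hΦ : IsKernel Φ) :
    ∃ C : ℝ≥0∞, C ≠ ⊤ ∧ ∀ s : ℝ, |s| ≤ 1 → ∀ F G : WeightedL2,
      ∫⁻ p : E × E, ‖F (p.1 + s • p.2)‖ₑ * ‖G (p.1 - s • p.2)‖ₑ * ‖Φ p‖ₑ ≤ C * (‖F‖ₑ * ‖G‖ₑ) := by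
  obtain ⟨C, hC, h⟩ := hΦ.exists_lintegral_comp_le
  refine ⟨C, hC, fun s hs F G => ?_⟩
  have mΦ : Measurable fun p => ‖Φ p‖ₑ ^ (1 / 2 : ℝ) :=
    hΦ.continuous.enorm.measurable.pow_const _
  have mF : Measurable fun x => ‖F x‖ₑ := (Lp.stronglyMeasurable F).measurable.enorm
  have mG : Measurable fun x => ‖G x‖ₑ := (Lp.stronglyMeasurable G).measurable.enorm
  have mFs : Measurable fun p : E × E => ‖F (p.1 + s • p.2)‖ₑ := mF.comp (by fun_prop)
  have mGs : Measurable fun p : E × E => ‖G (p.1 - s • p.2)‖ₑ := mG.comp (by fun_prop)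
  have half : ∀ z : ℝ≥0∞, z ^ (1 / 2 : ℝ) * z ^ (1 / 2 : ℝ) = z := fun z => by
    rw [← ENNReal.rpow_add_of_nonneg _ _ (by norm_num) (by norm_num)]
    norm_num
  have half2 : ∀ z : ℝ≥0∞, (z ^ (1 / 2 : ℝ)) ^ (2 : ℝ) = z := fun z => by
    rw [← ENNReal.rpow_mul]
    norm_num
  have cs := ENNReal.lintegral_mul_le_Lp_mul_Lq (volume : Measure (E × E))
    Real.HolderConjugate.two_two (mFs.mul mΦ).aemeasurable (mGs.mul mΦ).aemeasurable
  have b1 : ∫⁻ p : E × E, (‖F (p.1 + s • p.2)‖ₑ * ‖Φ p‖ₑ ^ (1 / 2 : ℝ)) ^ (2 : ℝ) ≤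
      C * ‖F‖ₑ ^ 2 := by
    rw [Lp.enorm_def, eLpNorm_two_sq]
    refine le_trans (le_of_eq (lintegral_congr fun p => ?_)) (h s hs _ (mF.pow_const 2))
    rw [ENNReal.mul_rpow_of_nonneg _ _ (by norm_num), half2, ENNReal.rpow_two]
  have b2 : ∫⁻ p : E × E, (‖G (p.1 - s • p.2)‖ₑ * ‖Φ p‖ₑ ^ (1 / 2 : ℝ)) ^ (2 : ℝ) ≤
      C * ‖G‖ₑ ^ 2 := by
    rw [Lp.enorm_def, eLpNorm_two_sq]
    refine le_trans (le_of_eq (lintegral_congr fun p => ?_)) (h (-s) (by rwa [abs_neg]) _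
      (mG.pow_const 2))
    rw [ENNReal.mul_rpow_of_nonneg _ _ (by norm_num), half2, ENNReal.rpow_two, neg_smul,
      ← sub_eq_add_neg]
  calc ∫⁻ p : E × E, ‖F (p.1 + s • p.2)‖ₑ * ‖G (p.1 - s • p.2)‖ₑ * ‖Φ p‖ₑ
      = ∫⁻ p : E × E, (‖F (p.1 + s • p.2)‖ₑ * ‖Φ p‖ₑ ^ (1 / 2 : ℝ)) *
          (‖G (p.1 - s • p.2)‖ₑ * ‖Φ p‖ₑ ^ (1 / 2 : ℝ)) := by
        refine lintegral_congr fun p => ?_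
        conv_lhs => rw [← half ‖Φ p‖ₑ]
        ring
    _ ≤ (C * ‖F‖ₑ ^ 2) ^ (1 / 2 : ℝ) * (C * ‖G‖ₑ ^ 2) ^ (1 / 2 : ℝ) :=
        cs.trans (mul_le_mul' (ENNReal.rpow_le_rpow b1 (by norm_num))
          (ENNReal.rpow_le_rpow b2 (by norm_num)))
    _ = _ := by
        rw [← ENNReal.mul_rpow_of_nonneg _ _ (by norm_num), show C * ‖F‖ₑ ^ 2 * (C * ‖G‖ₑ ^ 2) =
          (C * (‖F‖ₑ * ‖G‖ₑ)) ^ 2 by ring, ← ENNReal.rpow_natCast, ← ENNReal.rpow_mul]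
        norm_num

/-- The sesquilinear forms through which the Wigner transform acts on test functions. -/
def wignerForm (Φ : E × E → ℂ) (s : ℝ) (σ : E × E → ℂ) (F G : E → ℂ) : ℂ :=
  ∫ p : E × E, σ p * (F (p.1 + s • p.2) * (starRingEnd ℂ) (G (p.1 - s • p.2))) * Φ p

/-- Measurable functions of modulus at most one. -/
structure IsPhase (σ : E × E → ℂ) : Prop where
  measurable : Measurable σ
  norm_le : ∀ p, ‖σ p‖ ≤ 1

lemma wignerForm_congr_ae {Φ : E × E → ℂ} {s : ℝ} {σ : E × E → ℂ} {F F' G G' : E → ℂ}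
    (hF : F =ᵐ[volume] F') (hG : G =ᵐ[volume] G') :
    wignerForm Φ s σ F G = wignerForm Φ s σ F' G' := by
  refine integral_congr_ae ?_
  filter_upwards [(quasiMeasurePreserving_add_smul s).ae_eq_comp hF,
    (quasiMeasurePreserving_sub_smul s).ae_eq_comp hG] with p h1 h2
  simp only [Function.comp_apply] at h1 h2
  rw [h1, h2]

lemma IsKernel.integrable_form {Φ : E × E → ℂ} (hΦ : IsKernel Φ) {s : ℝ} (hs : |s| ≤ 1)
    {σ : E × E → ℂ} (hσ : IsPhase σ) (F G : WeightedL2) :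
    Integrable fun p : E × E =>
      σ p * (F (p.1 + s • p.2) * (starRingEnd ℂ) (G (p.1 - s • p.2))) * Φ p := by
  obtain ⟨C, hC, h⟩ := hΦ.exists_lintegral_mul_le
  have mF := (Lp.stronglyMeasurable F).measurable.comp
    (show Measurable fun p : E × E => p.1 + s • p.2 by fun_prop)
  have mG := (Lp.stronglyMeasurable G).measurable.comp
    (show Measurable fun p : E × E => p.1 - s • p.2 by fun_prop)
  refine ⟨((hσ.measurable.mul (mF.mul (Complex.continuous_conj.measurable.comp mG))).mul
    hΦ.continuous.measurable).aestronglyMeasurable, lt_of_le_of_lt (lintegral_mono fun p => ?_)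
    ((h s hs F G).trans_lt (ENNReal.mul_lt_top hC.lt_top (ENNReal.mul_lt_top enorm_lt_top
      enorm_lt_top)))⟩
  rw [enorm_mul, enorm_mul, enorm_mul, RCLike.enorm_conj]
  refine mul_le_mul_left (mul_le_of_le_one_left' ?_) _
  rw [← ofReal_norm]
  exact ENNReal.ofReal_le_one.2 (hσ.norm_le p)

lemma IsKernel.exists_norm_wignerForm_le {Φ : E × E → ℂ} (hΦ : IsKernel Φ) :
    ∃ C, 0 ≤ C ∧ ∀ s : ℝ, |s| ≤ 1 → ∀ σ, IsPhase σ → ∀ F G : WeightedL2,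
      ‖wignerForm Φ s σ F G‖ ≤ C * (‖F‖ * ‖G‖) := by
  obtain ⟨C, hC, h⟩ := hΦ.exists_lintegral_mul_le
  refine ⟨C.toReal, ENNReal.toReal_nonneg, fun s hs σ hσ F G => ?_⟩
  have h1 : ‖wignerForm Φ s σ F G‖ₑ ≤ C * (‖F‖ₑ * ‖G‖ₑ) := by
    refine (enorm_integral_le_lintegral_enorm _).trans ((lintegral_mono fun p => ?_).trans
      (h s hs F G))
    rw [enorm_mul, enorm_mul, enorm_mul, RCLike.enorm_conj]
    refine mul_le_mul_left (mul_le_of_le_one_left' ?_) _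
    rw [← ofReal_norm]
    exact ENNReal.ofReal_le_one.2 (hσ.norm_le p)
  have h2 := ENNReal.toReal_mono (ENNReal.mul_ne_top hC (ENNReal.mul_ne_top (by simp) (by simp))) h1
  simpa [ENNReal.toReal_mul] using h2

lemma coeFn_sub_ae (F F' : WeightedL2) :
    (F - F' : WeightedL2) =ᵐ[volume] fun x => F x - F' x :=
  volume_absolutelyContinuous_weightMeasure.ae_le (Lp.coeFn_sub F F')

lemma IsKernel.wignerForm_sub_left {Φ : E × E → ℂ} (hΦ : IsKernel Φ) {s : ℝ} (hs : |s| ≤ 1)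
    {σ : E × E → ℂ} (hσ : IsPhase σ) (F F' G : WeightedL2) :
    wignerForm Φ s σ (F - F' : WeightedL2) G = wignerForm Φ s σ F G - wignerForm Φ s σ F' G := by
  rw [wignerForm_congr_ae (coeFn_sub_ae F F') (ae_eq_refl _), wignerForm, wignerForm, wignerForm,
    ← integral_sub (hΦ.integrable_form hs hσ F G) (hΦ.integrable_form hs hσ F' G)]
  congr 1 with p
  ring

lemma IsKernel.wignerForm_sub_right {Φ : E × E → ℂ} (hΦ : IsKernel Φ) {s : ℝ} (hs : |s| ≤ 1)
    {σ : E × E → ℂ} (hσ : IsPhase σ) (F G G' : WeightedL2) :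
    wignerForm Φ s σ F (G - G' : WeightedL2) = wignerForm Φ s σ F G - wignerForm Φ s σ F G' := by
  rw [wignerForm_congr_ae (ae_eq_refl _) (coeFn_sub_ae G G'), wignerForm, wignerForm, wignerForm,
    ← integral_sub (hΦ.integrable_form hs hσ F G) (hΦ.integrable_form hs hσ F G')]
  congr 1 with p
  rw [map_sub]
  ring

/-! ### Riemann–Lebesgue for the difference of two distances -/

/-- The Riemann–Lebesgue lemma for a phase whose distribution is absolutely continuous. -/
lemma tendsto_integral_exp_phase_of_nonneg {X : Type*} [MeasurableSpace X] {m : Measure X}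
    {p : X → ℝ} (hp : Measurable p)
    (hnull : ∀ N, MeasurableSet N → volume N = 0 → m (p ⁻¹' N) = 0)
    {h : X → ℝ} (hh : Integrable h m) (h0 : ∀ x, 0 ≤ h x) {t : ℕ → ℝ}
    (ht : Tendsto t atTop (cocompact ℝ)) :
    Tendsto (fun k => ∫ x, Complex.exp (-Complex.I * ((t k * p x : ℝ) : ℂ)) * (h x : ℂ) ∂m)
      atTop (𝓝 0) := by
  set ρ := m.withDensity fun x => ENNReal.ofReal (h x) with hρ
  have : IsFiniteMeasure ρ := isFiniteMeasure_withDensity_ofReal hh.2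
  -- The oscillating integral over `X` is the Fourier transform of the image measure on the line.
  -- That measure is absolutely continuous, so the classical lemma applies to its density.
  set π := ρ.map p with hπ
  have hac : π ≪ volume := Measure.AbsolutelyContinuous.mk fun N hN hN0 => by
    rw [hπ, Measure.map_apply hp hN]
    exact withDensity_absolutelyContinuous _ _ (hnull N hN hN0)
  have hfin : IsFiniteMeasure π := Measure.isFiniteMeasure_map _ _
  have e : ∀ s : ℝ, ∫ x, Complex.exp (-Complex.I * ((s * p x : ℝ) : ℂ)) * (h x : ℂ) ∂m =
      ∫ v : ℝ, Real.fourierChar (-(v * (s / (2 * Real.pi)))) •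
        (((π.rnDeriv volume v).toReal : ℝ) : ℂ) := fun s => by
    have hexp : ∀ v : ℝ, (Real.fourierChar (-(v * (s / (2 * Real.pi)))) : ℂ) =
        Complex.exp (-Complex.I * ((s * v : ℝ) : ℂ)) := fun v => by
      rw [Real.fourierChar_apply]
      congr 1
      have : (Real.pi : ℂ) ≠ 0 := by exact_mod_cast Real.pi_ne_zero
      push_cast
      field_simp
    have h1 : ∫ v : ℝ, Real.fourierChar (-(v * (s / (2 * Real.pi)))) •
        (((π.rnDeriv volume v).toReal : ℝ) : ℂ) =
        ∫ v, Complex.exp (-Complex.I * ((s * v : ℝ) : ℂ)) ∂π := by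
      rw [← integral_rnDeriv_smul hac]
      congr 1 with v
      rw [Circle.smul_def, hexp, Complex.real_smul, smul_eq_mul, mul_comm]
    rw [h1, hπ, integral_map hp.aemeasurable (by fun_prop), hρ,
      integral_withDensity_eq_integral_toReal_smul₀ hh.aemeasurable.ennreal_ofReal
        (.of_forall fun _ => ENNReal.ofReal_lt_top)]
    congr 1 with x
    rw [ENNReal.toReal_ofReal (h0 x), Complex.real_smul, mul_comm]
  simp_rw [e]
  have hs : Tendsto (fun k => t k / (2 * Real.pi)) atTop (cocompact ℝ) := by
    have := (Homeomorph.mulRight₀ (2 * Real.pi)⁻¹ (by positivity)).isClosedEmbedding.tendsto_cocompact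
    simpa [div_eq_mul_inv, Function.comp_def] using this.comp ht
  exact (Real.tendsto_integral_exp_smul_cocompact
    (fun v => (((π.rnDeriv volume v).toReal : ℝ) : ℂ))).comp hs

lemma tendsto_integral_exp_phase {X : Type*} [MeasurableSpace X] {m : Measure X}
    {p : X → ℝ} (hp : Measurable p)
    (hnull : ∀ N, MeasurableSet N → volume N = 0 → m (p ⁻¹' N) = 0)
    {h : X → ℂ} (hh : Integrable h m) {t : ℕ → ℝ} (ht : Tendsto t atTop (cocompact ℝ)) :
    Tendsto (fun k => ∫ x, Complex.exp (-Complex.I * ((t k * p x : ℝ) : ℂ)) * h x ∂m)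
      atTop (𝓝 0) := by
  have hint : ∀ (s : ℝ) {g : X → ℂ}, Integrable g m →
      Integrable (fun x => Complex.exp (-Complex.I * ((s * p x : ℝ) : ℂ)) * g x) m :=
    fun s g hg => hg.bdd_mul (c := 1) (by fun_prop) (.of_forall fun x => by
      rw [neg_mul, ← mul_neg, ← Complex.ofReal_neg, norm_exp_I_mul])
  have hre : ∀ {g : X → ℝ}, Integrable g m → Tendsto (fun k => ∫ x,
      Complex.exp (-Complex.I * ((t k * p x : ℝ) : ℂ)) * (g x : ℂ) ∂m) atTop (𝓝 0) := fun {g} hg => by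
    have h1 := tendsto_integral_exp_phase_of_nonneg hp hnull hg.pos_part
      (fun x => le_max_right _ _) ht
    have h2 := tendsto_integral_exp_phase_of_nonneg hp hnull hg.neg_part
      (fun x => le_max_right _ _) ht
    have h3 := h1.sub h2
    rw [sub_zero] at h3
    refine h3.congr fun k => ?_
    have i1 : Integrable (fun x => ((max (g x) 0 : ℝ) : ℂ)) m := hg.pos_part.ofReal
    have i2 : Integrable (fun x => ((max (-g x) 0 : ℝ) : ℂ)) m := hg.neg_part.ofReal
    rw [← integral_sub (hint _ i1) (hint _ i2)]
    congr 1 with x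
    rw [← mul_sub, ← Complex.ofReal_sub, max_zero_sub_max_neg_zero_eq_self]
  have h3 := (hre hh.re).add ((hre hh.im).mul_const Complex.I)
  rw [zero_mul, add_zero] at h3
  refine h3.congr fun k => ?_
  have i1 : Integrable (fun x => ((RCLike.re (h x) : ℝ) : ℂ)) m := hh.re.ofReal
  have i2 : Integrable (fun x => ((RCLike.im (h x) : ℝ) : ℂ)) m := hh.im.ofReal
  rw [← integral_mul_const, ← integral_add (hint _ i1) ((hint _ i2).mul_const _)]
  congr 1 with x
  conv_rhs => rw [← Complex.re_add_im (h x)]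
  simp only [RCLike.re_to_complex, RCLike.im_to_complex]
  ring

/-- The integral of `f'` over `f⁻¹(N)` is the measure of a subset of `N`, hence zero, while `f' >
0`. -/
lemma volume_preimage_eq_zero_of_deriv_pos {f : ℝ → ℝ} (hf : Differentiable ℝ f)
    (hpos : ∀ t, 0 < deriv f t) {N : Set ℝ} (hN : MeasurableSet N) (h0 : volume N = 0) :
    volume (f ⁻¹' N) = 0 := by
  have hS : MeasurableSet (f ⁻¹' N) := hf.continuous.measurable hN
  have h1 := lintegral_deriv_eq_volume_image_of_monotoneOn hS
    (fun t _ => (hf t).hasDerivAt.hasDerivWithinAt)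
    ((strictMono_of_deriv_pos hpos).monotone.monotoneOn _)
  have h2 : volume (f '' (f ⁻¹' N)) = 0 := measure_mono_null (Set.image_preimage_subset f N) h0
  rw [h2, lintegral_eq_zero_iff (measurable_deriv f).ennreal_ofReal] at h1
  rw [← Measure.restrict_eq_zero, ← ae_eq_bot, ← eventually_false_iff_eq_bot]
  filter_upwards [h1] with t ht
  simp only [Pi.zero_apply, ENNReal.ofReal_eq_zero] at ht
  exact absurd (hpos t) (not_lt.2 ht)

lemma hasDerivAt_norm_line {x q : E} {t : ℝ} (h : x + t • q ≠ 0) :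
    HasDerivAt (fun t : ℝ => ‖x + t • q‖) (‖x + t • q‖⁻¹ * inner ℝ (x + t • q) q) t := by
  have h1 : HasDerivAt (fun t : ℝ => x + t • q) q t := by
    simpa using ((hasDerivAt_id t).smul_const q).const_add x
  have h2 := (h1.norm_sq).sqrt (by positivity)
  simp only [Real.sqrt_sq (norm_nonneg _)] at h2
  convert h2 using 1
  field_simp

/-- With `a = x + tq` and `b = a - q` the derivative is `(|a| + |b|)(|a||b| - a·b)/(|a||b|)`. It is
positive by strict Cauchy–Schwarz: were `a` and `b` positively parallel, `x` would lie on the line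
through `0` and `q`. -/
lemma deriv_norm_sub_norm_line_pos {x q : E} (hq : q ≠ 0) (hx : x ∉ Submodule.span ℝ {q}) (t : ℝ) :
    DifferentiableAt ℝ (fun t : ℝ => ‖x + t • q‖ - ‖x + t • q - q‖) t ∧
    0 < deriv (fun t : ℝ => ‖x + t • q‖ - ‖x + t • q - q‖) t := by
  have key : ∀ s : ℝ, x + s • q ∉ Submodule.span ℝ {q} := fun s h => hx <| by
    have := Submodule.sub_mem _ h (Submodule.smul_mem _ s (Submodule.mem_span_singleton_self q))
    simpa using this
  have hne : ∀ s : ℝ, x + s • q ≠ 0 := fun s h => key s (h ▸ Submodule.zero_mem _)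
  have hq' : ∀ s : ℝ, x + s • q - q = (x - q) + s • q := fun s => by abel
  have hb : x + t • q - q ≠ 0 := by
    have := hne (t - 1)
    rwa [sub_smul, one_smul, ← add_sub_assoc] at this
  have hd := (hasDerivAt_norm_line (hne t)).sub
    (hasDerivAt_norm_line (x := x - q) (q := q) (t := t) (by rwa [← hq']))
  simp only [← hq'] at hd
  have hd' : HasDerivAt (fun t : ℝ => ‖x + t • q‖ - ‖x + t • q - q‖) _ t := hd
  refine ⟨hd'.differentiableAt, ?_⟩
  rw [hd'.deriv]
  set a := x + t • q with ha
  have ha0 : a ≠ 0 := hne t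
  have hap := norm_pos_iff.2 ha0
  have hbp := norm_pos_iff.2 hb
  have cs : inner ℝ a (a - q) < ‖a‖ * ‖a - q‖ := by
    rw [inner_lt_norm_mul_iff_real]
    intro h
    rw [smul_sub] at h
    have h1 : (‖a‖ - ‖a - q‖) • a = ‖a‖ • q := by
      rw [sub_smul, h]; abel
    by_cases hz : ‖a‖ - ‖a - q‖ = 0
    · rw [hz, zero_smul] at h1
      exact hq ((smul_eq_zero.1 h1.symm).resolve_left hap.ne')
    · refine key t (Submodule.mem_span_singleton.2 ⟨(‖a‖ - ‖a - q‖)⁻¹ * ‖a‖, ?_⟩)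
      rw [mul_smul, ← h1, inv_smul_smul₀ hz]
  set b := a - q with hbdef
  have hqab : q = a - b := by rw [hbdef]; abel
  have e1 : inner ℝ a q = ‖a‖ ^ 2 - inner ℝ a b := by
    rw [hqab, inner_sub_right a a b, real_inner_self_eq_norm_sq]
  have e2 : inner ℝ b q = inner ℝ a b - ‖b‖ ^ 2 := by
    rw [hqab, inner_sub_right b a b, real_inner_self_eq_norm_sq, real_inner_comm a b]
  rw [e1, e2]
  have : ‖a‖⁻¹ * (‖a‖ ^ 2 - inner ℝ a b) - ‖b‖⁻¹ * (inner ℝ a b - ‖b‖ ^ 2) =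
      (‖a‖ + ‖b‖) * (‖a‖ * ‖b‖)⁻¹ * (‖a‖ * ‖b‖ - inner ℝ a b) := by
    field_simp
    ring
  rw [this]
  have := sub_pos.2 cs
  positivity

/-- The difference of the distances to two points has an absolutely continuous distribution. -/
lemma volume_preimage_norm_sub_norm {q : E} (hq : q ≠ 0) {N : Set ℝ} (hN : MeasurableSet N)
    (h0 : volume N = 0) : volume ((fun x : E => ‖x‖ - ‖x - q‖) ⁻¹' N) = 0 := by
  set A := (fun x : E => ‖x‖ - ‖x - q‖) ⁻¹' N with hA
  have hAm : MeasurableSet A := (by fun_prop : Measurable fun x : E => ‖x‖ - ‖x - q‖) hN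
  have hm : Measurable fun z : E × ℝ => z.1 + z.2 • q := by fun_prop
  have hspan : volume (Submodule.span ℝ {q} : Set E) = 0 := by
    refine Measure.addHaar_submodule _ _ fun h => ?_
    have h1 := finrank_span_singleton (K := ℝ) hq
    rw [h, finrank_top, finrank_euclideanSpace, Fintype.card_fin] at h1
    omega
  -- Fubini for the shear `(x, t) ↦ x + t q`. For almost every `x` the slice in `t` is null by
  -- monotonicity along the line, whereas for every `t` the slice in `x` is a translate of `A`.
  -- Hence `|A| · ∞ = 0`.
  have hB : (volume.prod volume : Measure (E × ℝ)) ((fun z : E × ℝ => z.1 + z.2 • q) ⁻¹' A) = 0 := by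
    rw [Measure.measure_prod_null (hm hAm)]
    have : ∀ᵐ x : E, x ∉ (Submodule.span ℝ {q} : Set E) := by
      rw [ae_iff]; simpa using hspan
    filter_upwards [this] with x hx
    have hd := deriv_norm_sub_norm_line_pos hq hx
    exact volume_preimage_eq_zero_of_deriv_pos (fun t => (hd t).1) (fun t => (hd t).2) hN h0
  rw [Measure.prod_apply_symm (hm hAm)] at hB
  have h2 : ∀ t : ℝ, volume ((fun x : E => (x, t)) ⁻¹' ((fun z : E × ℝ => z.1 + z.2 • q) ⁻¹' A)) =
      volume A := fun t => by
    simpa only [Set.preimage_preimage] using measure_preimage_add_right volume (t • q) A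
  simp only [h2, lintegral_const, Real.volume_univ] at hB
  simpa using hB

/-! ### Limits of the diagonal and cross forms -/

/-- Convergence of uniformly bounded biadditive forms extends from a dense set, and allows for
converging arguments. -/
lemma tendsto_form_of_dense {H : Type*} [NormedAddCommGroup H] {B : ℕ → H → H → ℂ}
    {B' : H → H → ℂ} {C : ℝ}
    (hB : ∀ k F G, ‖B k F G‖ ≤ C * (‖F‖ * ‖G‖)) (hB' : ∀ F G, ‖B' F G‖ ≤ C * (‖F‖ * ‖G‖))
    (hl : ∀ k F F' G, B k (F - F') G = B k F G - B k F' G)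
    (hr : ∀ k F G G', B k F (G - G') = B k F G - B k F G')
    (hl' : ∀ F F' G, B' (F - F') G = B' F G - B' F' G)
    (hr' : ∀ F G G', B' F (G - G') = B' F G - B' F G')
    {D : Set H} (hD : Dense D)
    (h : ∀ F ∈ D, ∀ G ∈ D, Tendsto (fun k => B k F G) atTop (𝓝 (B' F G)))
    {F G : ℕ → H} {F₀ G₀ : H} (hF : Tendsto F atTop (𝓝 F₀)) (hG : Tendsto G atTop (𝓝 G₀)) :
    Tendsto (fun k => B k (F k) (G k)) atTop (𝓝 (B' F₀ G₀)) := by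
  have key : ∀ b : H → H → ℂ, (∀ F G, ‖b F G‖ ≤ C * (‖F‖ * ‖G‖)) →
      (∀ F F' G, b (F - F') G = b F G - b F' G) → (∀ F G G', b F (G - G') = b F G - b F G') →
      ∀ F F' G G', ‖b F G - b F' G'‖ ≤ C * (‖F - F'‖ * ‖G‖) + C * (‖F'‖ * ‖G - G'‖) :=
    fun b hb h1 h2 F F' G G' => by
      have : b F G - b F' G' = b (F - F') G + b F' (G - G') := by rw [h1, h2]; ring
      rw [this]
      exact (norm_add_le _ _).trans (add_le_add (hb _ _) (hb _ _))
  refine Metric.tendsto_nhds.2 fun η hη => ?_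
  have ho : IsOpen {p : H × H | C * (‖F₀ - p.1‖ * ‖G₀‖) + C * (‖p.1‖ * ‖G₀ - p.2‖) < η / 4} :=
    isOpen_lt (by fun_prop) continuous_const
  obtain ⟨⟨F', G'⟩, ⟨hF', hG'⟩, hmem⟩ := (hD.prod hD).exists_mem_open ho
    ⟨(F₀, G₀), by simpa using hη⟩
  simp only [Set.mem_ofPred_eq] at hmem
  have h1 : Tendsto (fun k => C * (‖F k - F₀‖ * ‖G k‖) + C * (‖F₀‖ * ‖G k - G₀‖)) atTop (𝓝 0) := by
    have := (((hF.sub_const F₀).norm.mul hG.norm).const_mul C).add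
      (((hG.sub_const G₀).norm.const_mul ‖F₀‖).const_mul C)
    simpa using this
  filter_upwards [h1.eventually_lt_const (by positivity : 0 < η / 4),
    Metric.tendsto_nhds.1 (h F' hF' G' hG') (η / 4) (by positivity)] with k e1 e2
  rw [dist_eq_norm] at e2 ⊢
  have a1 := key (B k) (hB k) (hl k) (hr k) (F k) F₀ (G k) G₀
  have a2 := key (B k) (hB k) (hl k) (hr k) F₀ F' G₀ G'
  have a3 := key B' hB' hl' hr' F₀ F' G₀ G'
  rw [norm_sub_rev] at a3
  have : B k (F k) (G k) - B' F₀ G₀ = (B k (F k) (G k) - B k F₀ G₀) + (B k F₀ G₀ - B k F' G') +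
    (B k F' G' - B' F' G') + (B' F' G' - B' F₀ G₀) := by ring
  rw [this]
  refine lt_of_le_of_lt (norm_add_le _ _ |>.trans (add_le_add_left (norm_add_le _ _ |>.trans
    (add_le_add_left (norm_add_le _ _) _)) _)) ?_
  linarith

lemma dense_continuous_compactSupport : Dense {F : WeightedL2 | ∃ f : E → ℂ, Continuous f ∧
    HasCompactSupport f ∧ F =ᵐ[volume] f} := by
  have : IsFiniteMeasureOnCompacts (weightMeasure 1) :=
    ⟨fun K hK => (weightMeasure_le_volume le_rfl K).trans_lt hK.measure_lt_top⟩
  refine Metric.dense_iff.2 fun F r hr => ?_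
  obtain ⟨g, h1, h2, h3, h4⟩ := (Lp.memLp F).exists_hasCompactSupport_eLpNorm_sub_le (by simp)
    (ε := ENNReal.ofReal (r / 2)) (by simpa using hr)
  refine ⟨h4.toLp g, ?_, g, h3, h1,
    volume_absolutelyContinuous_weightMeasure.ae_le h4.coeFn_toLp⟩
  rw [Metric.mem_ball, dist_comm, dist_eq_norm, Lp.norm_def]
  refine lt_of_le_of_lt (b := r / 2) ?_ (by linarith)
  refine ENNReal.toReal_le_of_le_ofReal (by positivity) (le_trans (le_of_eq ?_) h2)
  refine eLpNorm_congr_ae ?_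
  filter_upwards [Lp.coeFn_sub F (h4.toLp g), h4.coeFn_toLp] with x e1 e2
  rw [e1, Pi.sub_apply, Pi.sub_apply, e2]

/-- The oscillating factor produced by the product of an outgoing wave from `q` and the conjugate
of an outgoing wave from `r`. -/
def phase (ε : ℝ) (q r : E) (p : E × E) : ℂ :=
  Complex.exp (-Complex.I *
    (((‖p.1 + (ε / 2) • p.2 - q‖ - ‖p.1 - (ε / 2) • p.2 - r‖) / ε : ℝ) : ℂ))

/-- The slowly varying part of `phase` in the limit of vanishing `ε`. -/
def limitPhase (q r : E) (p : E × E) : ℂ :=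
  Complex.exp (-Complex.I * ((‖p.1 - q‖⁻¹ * inner ℝ (p.1 - q) ((1 / 2 : ℝ) • p.2) +
    ‖p.1 - r‖⁻¹ * inner ℝ (p.1 - r) ((1 / 2 : ℝ) • p.2) : ℝ) : ℂ))

lemma norm_exp_neg_I_mul (r : ℝ) : ‖Complex.exp (-Complex.I * r)‖ = 1 := by
  rw [neg_mul, ← mul_neg, ← Complex.ofReal_neg, norm_exp_I_mul]

lemma isPhase_phase (ε : ℝ) (q r : E) : IsPhase (phase ε q r) :=
  ⟨by unfold phase; fun_prop, fun p => (norm_exp_neg_I_mul _).le⟩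

lemma isPhase_limitPhase (q r : E) : IsPhase (limitPhase q r) :=
  ⟨by unfold limitPhase; fun_prop, fun p => (norm_exp_neg_I_mul _).le⟩

/-- First-order expansion of the two distances around `x`. The prefactor removes the fast phase `(|x
- q| - |x - r|)/ε`, which is absent exactly when the two centres coincide. -/
lemma tendsto_phase {q r x : E} (y : E) (hq : x ≠ q) (hr : x ≠ r) {e : ℕ → ℝ}
    (he : ∀ k, 0 < e k) (h0 : Tendsto e atTop (𝓝 0)) :
    Tendsto (fun k => Complex.exp (Complex.I * (((e k)⁻¹ * (‖x - q‖ - ‖x - r‖) : ℝ) : ℂ)) *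
      phase (e k) q r (x, y)) atTop (𝓝 (limitPhase q r (x, y))) := by
  have h1 := tendsto_norm_sub_norm_sub_div (sub_ne_zero.2 hq) ((-(1 / 2) : ℝ) • y) he h0
  have h2 := tendsto_norm_sub_norm_sub_div (sub_ne_zero.2 hr) ((1 / 2 : ℝ) • y) he h0
  have h3 : Tendsto (fun k => Complex.exp (-Complex.I * ((-((‖x - q‖ - ‖e k • (-(1 / 2) : ℝ) • y -
      (x - q)‖) / e k) + (‖x - r‖ - ‖e k • (1 / 2 : ℝ) • y - (x - r)‖) / e k : ℝ) : ℂ))) atTop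
      (𝓝 (limitPhase q r (x, y))) := by
    refine (Complex.continuous_exp.tendsto _).comp ((Complex.continuous_ofReal.tendsto _).comp
      ?_ |>.const_mul _)
    have := h1.neg.add h2
    rw [neg_smul, inner_neg_right, mul_neg, neg_neg] at this
    simpa only [neg_smul, one_div] using this
  refine h3.congr fun k => ?_
  rw [phase, ← Complex.exp_add]
  congr 1
  have e1 : ‖e k • (-(1 / 2) : ℝ) • y - (x - q)‖ = ‖x + (e k / 2) • y - q‖ := by
    rw [← norm_neg]
    congr 1
    rw [smul_smul]
    module
  have e2 : ‖e k • (1 / 2 : ℝ) • y - (x - r)‖ = ‖x - (e k / 2) • y - r‖ := by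
    rw [← norm_neg]
    congr 1
    rw [smul_smul]
    module
  rw [e1, e2]
  have := (he k).ne'
  push_cast
  field_simp
  ring

lemma IsKernel.integrable {Φ : E × E → ℂ} (hΦ : IsKernel Φ) : Integrable Φ := by
  obtain ⟨D, K, hD, hK, hdec, hsupp⟩ := hΦ.decay
  have h1 : Integrable ((closedBall (0 : E) K).indicator fun _ => D) :=
    (integrableOn_const measure_closedBall_lt_top.ne).integrable_indicator measurableSet_closedBall
  refine (h1.mul_prod integrable_inv_one_add_norm_pow_four).mono'
    hΦ.continuous.aestronglyMeasurable (.of_forall fun p => ?_)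
  by_cases hp : p.1 ∈ closedBall (0 : E) K
  · rw [Set.indicator_of_mem hp]
    refine (hdec p.1 p.2).trans ?_
    gcongr
    · linarith [norm_nonneg p.2]
    · norm_num
  · rw [mem_closedBall_zero_iff, not_le] at hp
    rw [hsupp p.1 p.2 hp, norm_zero]
    have : 0 ≤ (closedBall (0 : E) K).indicator (fun _ => D) p.1 :=
      Set.indicator_nonneg (fun _ _ => hD) _
    positivity

lemma ae_fst_ne (q : E) : ∀ᵐ p : E × E, p.1 ≠ q :=
  Measure.quasiMeasurePreserving_fst.ae (Measure.ae_ne volume q)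

/-- For continuous amplitudes, only the fast part of the phase remains in the limit. -/
lemma tendsto_wignerForm_sub {Φ : E × E → ℂ} (hΦ : IsKernel Φ) (q r : E) {f g : E → ℂ}
    (hf : Continuous f) (hf' : HasCompactSupport f) (hg : Continuous g) (hg' : HasCompactSupport g)
    {e : ℕ → ℝ} (he : ∀ k, 0 < e k) (h0 : Tendsto e atTop (𝓝 0)) :
    Tendsto (fun k => wignerForm Φ (e k / 2) (phase (e k) q r) f g -
      ∫ p : E × E, Complex.exp (-Complex.I * (((e k)⁻¹ * (‖p.1 - q‖ - ‖p.1 - r‖) : ℝ) : ℂ)) *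
        (limitPhase q r p * (f p.1 * (starRingEnd ℂ) (g p.1)) * Φ p)) atTop (𝓝 0) := by
  obtain ⟨M, hM⟩ := hf'.exists_bound_of_continuous hf
  obtain ⟨L, hL⟩ := hg'.exists_bound_of_continuous hg
  have hM0 : 0 ≤ M := (norm_nonneg _).trans (hM 0)
  have hΦi := hΦ.integrable
  have mΦ := hΦ.continuous.measurable
  have mf := hf.measurable
  have mg := hg.measurable
  have bd : ∀ (σ : E × E → ℂ) (_ : IsPhase σ) (s : ℝ) (p : E × E),
      ‖σ p * (f (p.1 + s • p.2) * (starRingEnd ℂ) (g (p.1 - s • p.2))) * Φ p‖ ≤ M * L * ‖Φ p‖ :=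
    fun σ hσ s p => by
      rw [norm_mul, norm_mul, norm_mul, RCLike.norm_conj]
      refine mul_le_mul_of_nonneg_right ?_ (norm_nonneg _)
      exact (mul_le_of_le_one_left (by positivity) (hσ.norm_le p)).trans
        (mul_le_mul (hM _) (hL _) (norm_nonneg _) hM0)
  have hint : ∀ (σ : E × E → ℂ) (_ : IsPhase σ) (s : ℝ), Integrable fun p : E × E =>
      σ p * (f (p.1 + s • p.2) * (starRingEnd ℂ) (g (p.1 - s • p.2))) * Φ p := fun σ hσ s => by
    refine (hΦi.norm.const_mul (M * L)).mono' ?_ (.of_forall (bd σ hσ s))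
    have := hσ.measurable
    have hc := Complex.continuous_conj.measurable
    exact Measurable.aestronglyMeasurable (by fun_prop)
  have hint0 : ∀ k, Integrable fun p : E × E =>
      Complex.exp (-Complex.I * (((e k)⁻¹ * (‖p.1 - q‖ - ‖p.1 - r‖) : ℝ) : ℂ)) *
        (limitPhase q r p * (f p.1 * (starRingEnd ℂ) (g p.1)) * Φ p) := fun k => by
    have h1 := hint _ (isPhase_limitPhase q r) 0
    simp only [zero_smul, add_zero, sub_zero] at h1
    exact h1.bdd_mul (c := 1) (Continuous.aestronglyMeasurable (by fun_prop))
      (.of_forall fun p => (norm_exp_neg_I_mul _).le)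
  simp only [wignerForm]
  simp_rw [← integral_sub (hint _ (isPhase_phase _ q r) _) (hint0 _)]
  rw [← integral_zero (E × E) ℂ]
  refine tendsto_integral_of_dominated_convergence (fun p => M * L * ‖Φ p‖ + M * L * ‖Φ p‖)
    (fun k => ((hint _ (isPhase_phase _ q r) _).sub (hint0 _)).aestronglyMeasurable)
    ((hΦi.norm.const_mul _).add (hΦi.norm.const_mul _)) (fun k => .of_forall fun p => ?_) ?_
  · refine (norm_sub_le _ _).trans (add_le_add (bd _ (isPhase_phase _ q r) _ p) ?_)
    rw [norm_mul, norm_exp_neg_I_mul, one_mul]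
    simpa using bd _ (isPhase_limitPhase q r) 0 p
  · filter_upwards [ae_fst_ne q, ae_fst_ne r] with p hq hr
    have hs : Tendsto (fun k => e k / 2) atTop (𝓝 0) := by simpa using h0.div_const 2
    have t1 := tendsto_phase p.2 hq hr he h0
    have t2 : Tendsto (fun k => f (p.1 + (e k / 2) • p.2)) atTop (𝓝 (f p.1)) := by
      refine (hf.tendsto _).comp ?_
      simpa using (hs.smul_const p.2).const_add p.1
    have t3 : Tendsto (fun k => g (p.1 - (e k / 2) • p.2)) atTop (𝓝 (g p.1)) := by
      refine (hg.tendsto _).comp ?_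
      simpa using (hs.smul_const p.2).const_sub p.1
    have t4 := (t1.mul (t2.mul ((Complex.continuous_conj.tendsto _).comp t3))).mul_const (Φ p)
    have t5 := tendsto_iff_norm_sub_tendsto_zero.1 t4
    refine tendsto_zero_iff_norm_tendsto_zero.2 (t5.congr fun k => ?_)
    -- Multiplying by the unimodular fast factor does not change the norm, and it moves that factor
    -- from the phase to the limit term.
    rw [← one_mul ‖_ - _‖, ← norm_exp_neg_I_mul ((e k)⁻¹ * (‖p.1 - q‖ - ‖p.1 - r‖)), ← norm_mul]
    congr 1
    have hE : Complex.exp (-Complex.I * (((e k)⁻¹ * (‖p.1 - q‖ - ‖p.1 - r‖) : ℝ) : ℂ)) *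
        Complex.exp (Complex.I * (((e k)⁻¹ * (‖p.1 - q‖ - ‖p.1 - r‖) : ℝ) : ℂ)) = 1 := by
      rw [← Complex.exp_add, neg_mul, neg_add_cancel, Complex.exp_zero]
    simp only [Function.comp_apply]
    linear_combination (phase (e k) q r p * (f (p.1 + (e k / 2) • p.2) *
      (starRingEnd ℂ) (g (p.1 - (e k / 2) • p.2))) * Φ p) * hE

/-- Convergence of the forms with matching phases. -/
lemma tendsto_wignerForm_diag {Φ : E × E → ℂ} (hΦ : IsKernel Φ) (q : E) {e : ℕ → ℝ}
    (he : ∀ k, 0 < e k) (he1 : ∀ k, e k ≤ 1) (h0 : Tendsto e atTop (𝓝 0))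
    {F G : ℕ → WeightedL2} {F₀ G₀ : WeightedL2} (hF : Tendsto F atTop (𝓝 F₀))
    (hG : Tendsto G atTop (𝓝 G₀)) :
    Tendsto (fun k => wignerForm Φ (e k / 2) (phase (e k) q q) (F k) (G k)) atTop
      (𝓝 (wignerForm Φ 0 (limitPhase q q) F₀ G₀)) := by
  obtain ⟨C, hC, hb⟩ := hΦ.exists_norm_wignerForm_le
  have hs : ∀ k, |e k / 2| ≤ 1 := fun k => by
    rw [abs_of_pos (half_pos (he k))]; linarith [he1 k]
  have hs0 : |(0 : ℝ)| ≤ 1 := by simp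
  refine tendsto_form_of_dense (fun k => hb _ (hs k) _ (isPhase_phase _ q q))
    (hb 0 hs0 _ (isPhase_limitPhase q q)) (fun k => hΦ.wignerForm_sub_left (hs k) (isPhase_phase _ q q))
    (fun k => hΦ.wignerForm_sub_right (hs k) (isPhase_phase _ q q))
    (hΦ.wignerForm_sub_left hs0 (isPhase_limitPhase q q))
    (hΦ.wignerForm_sub_right hs0 (isPhase_limitPhase q q)) dense_continuous_compactSupport
    ?_ hF hG
  rintro F ⟨f, hf, hf', hFf⟩ G ⟨g, hg, hg', hGg⟩
  simp only [wignerForm_congr_ae hFf hGg]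
  have h := tendsto_wignerForm_sub hΦ q q hf hf' hg hg' he h0
  simp only [sub_self, mul_zero, Complex.ofReal_zero, Complex.exp_zero, one_mul] at h
  have h2 := h.add_const (wignerForm Φ 0 (limitPhase q q) f g)
  simpa [wignerForm] using h2

/-- The forms with different phases vanish in the limit. -/
lemma tendsto_wignerForm_of_ne {Φ : E × E → ℂ} (hΦ : IsKernel Φ) {q r : E} (hqr : q ≠ r)
    {e : ℕ → ℝ} (he : ∀ k, 0 < e k) (he1 : ∀ k, e k ≤ 1) (h0 : Tendsto e atTop (𝓝 0))
    {F G : ℕ → WeightedL2} {F₀ G₀ : WeightedL2} (hF : Tendsto F atTop (𝓝 F₀))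
    (hG : Tendsto G atTop (𝓝 G₀)) :
    Tendsto (fun k => wignerForm Φ (e k / 2) (phase (e k) q r) (F k) (G k)) atTop (𝓝 0) := by
  obtain ⟨C, hC, hb⟩ := hΦ.exists_norm_wignerForm_le
  have hs : ∀ k, |e k / 2| ≤ 1 := fun k => by
    rw [abs_of_pos (half_pos (he k))]; linarith [he1 k]
  refine tendsto_form_of_dense (B' := fun _ _ => 0)
    (fun k => hb _ (hs k) _ (isPhase_phase _ q r)) (fun _ _ => by rw [norm_zero]; positivity)
    (fun k => hΦ.wignerForm_sub_left (hs k) (isPhase_phase _ q r))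
    (fun k => hΦ.wignerForm_sub_right (hs k) (isPhase_phase _ q r))
    (by simp) (by simp) dense_continuous_compactSupport ?_ hF hG
  rintro F ⟨f, hf, hf', hFf⟩ G ⟨g, hg, hg', hGg⟩
  simp only [wignerForm_congr_ae hFf hGg]
  have h := tendsto_wignerForm_sub hΦ q r hf hf' hg hg' he h0
  have hnull : ∀ N : Set ℝ, MeasurableSet N → volume N = 0 →
      (volume : Measure (E × E)) ((fun p => ‖p.1 - q‖ - ‖p.1 - r‖) ⁻¹' N) = 0 := fun N hN hN0 => by
    have h1 := volume_preimage_norm_sub_norm (sub_ne_zero.2 hqr.symm) hN hN0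
    have h2 : volume ((fun x : E => ‖x - q‖ - ‖x - r‖) ⁻¹' N) = 0 := by
      rw [← measure_preimage_add_right volume q] 
      simpa [Set.preimage_preimage, sub_sub_eq_add_sub] using h1
    exact Measure.quasiMeasurePreserving_fst.preimage_null h2
  obtain ⟨M, hM⟩ := hf'.exists_bound_of_continuous hf
  obtain ⟨L, hL⟩ := hg'.exists_bound_of_continuous hg
  have hi : Integrable fun p : E × E =>
      limitPhase q r p * (f p.1 * (starRingEnd ℂ) (g p.1)) * Φ p := by
    refine hΦ.integrable.bdd_mul (c := 1 * (M * L)) ?_ (.of_forall fun p => ?_)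
    · have := (isPhase_limitPhase q r).measurable
      have mf := hf.measurable
      have mg := hg.measurable
      have hc := Complex.continuous_conj.measurable
      exact Measurable.aestronglyMeasurable (by fun_prop)
    · rw [norm_mul, norm_mul, RCLike.norm_conj]
      have := (isPhase_limitPhase q r).norm_le p
      have h1 := hM p.1
      have h2 := hL p.1
      have h3 : 0 ≤ M := (norm_nonneg _).trans h1
      gcongr
  have ht : Tendsto (fun k => (e k)⁻¹) atTop (cocompact ℝ) :=
    (tendsto_inv_nhdsGT_zero.comp (tendsto_nhdsWithin_iff.2 ⟨h0, .of_forall he⟩)).mono_right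
      atTop_le_cocompact
  have h3 := tendsto_integral_exp_phase (p := fun p : E × E => ‖p.1 - q‖ - ‖p.1 - r‖)
    (by fun_prop) hnull hi ht
  simpa using h.add h3

/-! ### The Wigner transform as a sesquilinear form -/

lemma wt_add_le (z q : E) : wt 1 (z + q) ≤ 2 * (1 + ‖q‖) * wt 1 z := by
  unfold wt
  have h1 : 0 < 1 + ‖z‖ ^ 2 := by positivity
  have h2 : 0 < 1 + ‖z + q‖ ^ 2 := by positivity
  have h3 : 0 ≤ ‖q‖ := norm_nonneg q
  have h4 : ‖z‖ ≤ ‖z + q‖ + ‖q‖ := by simpa using norm_sub_le (z + q) q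
  rw [one_pow, ← div_eq_mul_inv, inv_eq_one_div, div_le_div_iff₀ (by positivity) (by positivity),
    one_mul]
  refine Real.sqrt_le_iff.2 ⟨by positivity, ?_⟩
  rw [mul_pow, Real.sq_sqrt h2.le]
  nlinarith [norm_nonneg z, norm_nonneg (z + q), sq_nonneg (‖z + q‖ - ‖q‖),
    mul_nonneg h3 (sq_nonneg ‖z + q‖), mul_nonneg (sq_nonneg ‖q‖) (sq_nonneg ‖z + q‖)]

/-- Weights at `z` and `z + q` are comparable, so the wave centred at `q` can be measured in the
same space as the one centred at the origin. -/
lemma exists_eLpNorm_comp_sub_le (q : E) :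
    ∃ C : ℝ≥0∞, C ≠ ⊤ ∧ ∀ f : E → ℂ, AEStronglyMeasurable f volume →
      eLpNorm (fun x => f (x - q)) 2 (weightMeasure 1) ≤ C * eLpNorm f 2 (weightMeasure 1) := by
  refine ⟨ENNReal.ofReal ((2 * (1 + ‖q‖)) ^ 3) ^ (1 / 2 : ℝ),
    ENNReal.rpow_ne_top_of_nonneg (by norm_num) ENNReal.ofReal_ne_top, fun f hf => ?_⟩
  have m : AEMeasurable (fun x => ‖f x‖ₑ ^ 2) volume := hf.enorm.pow_const 2
  have m' : AEMeasurable (fun x => ‖f (x - q)‖ₑ ^ 2) volume :=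
    m.comp_quasiMeasurePreserving (measurePreserving_sub_right volume q).quasiMeasurePreserving
  rw [eLpNorm_two_eq, eLpNorm_two_eq, ← ENNReal.mul_rpow_of_nonneg _ _ (by norm_num),
    lintegral_weightMeasure one_pos m', lintegral_weightMeasure one_pos m,
    ← lintegral_const_mul'' (f := fun x => ENNReal.ofReal (1 ^ 2 * wt 1 x ^ 3) * ‖f x‖ₑ ^ 2) _
      ((measurable_weight one_pos).aemeasurable.mul m)]
  refine ENNReal.rpow_le_rpow ?_ (by norm_num)
  rw [← lintegral_add_right_eq_self (μ := (volume : Measure E)) _ q]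
  refine lintegral_mono fun z => ?_
  rw [add_sub_cancel_right, ← mul_assoc, ← ENNReal.ofReal_mul (by positivity)]
  refine mul_le_mul_left (ENNReal.ofReal_le_ofReal ?_) _
  have h0 := (wt_pos one_pos (z + q)).le
  calc 1 ^ 2 * wt 1 (z + q) ^ 3 ≤ 1 ^ 2 * (2 * (1 + ‖q‖) * wt 1 z) ^ 3 := by
        gcongr; exact wt_add_le z q
    _ = _ := by ring

lemma integrable_shift_mul_shift {u : E → ℂ} (hu : MemLp u 2 volume) {s : ℝ} (hs : s ≠ 0) (x : E) :
    Integrable fun y : E => u (x + s • y) * (starRingEnd ℂ) (u (x - s • y)) := by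
  have h1 : MemLp (fun y : E => u (x + s • y)) 2 volume :=
    memLp_comp_smul (hu.comp_measurePreserving (measurePreserving_add_left volume x)) hs
  have h2 : MemLp (fun y : E => u (x - s • y)) 2 volume :=
    memLp_comp_smul (hu.comp_measurePreserving (Measure.measurePreserving_sub_left volume x)) hs
  exact h1.integrable_mul h2.star

/-- The bound is uniform in `x`; at fixed `ε` it makes the Wigner transform bounded, hence
integrable against a test function. -/
lemma exists_integral_norm_shift_mul_shift_le {u : E → ℂ} (hu : MemLp u 2 volume) {s : ℝ}
    (hs : s ≠ 0) : ∃ C, ∀ x : E,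
      ∫ y : E, ‖u (x + s • y) * (starRingEnd ℂ) (u (x - s • y))‖ ≤ C := by
  have hi : Integrable fun z => ‖u z‖ ^ 2 := hu.integrable_norm_pow two_ne_zero
  refine ⟨(|(s ^ 3)⁻¹| * ∫ z, ‖u z‖ ^ 2) + (|(s ^ 3)⁻¹| * ∫ z, ‖u z‖ ^ 2), fun x => ?_⟩
  have e1 : ∫ y : E, ‖u (x + s • y)‖ ^ 2 = |(s ^ 3)⁻¹| * ∫ z, ‖u z‖ ^ 2 := by
    have h := Measure.integral_comp_smul (volume : Measure E) (fun z => ‖u (x + z)‖ ^ 2) s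
    rw [integral_add_left_eq_self (fun z => ‖u z‖ ^ 2) x, finrank_euclideanSpace,
      Fintype.card_fin] at h
    exact h
  have e2 : ∫ y : E, ‖u (x - s • y)‖ ^ 2 = |(s ^ 3)⁻¹| * ∫ z, ‖u z‖ ^ 2 := by
    have h := Measure.integral_comp_smul (volume : Measure E) (fun z => ‖u (x - z)‖ ^ 2) s
    rw [integral_sub_left_eq_self (fun z => ‖u z‖ ^ 2) volume x, finrank_euclideanSpace,
      Fintype.card_fin] at h
    exact h
  have i1 : Integrable fun y : E => ‖u (x + s • y)‖ ^ 2 :=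
    (hi.comp_add_left x).comp_smul hs
  have i2 : Integrable fun y : E => ‖u (x - s • y)‖ ^ 2 :=
    (hi.comp_sub_left x).comp_smul hs
  refine le_trans ?_ (add_le_add e1.le e2.le)
  rw [← integral_add i1 i2]
  refine integral_mono (integrable_shift_mul_shift hu hs x).norm (i1.add i2) fun y => ?_
  simp only [norm_mul, RCLike.norm_conj]
  nlinarith [sq_nonneg (‖u (x + s • y)‖ - ‖u (x - s • y)‖), sq_nonneg (‖u (x + s • y)‖),
    sq_nonneg (‖u (x - s • y)‖), Pi.add_apply (fun y : E => ‖u (x + s • y)‖ ^ 2)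
      (fun y : E => ‖u (x - s • y)‖ ^ 2) y]

lemma wigner_congr_ae {ε : ℝ} (hε : 0 < ε) {u v : E → ℂ} (h : u =ᵐ[volume] v) :
    wigner ε u = wigner ε v := by
  ext x ξ
  have hs : ε / 2 ≠ 0 := by positivity
  have hq : Measure.QuasiMeasurePreserving (fun y : E => (ε / 2) • y) volume volume :=
    Measure.quasiMeasurePreserving_smul volume hs
  have h1 := ((measurePreserving_add_left volume x).quasiMeasurePreserving.comp hq).ae_eq_comp h
  have h2 := ((Measure.measurePreserving_sub_left volume x).quasiMeasurePreserving.comp hq).ae_eq_comp h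
  unfold wigner fourier
  congr 1
  refine integral_congr_ae ?_
  filter_upwards [h1, h2] with y e1 e2
  simp only [Function.comp_apply] at e1 e2
  rw [e1, e2]

/-- The pairing of a Wigner transform with a test function is a sesquilinear form whose kernel
is the Fourier transform of the test function in the momentum variable. -/
lemma integral_wigner_mul {ε : ℝ} (hε : 0 < ε) (hε2 : ε ≤ 2) {u : E → ℂ} (hu : MemLp u 2 volume)
    {φ : E × E → ℂ} (hφ : IsTestFunction φ) :
    ∫ p : E × E, wigner ε u p.1 p.2 * φ p =
      wignerForm (partialFourier φ) (ε / 2) (fun _ => 1) u u := by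
  -- A strongly measurable representative makes the integrand jointly measurable in `(x, ξ, y)`.
  obtain ⟨v, hvm, huv⟩ : ∃ v : E → ℂ, StronglyMeasurable v ∧ u =ᵐ[volume] v :=
    ⟨hu.1.mk u, hu.1.stronglyMeasurable_mk, hu.1.ae_eq_mk⟩
  have hv : MemLp v 2 volume := hu.ae_eq huv
  rw [wigner_congr_ae hε huv, wignerForm_congr_ae huv huv]
  set s := ε / 2 with hs
  have hs0 : s ≠ 0 := by positivity
  have hs1 : |s| ≤ 1 := by rw [abs_of_pos (by positivity)]; linarith
  set c : ℂ := ((2 * Real.pi : ℝ) : ℂ)⁻¹ ^ 3 with hc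
  obtain ⟨C, hC⟩ := exists_integral_norm_shift_mul_shift_le hv hs0
  have vm := hvm.measurable
  have cm := Complex.continuous_conj.measurable
  have hφi : Integrable φ := hφ.1.continuous.integrable_of_hasCompactSupport hφ.2
  have i1 : Integrable fun p : E × E => wigner ε v p.1 p.2 * φ p := by
    refine hφi.bdd_mul (c := ‖c‖ * C) ?_ (.of_forall fun p => ?_)
    · refine (StronglyMeasurable.const_mul ?_ c).aestronglyMeasurable
      refine StronglyMeasurable.integral_prod_right (ν := (volume : Measure E)) (f := fun (p : E × E) (y : E) =>
        Complex.exp (-Complex.I * ((inner ℝ y p.2 : ℝ) : ℂ)) *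
          (v (p.1 + s • y) * (starRingEnd ℂ) (v (p.1 - s • y)))) ?_
      exact Measurable.stronglyMeasurable (by fun_prop)
    · rw [wigner, fourier, norm_mul]
      refine mul_le_mul_of_nonneg_left ((norm_integral_le_integral_norm _).trans
        (le_trans (le_of_eq ?_) (hC p.1))) (norm_nonneg _)
      congr 1 with y
      rw [norm_mul, norm_exp_neg_I_mul, one_mul]
  have hvw : MemLp v 2 (weightMeasure 1) := hv.mono_measure (weightMeasure_le_volume le_rfl)
  have hve : hvw.toLp v =ᵐ[volume] v :=
    volume_absolutelyContinuous_weightMeasure.ae_le hvw.coeFn_toLp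
  have i2 : Integrable fun p : E × E =>
      (v (p.1 + s • p.2) * (starRingEnd ℂ) (v (p.1 - s • p.2))) * partialFourier φ p := by
    refine (hφ.isKernel.integrable_form hs1 (σ := fun _ => 1) ⟨measurable_const, by simp⟩
      (hvw.toLp v) (hvw.toLp v)).congr ?_
    filter_upwards [(quasiMeasurePreserving_add_smul s).ae_eq_comp hve,
      (quasiMeasurePreserving_sub_smul s).ae_eq_comp hve] with p h1 h2
    simp only [Function.comp_apply] at h1 h2
    rw [h1, h2, one_mul]
  simp only [wignerForm, one_mul]
  rw [Measure.volume_eq_prod] at i1 i2 ⊢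
  rw [integral_prod _ i1, integral_prod _ i2]
  congr 1 with x
  simp only [wigner, partialFourier, fourier, ← hc, ← hs]
  have iw := integrable_shift_mul_shift hv hs0 x
  have ix := integrable_slice hφ x
  -- For fixed `x` the integrand is a bounded phase times a product of an integrable function of `ξ`
  -- and one of `y`.
  have hsw := integral_integral_swap (μ := (volume : Measure E)) (ν := (volume : Measure E))
    (f := fun ξ y => c * (Complex.exp (-Complex.I * ((inner ℝ y ξ : ℝ) : ℂ)) *
      ((φ (x, ξ)) * (v (x + s • y) * (starRingEnd ℂ) (v (x - s • y)))))) (by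
        refine Integrable.const_mul ?_ c
        exact (ix.mul_prod iw).bdd_mul (c := 1)
          (Continuous.aestronglyMeasurable (by fun_prop))
          (.of_forall fun p => (norm_exp_neg_I_mul _).le))
  calc _ = ∫ ξ, ∫ y, c * (Complex.exp (-Complex.I * ((inner ℝ y ξ : ℝ) : ℂ)) *
      ((φ (x, ξ)) * (v (x + s • y) * (starRingEnd ℂ) (v (x - s • y))))) := by
        congr 1 with ξ
        rw [integral_const_mul, mul_assoc, ← integral_mul_const]
        congr 2 with y
        ring
    _ = _ := hsw
    _ = _ := by
        congr 1 with y
        rw [integral_const_mul, mul_left_comm]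
        congr 1
        rw [← integral_const_mul]
        refine integral_congr_ae (.of_forall fun ξ => ?_)
        simp only
        rw [real_inner_comm y ξ]
        ring

lemma exp_mul_conj_exp (r s : ℝ) : Complex.exp (-Complex.I * (r : ℂ)) *
    (starRingEnd ℂ) (Complex.exp (-Complex.I * (s : ℂ))) =
      Complex.exp (-Complex.I * ((r - s : ℝ) : ℂ)) := by
  rw [← Complex.exp_conj, ← Complex.exp_add, map_mul, map_neg, Complex.conj_I, Complex.conj_ofReal]
  congr 1
  push_cast
  ring

/-- The quadratic form of a superposition of two outgoing waves. -/
lemma IsKernel.wignerForm_superposition {Φ : E × E → ℂ} (hΦ : IsKernel Φ) {ε : ℝ} (hε : 0 < ε)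
    (hε2 : ε ≤ 2) {q r : E} {u : E → ℂ} {F G : WeightedL2}
    (hu : u =ᵐ[volume] fun x => Complex.exp (-Complex.I * ((‖x - q‖ / ε : ℝ) : ℂ)) * F x +
      Complex.exp (-Complex.I * ((‖x - r‖ / ε : ℝ) : ℂ)) * G x) :
    wignerForm Φ (ε / 2) (fun _ => 1) u u =
      (wignerForm Φ (ε / 2) (phase ε q q) F F + wignerForm Φ (ε / 2) (phase ε q r) F G) +
      (wignerForm Φ (ε / 2) (phase ε r q) G F + wignerForm Φ (ε / 2) (phase ε r r) G G) := by
  have hs : |ε / 2| ≤ 1 := by rw [abs_of_pos (by positivity)]; linarith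
  rw [wignerForm_congr_ae hu hu]
  have i1 := hΦ.integrable_form hs (isPhase_phase ε q q) F F
  have i2 := hΦ.integrable_form hs (isPhase_phase ε q r) F G
  have i3 := hΦ.integrable_form hs (isPhase_phase ε r q) G F
  have i4 := hΦ.integrable_form hs (isPhase_phase ε r r) G G
  unfold wignerForm
  rw [← integral_add i1 i2, ← integral_add i3 i4]
  refine Eq.trans ?_ (integral_add (i1.add i2) (i3.add i4))
  refine integral_congr_ae (.of_forall fun p => ?_)
  have key : ∀ a b : E, phase ε a b p =
      Complex.exp (-Complex.I * ((‖p.1 + (ε / 2) • p.2 - a‖ / ε : ℝ) : ℂ)) *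
        (starRingEnd ℂ) (Complex.exp (-Complex.I * ((‖p.1 - (ε / 2) • p.2 - b‖ / ε : ℝ) : ℂ))) :=
    fun a b => by rw [exp_mul_conj_exp, phase, sub_div]
  simp only [key, map_add, map_mul]
  ring

/-! ### The limit of the Wigner transforms -/

lemma memLp_amplitude {ε : ℝ} (hε : 0 < ε) (a : ℝ) (S : Lp ℂ 2 (volume : Measure E)) :
    MemLp (amplitude ε a S) 2 volume := by
  refine (memLp_wave hε a S).of_le (aestronglyMeasurable_amplitude hε a S) (.of_forall fun x => ?_)
  rw [amplitude, norm_mul, norm_exp_I_mul, one_mul]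

lemma memLp_farField {T : E → ℂ} (hT : Measurable T) (hT2 : MemLp T 2 deltaSphere) :
    MemLp (farField T) 2 (weightMeasure 1) := by
  refine ⟨(measurable_farField hT).aestronglyMeasurable, ?_⟩
  rw [eLpNorm_farField hT]
  exact ENNReal.mul_lt_top farFieldConst_rpow_ne_top.lt_top hT2.2

lemma aestronglyMeasurable_of_weightMeasure {f : E → ℂ}
    (hf : AEStronglyMeasurable f (weightMeasure 1)) : AEStronglyMeasurable f volume :=
  hf.mono_ac volume_absolutelyContinuous_weightMeasure

lemma memLp_weightMeasure_comp_sub {f : E → ℂ} (hf : MemLp f 2 (weightMeasure 1)) (q : E) :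
    MemLp (fun x => f (x - q)) 2 (weightMeasure 1) := by
  obtain ⟨C, hC, h⟩ := exists_eLpNorm_comp_sub_le q
  have hf' := aestronglyMeasurable_of_weightMeasure hf.1
  refine ⟨aestronglyMeasurable_weightMeasure (hf'.comp_quasiMeasurePreserving
    (measurePreserving_sub_right volume q).quasiMeasurePreserving) 1, ?_⟩
  exact (h f hf').trans_lt (ENNReal.mul_lt_top hC.lt_top hf.2)

lemma tendsto_eLpNorm_comp_sub {f : ℕ → E → ℂ} (hf : ∀ k, AEStronglyMeasurable (f k) volume)
    (h0 : Tendsto (fun k => eLpNorm (f k) 2 (weightMeasure 1)) atTop (𝓝 0)) (q : E) :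
    Tendsto (fun k => eLpNorm (fun x => f k (x - q)) 2 (weightMeasure 1)) atTop (𝓝 0) := by
  obtain ⟨C, hC, h⟩ := exists_eLpNorm_comp_sub_le q
  have := ENNReal.Tendsto.const_mul h0 (.inr hC)
  rw [mul_zero] at this
  exact tendsto_of_tendsto_of_tendsto_of_le_of_le tendsto_const_nhds this (fun _ => zero_le)
    fun k => h _ (hf k)

/-- The limit of the Wigner transforms of the solutions, as a sum of two quadratic forms in the
far fields of the sources. -/
lemma tendsto_integral_wigner {e a : ℕ → ℝ} (h : Scales e a) {S₀ S₁ T₀ T₁ : E → ℂ} {q : E}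
    (hq : q ≠ 0) (hS₀ : MemB S₀) (hS₁ : MemB S₁) (hT₀ : Measurable T₀) (hT₁ : Measurable T₁)
    (hT₀2 : MemLp T₀ 2 deltaSphere) (hT₁2 : MemLp T₁ 2 deltaSphere)
    (hA₀ : Tendsto (fun k => eLpNorm (fun x =>
      amplitude (e k) (a k) (hS₀.memLp.toLp S₀) x - farField T₀ x) 2 (weightMeasure 1)) atTop (𝓝 0))
    (hA₁ : Tendsto (fun k => eLpNorm (fun x =>
      amplitude (e k) (a k) (hS₁.memLp.toLp S₁) x - farField T₁ x) 2 (weightMeasure 1)) atTop (𝓝 0))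
    {u : ℕ → E → ℂ} (hu : ∀ k, IsHelmholtzSolution (e k) (a k) (source S₀ S₁ q (e k)) (u k))
    {φ : E × E → ℂ} (hφ : IsTestFunction φ) :
    Tendsto (fun k => ∫ p : E × E, wigner (e k) (u k) p.1 p.2 * φ p) atTop
      (𝓝 (wignerForm (partialFourier φ) 0 (limitPhase 0 0) (farField T₀) (farField T₀) +
        wignerForm (partialFourier φ) 0 (limitPhase q q) (fun x => farField T₁ (x - q))
          fun x => farField T₁ (x - q))) := by
  have hΦ := hφ.isKernel
  set S₀' := hS₀.memLp.toLp S₀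
  set S₁' := hS₁.memLp.toLp S₁
  have mF : ∀ k, MemLp (amplitude (e k) (a k) S₀') 2 (weightMeasure 1) := fun k =>
    (memLp_amplitude (h.pos k) _ _).mono_measure (weightMeasure_le_volume le_rfl)
  have mG : ∀ k, MemLp (fun x => amplitude (e k) (a k) S₁' (x - q)) 2 (weightMeasure 1) := fun k =>
    (memLp_comp_sub (memLp_amplitude (h.pos k) _ _) q).mono_measure (weightMeasure_le_volume le_rfl)
  have mF₀ := memLp_farField hT₀ hT₀2
  have mG₀ := memLp_weightMeasure_comp_sub (memLp_farField hT₁ hT₁2) q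
  have tF : Tendsto (fun k => (mF k).toLp _) atTop (𝓝 (mF₀.toLp _)) :=
    (Lp.tendsto_Lp_iff_tendsto_eLpNorm'' _ mF _ mF₀).2 hA₀
  have tG : Tendsto (fun k => (mG k).toLp _) atTop (𝓝 (mG₀.toLp _)) :=
    (Lp.tendsto_Lp_iff_tendsto_eLpNorm'' _ mG _ mG₀).2
      (tendsto_eLpNorm_comp_sub (f := fun k x => amplitude (e k) (a k) S₁' x - farField T₁ x)
        (fun k => (aestronglyMeasurable_amplitude (h.pos k) _ _).sub
          (measurable_farField hT₁).aestronglyMeasurable) hA₁ q)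
  have cF : ∀ {f : E → ℂ} (m : MemLp f 2 (weightMeasure 1)), m.toLp f =ᵐ[volume] f := fun m =>
    volume_absolutelyContinuous_weightMeasure.ae_le m.coeFn_toLp
  have hu' : ∀ k, u k =ᵐ[volume] fun x =>
      Complex.exp (-Complex.I * ((‖x - 0‖ / e k : ℝ) : ℂ)) * (mF k).toLp _ x +
      Complex.exp (-Complex.I * ((‖x - q‖ / e k : ℝ) : ℂ)) * (mG k).toLp _ x := fun k => by
    have hw : ∀ S x, Complex.exp (-Complex.I * ((‖x‖ / e k : ℝ) : ℂ)) *
        amplitude (e k) (a k) S x = wave (e k) (a k) S x := fun S x => by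
      rw [amplitude, ← mul_assoc, ← Complex.exp_add, neg_mul, neg_add_cancel, Complex.exp_zero,
        one_mul]
    filter_upwards [(hu k).ae_eq_wave (h.pos k) (h.absorption_pos k) hS₀.memLp hS₁.memLp,
      cF (mF k), cF (mG k)] with x h1 h2 h3
    rw [h1, h2, h3, sub_zero, hw, hw]
  have e2 : ∀ k, e k ≤ 2 := fun k => (h.le_one k).trans (by norm_num)
  -- Of the four products of the two waves, the two with equal centres converge and the two mixed
  -- ones vanish.
  have hsum := ((tendsto_wignerForm_diag hΦ 0 h.pos h.le_one h.tendsto tF tF).add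
    (tendsto_wignerForm_of_ne hΦ hq.symm h.pos h.le_one h.tendsto tF tG)).add
    ((tendsto_wignerForm_of_ne hΦ hq h.pos h.le_one h.tendsto tG tF).add
    (tendsto_wignerForm_diag hΦ q h.pos h.le_one h.tendsto tG tG))
  rw [add_zero, zero_add, wignerForm_congr_ae (cF mF₀) (cF mF₀),
    wignerForm_congr_ae (cF mG₀) (cF mG₀)] at hsum
  refine hsum.congr fun k => ?_
  rw [integral_wigner_mul (h.pos k) (e2 k) (hu k).1 hφ,
    hΦ.wignerForm_superposition (h.pos k) (e2 k) (hu' k)]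

/-- With equal centres the shifts by `+y/2` and `-y/2` contribute equally, and the result is a plane
wave in `y`. Fourier inversion then evaluates `φ` at `ξ = -(x - q)/|x - q|`. -/
lemma inner_exp_limitPhase (q : E) (p : E × E) : limitPhase q q p =
    Complex.exp (-Complex.I * ((inner ℝ p.2 (‖p.1 - q‖⁻¹ • (p.1 - q)) : ℝ) : ℂ)) := by
  rw [limitPhase, inner_smul_right, inner_smul_right, real_inner_comm]
  congr 3
  ring

/-- The limit form, evaluated by Fourier inversion. -/
lemma wignerForm_limitPhase {T : E → ℂ} (hT : Measurable T) (hT2 : MemLp T 2 deltaSphere) (q : E)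
    {φ : E × E → ℂ} (hφ : IsTestFunction φ) :
    wignerForm (partialFourier φ) 0 (limitPhase q q) (fun x => farField T (x - q))
        (fun x => farField T (x - q)) =
      ∫ x, ((‖farField T x‖ ^ 2 : ℝ) : ℂ) * φ (x + q, -(‖x‖⁻¹ • x)) ∧
    Integrable fun x => ((‖farField T x‖ ^ 2 : ℝ) : ℂ) * φ (x + q, -(‖x‖⁻¹ • x)) := by
  have hm := memLp_weightMeasure_comp_sub (memLp_farField hT hT2) q
  have cF : hm.toLp _ =ᵐ[volume] fun x => farField T (x - q) :=
    volume_absolutelyContinuous_weightMeasure.ae_le hm.coeFn_toLp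
  have hi := hφ.isKernel.integrable_form (s := 0) (by simp) (isPhase_limitPhase q q)
    (hm.toLp _) (hm.toLp _)
  have hi' : Integrable fun p : E × E => limitPhase q q p * (farField T (p.1 - q) *
      (starRingEnd ℂ) (farField T (p.1 - q))) * partialFourier φ p := by
    refine hi.congr ?_
    filter_upwards [(quasiMeasurePreserving_add_smul 0).ae_eq_comp cF,
      (quasiMeasurePreserving_sub_smul 0).ae_eq_comp cF] with p h1 h2
    simp only [Function.comp_apply, zero_smul, add_zero, sub_zero] at h1 h2 ⊢
    rw [h1]
  have e : ∀ x, ∫ y, limitPhase q q (x, y) * (farField T (x - q) *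
      (starRingEnd ℂ) (farField T (x - q))) * partialFourier φ (x, y) =
      ((‖farField T (x - q)‖ ^ 2 : ℝ) : ℂ) * φ (x, -(‖x - q‖⁻¹ • (x - q))) := fun x => by
    rw [← integral_exp_mul_partialFourier hφ, ← integral_const_mul]
    congr 1
    ext1 y
    rw [inner_exp_limitPhase, Complex.mul_conj, Complex.normSq_eq_norm_sq]
    ring
  rw [Measure.volume_eq_prod] at hi'
  have h1 := integral_prod _ hi'
  have h2 := hi'.integral_prod_left
  simp only [e] at h1 h2
  have h3 := h2.comp_add_right q
  simp only [add_sub_cancel_right] at h3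
  refine ⟨?_, h3⟩
  simp only [wignerForm, zero_smul, add_zero, sub_zero]
  rw [Measure.volume_eq_prod, h1, ← integral_add_right_eq_self _ q]
  simp only [add_sub_cancel_right]

/-! ### Ray integrals, the radiation condition and the transport equation -/

/-- The energy of the far field, in polar coordinates. -/
lemma integral_normSq_farField_mul {T : E → ℂ} {q : E} {φ : E × E → ℂ}
    (hi : Integrable fun x => ((‖farField T x‖ ^ 2 : ℝ) : ℂ) * φ (x + q, -(‖x‖⁻¹ • x))) :
    ∫ x, ((‖farField T x‖ ^ 2 : ℝ) : ℂ) * φ (x + q, -(‖x‖⁻¹ • x)) =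
      ((8 * Real.pi ^ 4 : ℝ) : ℂ) *
        ∫ ξ, ((‖T ξ‖ ^ 2 : ℝ) : ℂ) * rayIntegral φ (q, ξ) ∂deltaSphere := by
  -- The reflection sends the point `rθ` to `-rθ`, where the frequency is `θ`, so the radial
  -- integral runs over `(q - rθ, θ)`. The Jacobian cancels `r⁻²`, and the constant is `2 · (2π²)² =
  -- 8π⁴`.
  rw [← integral_neg_eq_self, integral_polar hi.comp_neg, ← integral_const_mul,
    ← integral_const_mul]
  refine integral_congr_ae ?_
  filter_upwards [ae_deltaSphere_norm] with θ hθ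
  have e : ∀ r ∈ Set.Ioi (0 : ℝ), (r : ℂ) ^ 2 * (((‖farField T (-(r • θ))‖ ^ 2 : ℝ) : ℂ) *
      φ (-(r • θ) + q, -(‖-(r • θ)‖⁻¹ • -(r • θ)))) =
      ((4 * Real.pi ^ 4 * ‖T θ‖ ^ 2 : ℝ) : ℂ) * φ (q - r • θ, θ) := fun r hr => by
    have hr0 : 0 < r := hr
    have hn : ‖-(r • θ)‖ = r := by rw [norm_neg, norm_smul, hθ, mul_one, Real.norm_of_nonneg hr0.le]
    have hd : -(‖-(r • θ)‖⁻¹ • -(r • θ)) = θ := by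
      rw [hn, smul_neg, neg_neg, inv_smul_smul₀ hr0.ne']
    rw [farField, hd, hn, neg_add_eq_sub, norm_mul, norm_neg, Complex.norm_real,
      Real.norm_of_nonneg (by positivity)]
    have : (r : ℂ) ≠ 0 := by exact_mod_cast hr0.ne'
    push_cast
    field_simp
    ring
  rw [setIntegral_congr_fun measurableSet_Ioi e, integral_const_mul, rayIntegral]
  push_cast
  ring

lemma IsTestFunction.transport {ψ : E × E → ℂ} (hψ : IsTestFunction ψ) :
    IsTestFunction (transport ψ) := by
  refine ⟨?_, (hψ.2.fderiv ℝ).mono fun p hp => ?_⟩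
  · have h1 : ContDiff ℝ ∞ (fderiv ℝ ψ) := hψ.1.fderiv_right (mod_cast le_top)
    exact h1.clm_apply (contDiff_snd.prodMk contDiff_const)
  · rw [Function.mem_support] at hp ⊢
    intro h
    exact hp (by rw [TwoSource.transport, h, zero_apply])

/-- The fundamental theorem of calculus along the backward ray: `t ↦ ψ(x - tξ, ξ)` has derivative
minus the integrand. It vanishes for large `t` because the ray moves with unit speed and leaves the
support. -/
lemma rayIntegral_transport {ψ : E × E → ℂ} (hψ : IsTestFunction ψ) (x : E) {ξ : E} (hξ : ‖ξ‖ = 1) :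
    rayIntegral (transport ψ) (x, ξ) = ψ (x, ξ) := by
  set f : ℝ → ℂ := fun t => ψ (x - t • ξ, ξ) with hf
  have hd : ∀ t, HasDerivAt f (-transport ψ (x - t • ξ, ξ)) t := fun t => by
    have h1 : HasDerivAt (fun t : ℝ => (x - t • ξ, ξ)) (-ξ, (0 : E)) t := by
      refine HasDerivAt.prodMk ?_ (hasDerivAt_const t ξ)
      simpa using ((hasDerivAt_id t).smul_const ξ).const_sub x
    have h2 := ((hψ.1.differentiable (by simp)) (x - t • ξ, ξ)).hasFDerivAt.comp_hasDerivAt t h1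
    have h3 : fderiv ℝ ψ (x - t • ξ, ξ) (-ξ, (0 : E)) = -transport ψ (x - t • ξ, ξ) := by
      rw [transport, ← map_neg, Prod.neg_mk, neg_zero]
    rw [h3] at h2
    exact h2
  obtain ⟨K, hK⟩ := hψ.2.isCompact.isBounded.subset_closedBall 0
  have hc : HasCompactSupport f := by
    refine HasCompactSupport.intro (isCompact_closedBall (0 : ℝ) (K + ‖x‖)) fun t ht => ?_
    refine image_eq_zero_of_notMem_tsupport (f := ψ) fun h => ht ?_
    have h1 := mem_closedBall_zero_iff.1 (hK h)
    have h2 : ‖x - t • ξ‖ ≤ ‖(x - t • ξ, ξ)‖ := norm_fst_le (x - t • ξ, ξ)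
    have h3 : ‖t • ξ‖ ≤ ‖x‖ + ‖x - t • ξ‖ := by
      have := norm_sub_le x (x - t • ξ)
      rwa [sub_sub_cancel] at this
    rw [norm_smul, hξ, mul_one] at h3
    rw [mem_closedBall_zero_iff]
    linarith
  have hsm : ContDiff ℝ 1 f := (hψ.1.of_le (mod_cast le_top)).comp (by fun_prop)
  have h := hc.integral_Ioi_deriv_eq hsm 0
  simp only [fun t => (hd t).deriv, integral_neg, neg_inj] at h
  simpa [rayIntegral, hf] using h

/-- The source term sees only `|ξ| = 1`, so the behaviour of ray integrals near `ξ = 0` is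
irrelevant. -/
lemma pairQ_congr {q : E} {T₀ T₁ : E → ℂ} {ψ ψ' : E × E → ℂ}
    (h : ∀ x ξ : E, ‖ξ‖ = 1 → ψ (x, ξ) = ψ' (x, ξ)) : pairQ q T₀ T₁ ψ = pairQ q T₀ T₁ ψ' := by
  unfold pairQ
  congr 2 <;>
  · refine integral_congr_ae ?_
    filter_upwards [ae_deltaSphere_norm] with ξ hξ
    rw [h _ ξ hξ]

/-- The radiation condition implies the transport equation. -/
lemma transport_eq_of_radiation {q : E} {T₀ T₁ : E → ℂ} {μ : Measure (E × E)}
    (h : ∀ R : E × E → ℂ, IsTestFunction R → ∫ p, R p ∂μ = -pairQ q T₀ T₁ (rayIntegral R))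
    {ψ : E × E → ℂ} (hψ : IsTestFunction ψ) : -∫ p, transport ψ p ∂μ = pairQ q T₀ T₁ ψ := by
  rw [h _ hψ.transport, neg_neg]
  exact pairQ_congr fun x ξ hξ => rayIntegral_transport hψ x hξ

/-- The conditions on the scales hold from some index on, and dropping finitely many terms does not
change the limit. The lower bound `ε ^ γ` supplies the positivity of the absorption. -/
lemma exists_scales {α : ℝ → ℝ} {γ : ℝ} (hα : Tendsto α (𝓝[>] 0) (𝓝 0))
    (hγ : ∀ᶠ ε in 𝓝[>] (0 : ℝ), ε ^ γ ≤ α ε) {e : ℕ → ℝ} (he : Tendsto e atTop (𝓝[>] 0)) :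
    ∀ᶠ n in atTop, Scales (fun k => e (k + n)) fun k => α (e (k + n)) := by
  have h0 : Tendsto e atTop (𝓝 0) := he.mono_right nhdsWithin_le_nhds
  have ha : Tendsto (fun k => α (e k)) atTop (𝓝 0) := hα.comp he
  have hall : ∀ᶠ k in atTop, 0 < e k ∧ e k ≤ 1 ∧ 0 < α (e k) ∧ α (e k) ≤ 1 := by
    filter_upwards [he.eventually hγ, he.eventually self_mem_nhdsWithin,
      h0.eventually_le_const one_pos, ha.eventually_le_const one_pos] with k h1 h2 h3 h4
    exact ⟨h2, h3, (Real.rpow_pos_of_pos h2 γ).trans_le h1, h4⟩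
  filter_upwards [eventually_forall_ge_atTop.2 hall] with n hn
  have hk := fun k => hn (k + n) (Nat.le_add_left n k)
  exact ⟨fun k => (hk k).1, fun k => (hk k).2.1, (tendsto_add_atTop_iff_nat n).2 h0,
    fun k => (hk k).2.2.1, fun k => (hk k).2.2.2, (tendsto_add_atTop_iff_nat n).2 ha⟩

/-- Every Wigner measure is the outgoing solution of the transport equation. -/
lemma IsWignerMeasure.integral_eq {α : ℝ → ℝ} {γ : ℝ} (hα : Tendsto α (𝓝[>] 0) (𝓝 0))
    (hγ : ∀ᶠ ε in 𝓝[>] (0 : ℝ), ε ^ γ ≤ α ε) {S₀ S₁ T₀ T₁ : E → ℂ} {q : E} (hq : q ≠ 0)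
    (hS₀ : MemB S₀) (hS₁ : MemB S₁) (hT₀ : Measurable T₀) (hT₁ : Measurable T₁)
    (hT₀2 : MemLp T₀ 2 deltaSphere) (hT₁2 : MemLp T₁ 2 deltaSphere)
    (hA₀ : ∀ e a : ℕ → ℝ, Scales e a → Tendsto (fun k => eLpNorm (fun x =>
      amplitude (e k) (a k) (hS₀.memLp.toLp S₀) x - farField T₀ x) 2 (weightMeasure 1)) atTop (𝓝 0))
    (hA₁ : ∀ e a : ℕ → ℝ, Scales e a → Tendsto (fun k => eLpNorm (fun x =>
      amplitude (e k) (a k) (hS₁.memLp.toLp S₁) x - farField T₁ x) 2 (weightMeasure 1)) atTop (𝓝 0))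
    {u : ℝ → E → ℂ}
    (hu : ∀ᶠ ε in 𝓝[>] (0 : ℝ), IsHelmholtzSolution ε (α ε) (source S₀ S₁ q ε) (u ε))
    {e : ℕ → ℝ} (he : Tendsto e atTop (𝓝[>] 0)) {μ : Measure (E × E)} (hμ : IsWignerMeasure u e μ)
    {φ : E × E → ℂ} (hφ : IsTestFunction φ) :
    ∫ p, φ p ∂μ = -pairQ q T₀ T₁ (rayIntegral φ) := by
  obtain ⟨n, hn, hun⟩ := ((exists_scales hα hγ he).and
    (eventually_forall_ge_atTop.2 (he.eventually hu))).exists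
  have h := tendsto_integral_wigner hn hq hS₀ hS₁ hT₀ hT₁ hT₀2 hT₁2 (hA₀ _ _ hn) (hA₁ _ _ hn)
    (fun k => hun (k + n) (Nat.le_add_left n k)) hφ
  -- The Wigner transforms converge along the whole sequence of scales to an explicit limit, which
  -- must agree with the pairing with `μ`.
  rw [tendsto_nhds_unique ((tendsto_add_atTop_iff_nat n).2 (hμ.tendsto φ hφ)) h]
  obtain ⟨e₀, i₀⟩ := wignerForm_limitPhase hT₀ hT₀2 0 hφ
  obtain ⟨e₁, i₁⟩ := wignerForm_limitPhase hT₁ hT₁2 q hφ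
  rw [integral_normSq_farField_mul i₀] at e₀
  rw [integral_normSq_farField_mul i₁] at e₁
  simp only [sub_zero] at e₀
  rw [e₁, e₀, pairQ]
  ring

end TwoSource

end

theorem theorem4p2
    (S₀ S₁ : TwoSource.E → ℂ) (q₁ : TwoSource.E) (hq₁ : q₁ ≠ 0)
    (α : ℝ → ℝ) (γ N : ℝ) (hγ : 0 < γ)
    (hα : Tendsto α (𝓝[>] 0) (𝓝 0))
    (H1 : ∀ᶠ ε in 𝓝[>] (0 : ℝ), ε ^ γ ≤ α ε)
    (H2 : TwoSource.MemB S₀ ∧ TwoSource.MemB S₁)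
    (hN : 1 / 2 + 3 * γ / (γ + 1) < N)
    (H3 : MemLp (fun x => ((TwoSource.bracket x ^ N : ℝ) : ℂ) * S₀ x) 2 volume ∧
      MemLp (fun x => ((TwoSource.bracket x ^ N : ℝ) : ℂ) * S₁ x) 2 volume)
    (u : ℝ → TwoSource.E → ℂ)
    (hu : ∀ᶠ ε in 𝓝[>] (0 : ℝ),
      TwoSource.IsHelmholtzSolution ε (α ε) (TwoSource.source S₀ S₁ q₁ ε) (u ε))
    (e : ℕ → ℝ) (he : Tendsto e atTop (𝓝[>] 0))
    (μ : Measure (TwoSource.E × TwoSource.E)) (hμ : TwoSource.IsWignerMeasure u e μ) :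
    ∃ T₀ T₁ : TwoSource.E → ℂ,
      TwoSource.IsFourierTrace S₀ T₀ ∧ TwoSource.IsFourierTrace S₁ T₁ ∧
      -- the transport equation, in the sense of distributions on phase space
      (∀ ψ : TwoSource.E × TwoSource.E → ℂ, TwoSource.IsTestFunction ψ →
        -∫ p, TwoSource.transport ψ p ∂μ = TwoSource.pairQ q₁ T₀ T₁ ψ) ∧
      -- the radiation condition
      (∀ R : TwoSource.E × TwoSource.E → ℂ, TwoSource.IsTestFunction R →
        ∫ p, R p ∂μ = -TwoSource.pairQ q₁ T₀ T₁ (TwoSource.rayIntegral R)) := by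
  obtain ⟨hS₀, hS₁⟩ := H2
  obtain ⟨T₀, m₀, l₀, g₀, t₀, b₀, c₀⟩ := TwoSource.exists_trace hS₀
  obtain ⟨T₁, m₁, l₁, g₁, t₁, b₁, c₁⟩ := TwoSource.exists_trace hS₁
  have key : ∀ R : TwoSource.E × TwoSource.E → ℂ, TwoSource.IsTestFunction R →
      ∫ p, R p ∂μ = -TwoSource.pairQ q₁ T₀ T₁ (TwoSource.rayIntegral R) := fun R hR =>
    hμ.integral_eq hα H1 hq₁ hS₀ hS₁ m₀ m₁ l₀ l₁
      (fun _ _ h => TwoSource.tendsto_amplitude h hS₀ m₀ t₀ b₀ c₀)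
      (fun _ _ h => TwoSource.tendsto_amplitude h hS₁ m₁ t₁ b₁ c₁) hu he hR
  exact ⟨T₀, T₁, TwoSource.isFourierTrace_of_tendsto hS₀ l₀ t₀ b₀ c₀,
    TwoSource.isFourierTrace_of_tendsto hS₁ l₁ t₁ b₁ c₁,
    fun ψ hψ => TwoSource.transport_eq_of_radiation key hψ, key⟩
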